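/- **First Averaging Theorem.** Let $m_0,m_1,m_2,\upsilon_0>0$. Consider the planar three-body problem with a central body of mass $m_0$ and planets of masses $\varepsilon m_1,\varepsilon m_2$ (gravitational constant 1), whose rescaled heliocentric Hamiltonian is $$\mathcal H=\sum_{j=1,2}\Big(\frac{\|\tilde r_j\|^2}{2\hat m_j}-\frac{\mu_j\hat m_j}{\|r_j\|}\Big)+\varepsilon\Big(\frac{\tilde r_1\cdot\tilde r_2}{m_0}-\frac{m_1m_2}{\|r_1-r_2\|}\Big),\qquad \hat m_j=\frac{m_0m_j}{m_0+\varepsilon m_j},\quad \mu_j=m_0+\varepsilon m_j .$$ Let $(\Lambda_j,\lambda_j,x_j,\tilde x_j)$ be the Poincaré complex variables, $\Lambda_j=\hat m_j\sqrt{\mu_ja_j}$, $\lambda_j$ the mean longitude, $x_j=\sqrt{\Lambda_j}\sqrt{1-\sqrt{1-e_j^2}}\,e^{i\varpi_j}$, $\tilde x_j=-i\bar x_j$, where $a_j,e_j,\varpi_j$ are the semi-major axis, eccentricity and longitude of pericentre. Let $\Lambda_{j,0}=\hat m_j\sqrt{\mu_ja_{j,0}}$ with $a_{j,0}=\mu_j^{1/3}\upsilon_0^{-2/3}$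 (exact 1:1 resonance of frequency $\upsilon_0$), and let $Z_1=\Lambda_1-\Lambda_{1,0}$, $Z_2=\Lambda_1-\Lambda_{1,0}+\Lambda_2-\Lambda_{2,0}$, $\zeta_1=\lambda_1-\lambda_2$, $\zeta_2=\lambda_2$. In these variables $\mathcal H$ reads $H=H_K(Z)+H_P(Z,\zeta,x,\tilde x)$, where $$H_K(Z)=-\frac{\hat m_1^3\mu_1^2}{2(\Lambda_{1,0}+Z_1)^2}-\frac{\hat m_2^3\mu_2^2}{2(\Lambda_{2,0}+Z_2-Z_1)^2}$$ and $H_P$ is the term of $\mathcal H$ with the factor $\varepsilon$. For $\hat\Delta\in(0,\pi]$ and $\rho,\sigma>0$ let $\hat{\mathcal K}_{\rho,\sigma}$ be the set of $(Z,\zeta,x,\tilde x)\in\mathbb C^2\times(\mathbb C\times\mathbb C/2\pi\mathbb Z)\times\mathbb C^2\times\mathbb C^2$ with $|Z_j|\le\rho$, $\operatorname{dist}(\zeta_1,[\hat\Delta,2\pi-\hat\Delta])\le\sigma$, $|\operatorname{Im}\zeta_2|\le\sigma$, $|x_j|,|\tilde x_j|\le\sqrt{\rho\sigma}$. There is $c>0$,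 depending only on $m_0,m_1,m_2,\upsilon_0$, such that for all $\hat\Delta\in(0,\pi]$, $0<\sigma_0<c\hat\Delta$ and $1/7<\beta<1/2$ there are $C,\varepsilon_0>0$ with the following property for all $0<\varepsilon<\varepsilon_0$. Put $(\rho,\sigma)=\sigma_0(\varepsilon^\beta,1)$, $\hat{\mathcal K}_p=\hat{\mathcal K}_{p\rho,p\sigma}$, $\|\cdot\|_p=\sup_{\hat{\mathcal K}_p}|\cdot|$ ($|\cdot|$ being the maximum norm), and $\alpha=(1-2\beta)/5$; a bar over a function denotes its average over $\zeta_2$. Then $H_P$ extends holomorphically from the real points of $\hat{\mathcal K}_1$ (those with $Z,\zeta$ real and $\tilde x=-i\bar x$) to $\hat{\mathcal K}_1$; $H$ satisfies there the D'Alembert rule, i.e. it has an expansion $\sum f_{k,p,\tilde p}(Z,\zeta_1)\,x_1^{p_1}x_2^{p_2}\tilde x_1^{\tilde p_1}\tilde x_2^{\tilde p_2}e^{ik\zeta_2}$ over $k\in\mathbb Z$, $p,\tilde p\in\mathbb N^2$ with $k+p_1+p_2-\tilde p_1-\tilde p_2=0$; and there is a holomorphic, injective map $\overline\Upsilon:\hat{\mathcal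 K}_{1/3}\to\hat{\mathcal K}_1$, canonical for $dZ\wedge d\zeta+dx\wedge d\tilde x$ and mapping real points to real points, with $\hat{\mathcal K}_{1/6}\subseteq\overline\Upsilon(\hat{\mathcal K}_{1/3})\subseteq\hat{\mathcal K}_{1/2}$, such that $$H\circ\overline\Upsilon=H_K+\overline H_P+H_*\ \text{ on }\hat{\mathcal K}_{1/3},\qquad \|\overline H_*\|_{1/3}\le C\varepsilon^{2-\beta},\qquad \|H_*-\overline H_*\|_{1/3}\le C\,\varepsilon\exp(-\varepsilon^{-\alpha}),$$ and, writing $(Z,\zeta,x,\tilde x)=\overline\Upsilon(Z^*,\zeta^*,x^*,\tilde x^*)$, $$\|Z^*-Z\|_{1/3}\le C\varepsilon,\qquad \|\zeta^*-\zeta\|_{1/3}\le C\varepsilon^{1-\beta},\qquad \|(x^*,\tilde x^*)-(x,\tilde x)\|_{1/3}\le C\varepsilon^{1-\beta/2}.$$ Moreover $\overline\Upsilon$ preserves the D'Alembert rule: if $f$ is holomorphic on $\hat{\mathcal K}_{1/2}$ and satisfies the rule there, then $f\circ\overline\Upsilon$ satisfies it on $\hat{\mathcal K}_{1/3}$, and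 in particular $H\circ\overline\Upsilon$ satisfies it. Finally, the angular momentum $\mathcal C=Z_2-ix_1\tilde x_1-ix_2\tilde x_2$ (up to an additive constant) satisfies $\mathcal C\circ\overline\Upsilon=\mathcal C$, and $\mathcal C$ is a first integral of the averaged Hamiltonian: $\{\mathcal C,H_K+\overline H_P+\overline H_*\}=0$ on $\hat{\mathcal K}_{1/3}$. -/

import Mathlib

namespace Coorbital

noncomputable section

/-- Data of the planar planetary three-body problem: mass `m0` of the central body, masses
`eps * m 0` and `eps * m 1` of the two planets, and the common orbital frequency `ups` of the exact
1:1 resonance.  (Index `0 : Fin 2` is planet 1, index `1 : Fin 2` is planet 2.) -/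
structure ThreeBody where
  m0 : ℝ
  m : Fin 2 → ℝ
  ups : ℝ
  eps : ℝ

namespace ThreeBody

variable (S : ThreeBody)

/-- Reduced mass `m0 m_j / (m0 + eps m_j)`. -/
def redMass (j : Fin 2) : ℝ := S.m0 * S.m j / (S.m0 + S.eps * S.m j)

/-- `mu_j = m0 + eps m_j`. -/
def mu (j : Fin 2) : ℝ := S.m0 + S.eps * S.m j

/-- Keplerian part of the heliocentric Hamiltonian.  The plane of motion is `ℂ`, with its Euclidean
norm; `rt j` and `r j` are the momentum and the position of planet `j`. -/
def planetaryK (rt r : Fin 2 → ℂ) : ℝ :=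
  ∑ j, (‖rt j‖ ^ 2 / (2 * S.redMass j) - S.mu j * S.redMass j / ‖r j‖)

/-- Perturbation part of the heliocentric Hamiltonian. -/
def planetaryP (rt r : Fin 2 → ℂ) : ℝ :=
  S.eps * (inner ℝ (rt 0) (rt 1) / S.m0 - S.m 0 * S.m 1 / ‖r 0 - r 1‖)

/-- Exact-resonant semi-major axis. -/
def semiAxis0 (j : Fin 2) : ℝ := S.mu j ^ (1 / 3 : ℝ) * S.ups ^ (-(2 / 3) : ℝ)

/-- Exact-resonant action. -/
def Lam0 (j : Fin 2) : ℝ := S.redMass j * √(S.mu j * S.semiAxis0 j)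

end ThreeBody

/-- `IsKeplerState mh mu Lam lam x rt r`: the momentum `rt` and the position `r` are those of a body
of mass `mh`, attracted by a fixed centre of mass `mu`, whose Poincaré complex variables are
`(Lam, lam, x, -i conj x)`.  Here `a`, `e`, `w`, `E` are the semi-major axis, the eccentricity, the
longitude of the pericentre and the eccentric anomaly; `lam = w + (E - e sin E)` is the mean
longitude. -/
def IsKeplerState (mh mu Lam lam : ℝ) (x rt r : ℂ) : Prop :=
  ∃ a e w E : ℝ, 0 < a ∧ 0 ≤ e ∧ e < 1 ∧
    Lam = mh * √(mu * a) ∧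
    lam = w + (E - e * Real.sin E) ∧
    x = (√Lam * √(1 - √(1 - e ^ 2)) : ℝ) * Complex.exp (Complex.I * w) ∧
    r = a * ((Real.cos E - e : ℝ) + Complex.I * (√(1 - e ^ 2) * Real.sin E : ℝ))
          * Complex.exp (Complex.I * w) ∧
    rt = (mh * (√(mu / a ^ 3) * a / (1 - e * Real.cos E)) : ℝ)
          * ((-Real.sin E : ℝ) + Complex.I * (√(1 - e ^ 2) * Real.cos E : ℝ))
          * Complex.exp (Complex.I * w)

/-- Complexified phase space, with points `(Z, zeta, x, xt)` and the supremum norm; the angles are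
lifted to the universal cover. -/
abbrev Phase : Type := (Fin 2 → ℂ) × (Fin 2 → ℂ) × (Fin 2 → ℂ) × (Fin 2 → ℂ)

/-- The resonant actions `Z`. -/
abbrev Phase.act (p : Phase) : Fin 2 → ℂ := p.1
/-- The resonant angles `zeta`; `zeta 0` is semi-fast and `zeta 1` is the fast angle. -/
abbrev Phase.ang (p : Phase) : Fin 2 → ℂ := p.2.1
/-- The eccentricity variables `x`. -/
abbrev Phase.ecc (p : Phase) : Fin 2 → ℂ := p.2.2.1
/-- The conjugate eccentricity variables `xt`. -/
abbrev Phase.eccT (p : Phase) : Fin 2 → ℂ := p.2.2.2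

/-- The real phase point with resonant variables `(Z, zeta, x, -i conj x)`. -/
def realPoint (Z zeta : Fin 2 → ℝ) (x : Fin 2 → ℂ) : Phase :=
  (fun j => (Z j : ℂ), fun j => (zeta j : ℂ), x, fun j => -Complex.I * (starRingEnd ℂ) (x j))

/-- The set of all real phase points. -/
def realPoints : Set Phase := {p | ∃ Z zeta x, p = realPoint Z zeta x}

/-- The collisionless complex domain of widths `rho`, `sig`: `Z` in the polydisc of radius `rho`,
`zeta` at distance at most `sig` from the real set `D ≤ zeta 0 ≤ 2 π - D`, and `(x, xt)` in the
polydisc of radius `√(rho sig)`. -/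
def domain (D rho sig : ℝ) : Set Phase :=
  {p | (∀ j, ‖p.act j‖ ≤ rho) ∧
    (∃ t : Fin 2 → ℝ, t 0 ∈ Set.Icc D (2 * Real.pi - D) ∧ ∀ j, ‖p.ang j - t j‖ ≤ sig) ∧
    (∀ j, ‖p.ecc j‖ ≤ √(rho * sig)) ∧ (∀ j, ‖p.eccT j‖ ≤ √(rho * sig))}

/-- The Keplerian Hamiltonian in the resonant variables. -/
def ThreeBody.HK (S : ThreeBody) (p : Phase) : ℂ :=
  -((S.redMass 0 ^ 3 * S.mu 0 ^ 2 : ℝ) / (2 * (S.Lam0 0 + p.act 0) ^ 2))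
    - ((S.redMass 1 ^ 3 * S.mu 1 ^ 2 : ℝ) / (2 * (S.Lam0 1 + p.act 1 - p.act 0) ^ 2))

/-- `rt`, `r` are the heliocentric coordinates of the real point with resonant variables
`Lam_1 = Lam0_1 + Z_1`, `Lam_2 = Lam0_2 + Z_2 - Z_1`, `lam_1 = zeta_1 + zeta_2`,
`lam_2 = zeta_2`, and `x_1`, `x_2`. -/
def ThreeBody.IsState (S : ThreeBody) (Z zeta : Fin 2 → ℝ) (x rt r : Fin 2 → ℂ) : Prop :=
  IsKeplerState (S.redMass 0) (S.mu 0) (S.Lam0 0 + Z 0) (zeta 0 + zeta 1) (x 0) (rt 0) (r 0) ∧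
  IsKeplerState (S.redMass 1) (S.mu 1) (S.Lam0 1 + Z 1 - Z 0) (zeta 1) (x 1) (rt 1) (r 1)

/-- `HP` is the holomorphic extension to `K` of the planetary perturbation written in the resonant
variables: it is holomorphic on (a neighbourhood of) `K`, and at each real point of `K` which
represents the heliocentric state `(rt, r)` it takes the value of the perturbation at that state,
`HK + HP` being the value of the whole planetary Hamiltonian. -/
def ThreeBody.IsPerturbation (S : ThreeBody) (K : Set Phase) (HP : Phase → ℂ) : Prop :=
  AnalyticOnNhd ℂ HP K ∧
  ∀ (Z zeta : Fin 2 → ℝ) (x : Fin 2 → ℂ), realPoint Z zeta x ∈ K →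
    (∃ rt r, S.IsState Z zeta x rt r) ∧
    ∀ rt r, S.IsState Z zeta x rt r → r 0 ≠ r 1 ∧
      HP (realPoint Z zeta x) = (S.planetaryP rt r : ℂ) ∧
      S.HK (realPoint Z zeta x) + HP (realPoint Z zeta x)
        = ((S.planetaryK rt r + S.planetaryP rt r : ℝ) : ℂ)

/-- Average over the fast angle. -/
def avg (f : Phase → ℂ) (p : Phase) : ℂ :=
  (1 / (2 * Real.pi) : ℂ) *
    ∫ t in (0 : ℝ)..(2 * Real.pi), f (p.act, ![p.ang 0, (t : ℂ)], p.ecc, p.eccT)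

/-- The symplectic form `dZ ∧ dzeta + dx ∧ dxt`. -/
def omega (u v : Phase) : ℂ :=
  ∑ j, (u.act j * v.ang j - u.ang j * v.act j + (u.ecc j * v.eccT j - u.eccT j * v.ecc j))

/-- The translation by one turn of the fast angle. -/
def turn : Phase := (0, ![0, (2 * Real.pi : ℂ)], 0, 0)

/-- A canonical transformation on `K` (the complexification of a transformation of the real phase
space): holomorphic, injective, symplectic, well defined modulo `2 π` in the fast angle, and mapping
real points to real points. -/
structure IsCanonical (U : Phase → Phase) (K : Set Phase) : Prop where
  analytic : AnalyticOnNhd ℂ U K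
  injective : Set.InjOn U K
  symplectic : ∀ p ∈ K, ∀ u v : Phase, omega (fderiv ℂ U p u) (fderiv ℂ U p v) = omega u v
  periodic : ∀ p ∈ K, U (p + turn) = U p + turn
  real : ∀ p ∈ K, p ∈ realPoints → U p ∈ realPoints

/-- Poisson bracket of two holomorphic functions for the variables `(Z, zeta)` and `(x, xt)`. -/
def poisson (f g : Phase → ℂ) (p : Phase) : ℂ :=
  ∑ j, (fderiv ℂ f p (Pi.single j 1, 0, 0, 0) * fderiv ℂ g p (0, Pi.single j 1, 0, 0)
      - fderiv ℂ g p (Pi.single j 1, 0, 0, 0) * fderiv ℂ f p (0, Pi.single j 1, 0, 0)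
      + (fderiv ℂ f p (0, 0, Pi.single j 1, 0) * fderiv ℂ g p (0, 0, 0, Pi.single j 1)
      - fderiv ℂ g p (0, 0, Pi.single j 1, 0) * fderiv ℂ f p (0, 0, 0, Pi.single j 1)))

/-- The D'Alembert rule on `K`: `f` is on `K` the sum of its Fourier-Taylor expansion
`∑ c_{k,q,qt}(Z, zeta_1) x^q xt^qt exp (i k zeta_2)`, in which only indices with
`k + q_1 + q_2 - qt_1 - qt_2 = 0` occur. -/
def DAlembert (f : Phase → ℂ) (K : Set Phase) : Prop :=
  ∃ c : ℤ × (Fin 2 → ℕ) × (Fin 2 → ℕ) → (Fin 2 → ℂ) → ℂ → ℂ,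
    (∀ n, n.1 + (n.2.1 0 : ℤ) + (n.2.1 1 : ℤ) - (n.2.2 0 : ℤ) - (n.2.2 1 : ℤ) ≠ 0 →
      ∀ Z s, c n Z s = 0) ∧
    ∀ p ∈ K, HasSum (fun n : ℤ × (Fin 2 → ℕ) × (Fin 2 → ℕ) =>
      c n p.act (p.ang 0) * (∏ j, p.ecc j ^ n.2.1 j) * (∏ j, p.eccT j ^ n.2.2 j)
        * Complex.exp (Complex.I * n.1 * p.ang 1)) (f p)

/-- The total angular momentum (up to an additive constant) in the resonant variables: as
`i x_j xt_j = |x_j|^2` at real points, it is `Z_2 - |x_1|^2 - |x_2|^2`. -/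
def angMom (p : Phase) : ℂ :=
  p.act 1 - Complex.I * p.ecc 0 * p.eccT 0 - Complex.I * p.ecc 1 * p.eccT 1

end

end Coorbital

/-!
In suitably rescaled variables the theorem is an averaging theorem for a Hamiltonian
`υ Z₂ + k + P`, where `k` depends on the actions only.

*Rescaling.*  Put `a = ε ^ β`, let `scale` multiply the actions by `a` and the eccentricity variables
by `√a`, and divide the Hamiltonian by `a`.  The domains `K q` then become neighbourhoods (`nbhd`) of
fixed width, in the supremum norm, of the set of circular co-orbital configurations.  The two planets
have the same frequency `υ`, so that the Keplerian part becomes `υ Z₂ + k` with `k` of the order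
of `a` (`exists_keplerian_remainder`), and the perturbation becomes a function `P` of the order of
`Y = ε ^ (1 - β)`.

*The perturbation.*  Near circular orbits Kepler's equation has an analytic solution, by the implicit
function theorem; this gives holomorphic extensions of positions, momenta and of their conjugates
(`exists_isKeplerState_formulas`).  The mutual distance of planets on circular orbits does not vanish
as long as the complex difference of their longitudes is at distance less than `D` from
`[D, 2π - D]` (`distSq_mem_slitPlane`).  Compactness, once the fast angle is rotated away, and
continuity in `ε` give an extension to a domain independent of `ε`, bounded by a multiple of `ε`
(`exists_perturbation`).

*One averaging step.*  As the fast frequency `υ` is constant, the homological equation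
`υ ∂χ/∂ζ₂ = -R` is solved by an integral over one turn of the fast angle, without small divisors and
without loss of domain (`exists_homological`).  Instead of the flow of `χ`, the step uses the implicit
midpoint map of its Hamiltonian vector field (`exists_midpoint_map`).  This map is symplectic, it
commutes with the rotations of the system and with the complex conjugation, and it preserves the
angular momentum because the latter is quadratic.  The remainder of the step is estimated by Cauchy's
inequalities (`IsNormalForm.step`).

*Iteration.*  One step of fixed loss of domain followed by `N` steps of loss proportional to `1 / N`
divides the oscillating part of the Hamiltonian by `exp N`, provided that `a N` is small
(`exists_averaging`).  The choice `N ≈ ε ^ (-α)` is allowed because `α < β`, which is the condition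
`1 / 7 < β`.

*D'Alembert's rule* for a holomorphic function on a domain `K q` is equivalent to invariance under the
rotations of the system (`rot_of_dAlembert`, `dAlembert_of_rot`): the Taylor coefficients in the
eccentricity variables of an invariant function are pure exponentials of the fast angle.  Hence the
rule is preserved by transformations which commute with the rotations.  The angular momentum
generates the rotations, so that its bracket with an invariant function vanishes (`poisson_angMom`).
-/

open Metric Set Filter Topology MeasureTheory
open scoped Real Interval

namespace Coorbital

/-! ### Holomorphic functions of several variables -/

section SeveralVariables

variable {E : Type*} [NormedAddCommGroup E] [NormedSpace ℂ E]
variable {F : Type*} [NormedAddCommGroup F] [NormedSpace ℂ F]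

/-- Cauchy's estimate for the derivative of a function of several variables. -/
theorem norm_fderiv_le_of_ball {f : E → F} {c : E} {r M : ℝ} (hr : 0 < r)
    (hd : DifferentiableOn ℂ f (ball c r)) (hM : ∀ p ∈ ball c r, ‖f p‖ ≤ M) :
    ‖fderiv ℂ f c‖ ≤ M / r := by
  have hc : c ∈ ball c r := mem_ball_self hr
  have hM0 : 0 ≤ M := (norm_nonneg _).trans (hM c hc)
  have hdc : DifferentiableAt ℂ f c := hd.differentiableAt (ball_mem_nhds c hr)
  refine ContinuousLinearMap.opNorm_le_bound _ (by positivity) fun u => ?_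
  rcases eq_or_ne u 0 with rfl | hu
  · simp
  have hu' : 0 < ‖u‖ := norm_pos_iff.2 hu
  set g : ℂ → F := fun t => f (c + t • u) with hg
  have hline : ∀ t : ℂ, HasDerivAt (fun t : ℂ => c + t • u) u t := fun t => by
    simpa using ((hasDerivAt_id t).smul_const u).const_add c
  have hgd : HasDerivAt g (fderiv ℂ f c u) 0 := by
    have h1 : HasFDerivAt f (fderiv ℂ f c) (c + (0 : ℂ) • u) := by
      simpa using hdc.hasFDerivAt
    exact h1.comp_hasDerivAt (0 : ℂ) (hline 0)
  -- Cauchy's estimate on a circle of radius `ρ / ‖u‖` in the complex line of direction `u`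
  have key : ∀ ρ, 0 < ρ → ρ < r → ‖fderiv ℂ f c u‖ ≤ M * ‖u‖ / ρ := by
    intro ρ h0 hρ
    have hmem : ∀ t ∈ closedBall (0 : ℂ) (ρ / ‖u‖), c + t • u ∈ ball c r := by
      intro t ht
      rw [mem_closedBall_zero_iff] at ht
      rw [mem_ball, dist_eq_norm, add_sub_cancel_left, norm_smul]
      calc ‖t‖ * ‖u‖ ≤ ρ / ‖u‖ * ‖u‖ := by gcongr
        _ = ρ := by field_simp
        _ < r := hρ
    have h2 : DiffContOnCl ℂ g (ball 0 (ρ / ‖u‖)) := by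
      refine DifferentiableOn.diffContOnCl ?_
      rw [closure_ball _ (by positivity)]
      intro t ht
      exact ((hd.differentiableAt (isOpen_ball.mem_nhds (hmem t ht))).comp t
        (hline t).differentiableAt).differentiableWithinAt
    have := Complex.norm_deriv_le_of_forall_mem_sphere_norm_le (by positivity) h2
      (C := M) fun t ht => hM _ (hmem t (sphere_subset_closedBall ht))
    rw [hgd.deriv] at this
    calc _ ≤ _ := this
      _ = _ := by field_simp
  have h3 : Tendsto (fun ρ => M * ‖u‖ / ρ) (𝓝[<] r) (𝓝 (M * ‖u‖ / r)) :=
    ((continuousAt_const.div continuousAt_id hr.ne').tendsto).mono_left nhdsWithin_le_nhds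
  have h4 := ge_of_tendsto h3 (b := ‖fderiv ℂ f c u‖) <| by
    filter_upwards [Ioo_mem_nhdsLT hr] with ρ hρ using key ρ hρ.1 hρ.2
  calc _ ≤ _ := h4
    _ = _ := by ring

/-- The derivative of a holomorphic function is continuous: the Cauchy estimate is applied to the
differences `f (· + h) - f`. -/
theorem continuousOn_fderiv_of_differentiableOn [ProperSpace E] {f : E → F} {s : Set E}
    (hs : IsOpen s) (hd : DifferentiableOn ℂ f s) : ContinuousOn (fderiv ℂ f) s := by
  intro c hc
  apply ContinuousAt.continuousWithinAt
  obtain ⟨r, hr, hrs⟩ := nhds_basis_closedBall.mem_iff.1 (hs.mem_nhds hc)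
  have huc : UniformContinuousOn f (closedBall c r) :=
    (isCompact_closedBall c r).uniformContinuousOn_of_continuous (hd.continuousOn.mono hrs)
  rw [Metric.continuousAt_iff]
  intro ε hε
  obtain ⟨δ, hδ, h⟩ := Metric.uniformContinuousOn_iff.1 huc (ε * (r / 2) / 2) (by positivity)
  refine ⟨min δ (r / 2), by positivity, fun {x} hx => ?_⟩
  have hx1 : ‖x - c‖ < δ := by rw [← dist_eq_norm]; exact hx.trans_le (min_le_left _ _)
  have hx2 : ‖x - c‖ < r / 2 := by rw [← dist_eq_norm]; exact hx.trans_le (min_le_right _ _)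
  have hcb : ∀ p ∈ ball c (r / 2), p ∈ closedBall c r ∧ p + (x - c) ∈ closedBall c r := by
    intro p hp
    rw [mem_ball, dist_eq_norm] at hp
    constructor
    · rw [mem_closedBall, dist_eq_norm]; linarith
    · rw [mem_closedBall, dist_eq_norm]
      calc ‖p + (x - c) - c‖ = ‖(p - c) + (x - c)‖ := by congr 1; abel
        _ ≤ ‖p - c‖ + ‖x - c‖ := norm_add_le _ _
        _ ≤ r := by linarith
  have hnhds : ∀ p ∈ ball c r, s ∈ 𝓝 p := fun p hp =>
    hs.mem_nhds (hrs (ball_subset_closedBall hp))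
  have hdiff1 : ∀ p ∈ ball c (r / 2), DifferentiableAt ℂ f p := fun p hp =>
    hd.differentiableAt (hnhds p (ball_subset_ball (by linarith) hp))
  have hdiff2 : ∀ p ∈ ball c (r / 2), DifferentiableAt ℂ f (p + (x - c)) := fun p hp => by
    refine hd.differentiableAt (hnhds _ ?_)
    rw [mem_ball, dist_eq_norm] at hp ⊢
    calc ‖p + (x - c) - c‖ = ‖(p - c) + (x - c)‖ := by congr 1; abel
      _ ≤ ‖p - c‖ + ‖x - c‖ := norm_add_le _ _
      _ < r := by linarith
  have h5 := norm_fderiv_le_of_ball (f := fun p => f (p + (x - c)) - f p) (c := c) (r := r / 2)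
    (M := ε * (r / 2) / 2) (by positivity)
    (fun p hp => ((((hdiff2 p hp).comp p (differentiableAt_id.add_const _))).sub
      (hdiff1 p hp)).differentiableWithinAt)
    (fun p hp => by
      have := h (p + (x - c)) (hcb p hp).2 p (hcb p hp).1 (by rw [dist_eq_norm]; simpa using hx1)
      rw [dist_eq_norm] at this
      exact this.le)
  have h6 : fderiv ℂ (fun p => f (p + (x - c)) - f p) c = fderiv ℂ f x - fderiv ℂ f c := by
    have hc' := mem_ball_self (x := c) (half_pos hr)
    have h7 : DifferentiableAt ℂ (fun p => f (p + (x - c))) c :=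
      (hdiff2 c hc').comp c (differentiableAt_id.add_const _)
    rw [fderiv_fun_sub h7 (hdiff1 c hc'), fderiv_comp_add_right, add_sub_cancel]
  rw [h6] at h5
  rw [dist_eq_norm]
  calc _ ≤ _ := h5
    _ = ε / 2 := by field_simp
    _ < ε := by linarith

/-- Differentiation under the integral sign for the superposition of translates of a holomorphic
function along a curve. -/
theorem hasFDerivAt_integral_translates [ProperSpace E] [CompleteSpace F] {f : E → F}
    {s : Set E} (hs : IsOpen s) (hd : DifferentiableOn ℂ f s) {a b : ℝ} {w : ℝ → ℂ} {γ : ℝ → E}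
    (hw : Continuous w) (hγ : Continuous γ) {p : E} (hp : ∀ t ∈ uIcc a b, p + γ t ∈ s) :
    HasFDerivAt (fun q => ∫ t in a..b, w t • f (q + γ t))
      (∫ t in a..b, w t • fderiv ℂ f (p + γ t)) p := by
  -- the derivative is bounded on a compact neighbourhood of the curve
  have hcomp : IsCompact ((fun t => p + γ t) '' uIcc a b) :=
    isCompact_uIcc.image (by fun_prop)
  obtain ⟨δ, hδ, hsub⟩ := hcomp.exists_cthickening_subset_open hs (by
    rintro _ ⟨t, ht, rfl⟩; exact hp t ht)
  have hmem : ∀ q ∈ ball p δ, ∀ t ∈ uIcc a b,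
      q + γ t ∈ cthickening δ ((fun t => p + γ t) '' uIcc a b) := by
    intro q hq t ht
    refine thickening_subset_cthickening _ _ (mem_thickening_iff.2 ⟨_, ⟨t, ht, rfl⟩, ?_⟩)
    simpa [dist_eq_norm] using hq
  have hcont := continuousOn_fderiv_of_differentiableOn hs hd
  obtain ⟨B, hB⟩ := (hcomp.cthickening (r := δ)).exists_bound_of_continuousOn (hcont.mono hsub)
  have hcf : ∀ q ∈ ball p δ, ContinuousOn (fun t => w t • f (q + γ t)) (uIcc a b) := by
    intro q hq
    refine hw.continuousOn.smul (hd.continuousOn.comp (by fun_prop) fun t ht => ?_)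
    exact hsub (hmem q hq t ht)
  have hpb : p ∈ ball p δ := mem_ball_self hδ
  have hcf' : ContinuousOn (fun t => w t • fderiv ℂ f (p + γ t)) (uIcc a b) :=
    hw.continuousOn.smul (hcont.comp (by fun_prop) fun t ht => hp t ht)
  refine intervalIntegral.hasFDerivAt_integral_of_dominated_of_fderiv_le
    (F' := fun q t => w t • fderiv ℂ f (q + γ t)) (bound := fun t => ‖w t‖ * B)
    (ball_mem_nhds p hδ) ?_ (hcf p hpb).intervalIntegrable
    ((hcf'.mono uIoc_subset_uIcc).aestronglyMeasurable measurableSet_uIoc) ?_ ?_ ?_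
  · filter_upwards [ball_mem_nhds p hδ] with q hq using
      ((hcf q hq).mono uIoc_subset_uIcc).aestronglyMeasurable measurableSet_uIoc
  · refine ae_of_all _ fun t ht q hq => ?_
    rw [norm_smul]
    gcongr
    exact hB _ (hmem q hq t (uIoc_subset_uIcc ht))
  · exact (hw.norm.mul continuous_const).intervalIntegrable _ _
  · refine ae_of_all _ fun t ht q hq => ?_
    have h1 : DifferentiableAt ℂ f (q + γ t) :=
      hd.differentiableAt (hs.mem_nhds (hsub (hmem q hq t (uIoc_subset_uIcc ht))))
    have h2 : HasFDerivAt (fun q => f (q + γ t)) (fderiv ℂ f (q + γ t)) q := by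
      simpa [Function.comp_def] using h1.hasFDerivAt.comp q ((hasFDerivAt_id q).add_const (γ t))
    exact h2.const_smul (w t)

/-- Directional derivatives of a holomorphic function are holomorphic. -/
theorem differentiableOn_fderiv_apply [ProperSpace E] [CompleteSpace F] {f : E → F}
    {s : Set E} (hs : IsOpen s) (hd : DifferentiableOn ℂ f s) (u : E) :
    DifferentiableOn ℂ (fun p => fderiv ℂ f p u) s := by
  intro c hc
  apply DifferentiableAt.differentiableWithinAt
  obtain ⟨r, hr, hrs⟩ := nhds_basis_ball.mem_iff.1 (hs.mem_nhds hc)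
  set ρ : ℝ := r / 2 / (‖u‖ + 1) with hρ
  have hρ0 : 0 < ρ := by positivity
  have hρu : ρ * ‖u‖ < r / 2 := by
    rw [hρ, div_mul_eq_mul_div, div_lt_iff₀ (by positivity)]
    nlinarith [norm_nonneg u]
  have hline : ∀ (p : E) (t : ℂ), HasDerivAt (fun t : ℂ => p + t • u) u t := fun p t => by
    simpa using ((hasDerivAt_id t).smul_const u).const_add p
  have hmem : ∀ p ∈ ball c (r / 2), ∀ t ∈ closedBall (0 : ℂ) ρ, p + t • u ∈ s := by
    intro p hp t ht
    apply hrs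
    rw [mem_closedBall_zero_iff] at ht
    rw [mem_ball, dist_eq_norm] at hp ⊢
    calc ‖p + t • u - c‖ = ‖(p - c) + t • u‖ := by congr 1; abel
      _ ≤ ‖p - c‖ + ‖t‖ * ‖u‖ := (norm_add_le _ _).trans (by rw [norm_smul])
      _ ≤ ‖p - c‖ + ρ * ‖u‖ := by gcongr
      _ < r := by linarith
  -- the directional derivative is a Cauchy integral, that is, a superposition of translates of `f`
  have hrep : ∀ p ∈ ball c (r / 2), fderiv ℂ f p u =
      ∫ t in (0 : ℝ)..(2 * π), ((2 * π * Complex.I : ℂ)⁻¹ * (deriv (circleMap 0 ρ) t *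
        (circleMap 0 ρ t ^ 2)⁻¹)) • f (p + circleMap 0 ρ t • u) := by
    intro p hp
    have hdp : DifferentiableAt ℂ f p :=
      hd.differentiableAt (hs.mem_nhds (by simpa using hmem p hp 0 (by simp [hρ0.le])))
    have hgd : HasDerivAt (fun t : ℂ => f (p + t • u)) (fderiv ℂ f p u) 0 := by
      have h1 : HasFDerivAt f (fderiv ℂ f p) (p + (0 : ℂ) • u) := by
        simpa using hdp.hasFDerivAt
      exact h1.comp_hasDerivAt (0 : ℂ) (hline p 0)
    have h2 : DiffContOnCl ℂ (fun t : ℂ => f (p + t • u)) (ball 0 ρ) := by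
      refine DifferentiableOn.diffContOnCl ?_
      rw [closure_ball _ hρ0.ne']
      intro t ht
      exact ((hd.differentiableAt (hs.mem_nhds (hmem p hp t ht))).comp t
        (hline p t).differentiableAt).differentiableWithinAt
    have h3 := h2.deriv_eq_smul_circleIntegral hρ0
    rw [hgd.deriv, eq_comm, ← eq_inv_smul_iff₀ Complex.two_pi_I_ne_zero] at h3
    rw [h3, circleIntegral, ← intervalIntegral.integral_smul]
    congr 1
    ext t
    rw [smul_smul, smul_smul]
    simp [mul_assoc]
  have hderiv : DifferentiableAt ℂ (fun p => ∫ t in (0 : ℝ)..(2 * π),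
      ((2 * π * Complex.I : ℂ)⁻¹ * (deriv (circleMap 0 ρ) t *
        (circleMap 0 ρ t ^ 2)⁻¹)) • f (p + circleMap 0 ρ t • u)) c := by
    refine (hasFDerivAt_integral_translates hs hd ?_ ?_ ?_).differentiableAt
    · have h0 : ∀ t, circleMap 0 ρ t ^ 2 ≠ 0 := fun t =>
        pow_ne_zero _ (circleMap_ne_center hρ0.ne')
      simp only [deriv_circleMap]
      exact continuous_const.mul (((continuous_circleMap 0 ρ).mul continuous_const).mul
        (((continuous_circleMap 0 ρ).pow 2).inv₀ h0))
    · exact (continuous_circleMap 0 ρ).smul continuous_const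
    · intro t _
      exact hmem c (mem_ball_self (by positivity)) _ (by simp [abs_of_pos hρ0])
  exact hderiv.congr_of_eventuallyEq (by
    filter_upwards [ball_mem_nhds c (half_pos hr)] with p hp using hrep p hp)

theorem contDiffOn_of_differentiableOn [FiniteDimensional ℂ E] [CompleteSpace F] {s : Set E}
    (hs : IsOpen s) (n : ℕ) : ∀ f : E → F, DifferentiableOn ℂ f s → ContDiffOn ℂ n f s := by
  have : ProperSpace E := FiniteDimensional.proper ℂ E
  induction n with
  | zero => exact fun f hf => contDiffOn_zero.2 hf.continuousOn
  | succ n ih =>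
    intro f hf
    push_cast
    rw [contDiffOn_succ_iff_fderiv_apply hs.uniqueDiffOn]
    refine ⟨hf, by simp, fun y => ih _ ?_⟩
    exact (differentiableOn_fderiv_apply hs hf y).congr fun x hx => by
      rw [fderivWithin_of_isOpen hs hx]

theorem differentiableOn_fderiv [FiniteDimensional ℂ E] [CompleteSpace F] {s : Set E}
    (hs : IsOpen s) {f : E → F} (hf : DifferentiableOn ℂ f s) :
    DifferentiableOn ℂ (fderiv ℂ f) s :=
  (((contDiffOn_succ_iff_fderiv_of_isOpen (n := 1) hs).1
    (by simpa [one_add_one_eq_two] using contDiffOn_of_differentiableOn hs 2 f hf)).2.2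
    ).differentiableOn (by simp)

/-- The iterated Cauchy estimate. -/
theorem norm_iteratedFDeriv_le_of_ball [FiniteDimensional ℂ E] [CompleteSpace F] {f : E → F}
    {c : E} {r M δ : ℝ} (hδ : 0 < δ) (hd : DifferentiableOn ℂ f (ball c r))
    (hM : ∀ p ∈ ball c r, ‖f p‖ ≤ M) (n : ℕ) :
    ∀ p ∈ ball c (r - n * δ), ‖iteratedFDeriv ℂ n f p‖ ≤ M / δ ^ n := by
  induction n with
  | zero => simpa using hM
  | succ n ih =>
    intro p hp
    have hsub : ball p δ ⊆ ball c (r - n * δ) := by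
      apply ball_subset_ball'
      rw [mem_ball] at hp
      push_cast at hp
      linarith
    have hsub' : ball p δ ⊆ ball c r := hsub.trans (ball_subset_ball (by
      have : 0 ≤ n * δ := by positivity
      linarith))
    have hdn : DifferentiableOn ℂ (iteratedFDeriv ℂ n f) (ball p δ) := by
      intro q hq
      have h1 : ContDiffAt ℂ (n + 1 : ℕ) f q :=
        (contDiffOn_of_differentiableOn isOpen_ball (n + 1) f hd).contDiffAt
          (isOpen_ball.mem_nhds (hsub' hq))
      exact (h1.differentiableAt_iteratedFDeriv (by exact_mod_cast n.lt_succ_self)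
        ).differentiableWithinAt
    have := norm_fderiv_le_of_ball hδ hdn fun q hq => ih q (hsub hq)
    rw [norm_fderiv_iteratedFDeriv] at this
    rwa [pow_succ, ← div_div]

open scoped Nat in
/-- **Osgood's lemma**: a function of finitely many complex variables which is complex
differentiable on an open set is analytic there.  The Taylor series at `c` converges to `f` on every
complex line through `c`, and its radius of convergence is positive by the iterated Cauchy
estimate. -/
theorem analyticOnNhd_of_differentiableOn [FiniteDimensional ℂ E] [CompleteSpace F] {f : E → F}
    {s : Set E} (hs : IsOpen s) (hd : DifferentiableOn ℂ f s) : AnalyticOnNhd ℂ f s := by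
  have : ProperSpace E := FiniteDimensional.proper ℂ E
  intro c hc
  obtain ⟨r, hr, hrs⟩ := nhds_basis_closedBall.mem_iff.1 (hs.mem_nhds hc)
  obtain ⟨M, hM⟩ := (isCompact_closedBall c r).exists_bound_of_continuousOn
    (hd.continuousOn.mono hrs)
  have hM0 : 0 ≤ M := (norm_nonneg _).trans (hM c (mem_closedBall_self hr.le))
  have hdb : DifferentiableOn ℂ f (ball c r) := hd.mono (ball_subset_closedBall.trans hrs)
  set P : FormalMultilinearSeries ℂ E F := fun n => ((n ! : ℂ)⁻¹) • iteratedFDeriv ℂ n f c with hP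
  set R : ℝ := r / 2 / Real.exp 1 with hR
  have hR0 : 0 < R := by positivity
  -- the iterated Cauchy estimate with steps `r / (2 n)`, and `n ^ n / n! ≤ exp n`
  have hbound : ∀ n : ℕ, ‖P n‖ * R ^ n ≤ M := by
    intro n
    rcases Nat.eq_zero_or_pos n with rfl | hn
    · simpa [hP] using hM c (mem_closedBall_self hr.le)
    have hn' : (0 : ℝ) < n := by exact_mod_cast hn
    have h1 := norm_iteratedFDeriv_le_of_ball (δ := r / 2 / n) (by positivity) hdb
      (fun p hp => hM p (ball_subset_closedBall hp)) n c (mem_ball_self (by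
        field_simp; linarith))
    have h2 : (n : ℝ) ^ n / n ! ≤ Real.exp n := Real.pow_div_factorial_le_exp _ hn'.le n
    have h3 : ‖P n‖ = (n ! : ℝ)⁻¹ * ‖iteratedFDeriv ℂ n f c‖ := by
      simp [hP, norm_smul]
    rw [h3]
    calc (n ! : ℝ)⁻¹ * ‖iteratedFDeriv ℂ n f c‖ * R ^ n
        ≤ (n ! : ℝ)⁻¹ * (M / (r / 2 / n) ^ n) * R ^ n := by gcongr
      _ = M * ((n : ℝ) ^ n / n !) / Real.exp 1 ^ n := by
          rw [hR]; simp only [div_pow]; field_simp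
      _ ≤ M * Real.exp n / Real.exp 1 ^ n := by gcongr
      _ = M := by rw [← Real.exp_nat_mul]; simp
  have hiter : ∀ h : E, ∀ n : ℕ, ∀ t : ℂ, c + t • h ∈ ball c r →
      iteratedDeriv n (fun t : ℂ => f (c + t • h)) t =
        iteratedFDeriv ℂ n f (c + t • h) fun _ => h := by
    intro h n
    induction n with
    | zero => intro t _; simp
    | succ n ih =>
      intro t ht
      have hline : HasDerivAt (fun t : ℂ => c + t • h) h t := by
        simpa using ((hasDerivAt_id t).smul_const h).const_add c
      rw [iteratedDeriv_succ, iteratedFDeriv_succ_apply_left]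
      have h1 : ContDiffAt ℂ (n + 1 : ℕ) f (c + t • h) :=
        (contDiffOn_of_differentiableOn isOpen_ball (n + 1) f hdb).contDiffAt
          (isOpen_ball.mem_nhds ht)
      have h2 := (h1.differentiableAt_iteratedFDeriv
        (m := n) (by exact_mod_cast n.lt_succ_self)).hasFDerivAt.comp_hasDerivAt t hline
      have h3 : HasDerivAt (fun t : ℂ => iteratedFDeriv ℂ n f (c + t • h) fun _ => h)
          (fderiv ℂ (iteratedFDeriv ℂ n f) (c + t • h) h fun _ => h) t := by
        exact (ContinuousMultilinearMap.apply ℂ (fun _ : Fin n => E) F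
          (fun _ => h)).hasFDerivAt.comp_hasDerivAt t h2
      have hev : iteratedDeriv n (fun t : ℂ => f (c + t • h)) =ᶠ[𝓝 t]
          fun t => iteratedFDeriv ℂ n f (c + t • h) fun _ => h := by
        filter_upwards [hline.continuousAt.preimage_mem_nhds (isOpen_ball.mem_nhds ht)]
          with t' ht' using ih t' ht'
      rw [hev.deriv_eq, h3.deriv]
      rfl
  refine ⟨P, ENNReal.ofReal R, ?_, by simpa using hR0, ?_⟩
  · exact P.le_radius_of_bound M (r := R.toNNReal) fun n => by
      simpa [Real.coe_toNNReal _ hR0.le] using hbound n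
  · intro y hy
    rw [Metric.eball_ofReal, mem_ball_zero_iff] at hy
    have hRr : R ≤ r / 2 := div_le_self (by positivity) (Real.one_le_exp (by norm_num))
    have hmem : ∀ t ∈ ball (0 : ℂ) 2, c + t • y ∈ ball c r := by
      intro t ht
      rw [mem_ball_zero_iff] at ht
      rw [mem_ball, dist_eq_norm, add_sub_cancel_left, norm_smul]
      nlinarith [norm_nonneg t, norm_nonneg y]
    have hdl : DifferentiableOn ℂ (fun t : ℂ => f (c + t • y)) (ball 0 2) := by
      refine hdb.comp (by fun_prop) hmem
    have := Complex.hasSum_taylorSeries_on_ball hdl (z := 1) (by simp)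
    convert this using 1
    · ext n
      rw [hiter y n 0 (by simpa using hr)]
      simp [hP]
    · simp

end SeveralVariables

/-! ### The phase space and its symmetries -/

noncomputable section

@[simp] theorem Phase.act_def (p : Phase) : p.act = p.1 := rfl
@[simp] theorem Phase.ang_def (p : Phase) : p.ang = p.2.1 := rfl
@[simp] theorem Phase.ecc_def (p : Phase) : p.ecc = p.2.2.1 := rfl
@[simp] theorem Phase.eccT_def (p : Phase) : p.eccT = p.2.2.2 := rfl

theorem Phase.norm_le_iff {p : Phase} {C : ℝ} : ‖p‖ ≤ C ↔
    ‖p.act‖ ≤ C ∧ ‖p.ang‖ ≤ C ∧ ‖p.ecc‖ ≤ C ∧ ‖p.eccT‖ ≤ C := by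
  simp only [Phase, Phase.act, Phase.ang, Phase.ecc, Phase.eccT, Prod.norm_def, sup_le_iff]

/-- The direction of the fast angle. -/
def fastDir : Phase := (0, ![0, 1], 0, 0)

/-- Linear part of the rotation of the system by the angle `θ`. -/
def rotLin (θ : ℝ) : Phase →L[ℂ] Phase :=
  (ContinuousLinearMap.id ℂ (Fin 2 → ℂ)).prodMap
    ((ContinuousLinearMap.id ℂ (Fin 2 → ℂ)).prodMap
      ((Complex.exp (θ * Complex.I) • ContinuousLinearMap.id ℂ (Fin 2 → ℂ)).prodMap
        (Complex.exp (-(θ * Complex.I)) • ContinuousLinearMap.id ℂ (Fin 2 → ℂ))))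

/-- Rotation of the whole system by the angle `θ`: both mean longitudes, hence the fast angle,
increase by `θ`, and the eccentricity variables are multiplied by `e^{iθ}`, `e^{-iθ}`. -/
def rot (θ : ℝ) (p : Phase) : Phase := rotLin θ p + (θ : ℂ) • fastDir

/-- Linear part of the reflection `conjP`; it only serves to separate the antilinear part `star`. -/
def swapLin : Phase →L[ℂ] Phase where
  toFun p := (p.1, p.2.1, (-Complex.I) • p.2.2.2, (-Complex.I) • p.2.2.1)
  map_add' p q := by simp
  map_smul' c p := by simp [smul_comm c]
  cont := by fun_prop

/-- The antiholomorphic reflection of the complexified phase space whose fixed points are the real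
points. -/
def conjP (p : Phase) : Phase := swapLin (star p)

theorem rot_apply (θ : ℝ) (p : Phase) : rot θ p = (p.1, p.2.1 + ![0, (θ : ℂ)],
    Complex.exp (θ * Complex.I) • p.2.2.1, Complex.exp (-(θ * Complex.I)) • p.2.2.2) := by
  ext j <;> fin_cases j <;> simp [rot, rotLin, fastDir]

theorem conjP_apply (p : Phase) : conjP p = (star p.1, star p.2.1,
    (-Complex.I) • star p.2.2.2, (-Complex.I) • star p.2.2.1) := rfl

theorem conjP_add (p q : Phase) : conjP (p + q) = conjP p + conjP q := by
  simp [conjP, star_add]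

theorem conjP_smul (c : ℂ) (p : Phase) : conjP (c • p) = star c • conjP p := by
  simp [conjP, star_smul]

theorem conjP_conjP (p : Phase) : conjP (conjP p) = p := by
  ext j <;> simp [conjP_apply, ← mul_assoc]

theorem conjP_fastDir : conjP fastDir = fastDir := by
  ext j <;> fin_cases j <;> simp [conjP_apply, fastDir]

theorem norm_conjP (p : Phase) : ‖conjP p‖ = ‖p‖ := by
  simp only [conjP_apply, Phase, Prod.norm_def, norm_star, norm_smul, norm_neg, Complex.norm_I,
    one_mul]
  congr 2
  exact max_comm _ _

theorem norm_rotLin (θ : ℝ) (p : Phase) : ‖rotLin θ p‖ = ‖p‖ := by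
  have h2 : ‖Complex.exp (-(θ * Complex.I))‖ = 1 := by
    have := Complex.norm_exp_ofReal_mul_I (-θ)
    simpa using this
  simp [rotLin, Phase, Prod.norm_def, norm_smul, h2]

theorem rotLin_fastDir (θ : ℝ) : rotLin θ fastDir = fastDir := by
  simp [rotLin, fastDir]

theorem rot_add_smul_fastDir (θ : ℝ) (p : Phase) (t : ℂ) :
    rot θ (p + t • fastDir) = rot θ p + t • fastDir := by
  simp only [rot, map_add, map_smul, rotLin_fastDir]
  abel

theorem conjP_add_smul_fastDir (p : Phase) (t : ℝ) :
    conjP (p + (t : ℂ) • fastDir) = conjP p + (t : ℂ) • fastDir := by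
  rw [conjP_add, conjP_smul, conjP_fastDir]
  simp

theorem rot_two_pi (p : Phase) : rot (2 * π) p = p + ((2 * π : ℝ) : ℂ) • fastDir := by
  have h : Complex.exp (-(2 * π * Complex.I)) = 1 := by
    rw [Complex.exp_neg, Complex.exp_two_pi_mul_I, inv_one]
  ext j <;> fin_cases j <;> simp [rot_apply, fastDir, h, Matrix.vecHead, Matrix.vecTail]

theorem turn_eq : turn = ((2 * π : ℝ) : ℂ) • fastDir := by
  simp [turn, fastDir]

theorem mem_realPoints_iff (p : Phase) : p ∈ realPoints ↔ conjP p = p := by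
  constructor
  · rintro ⟨Z, zeta, x, rfl⟩
    ext j
    · simp [conjP_apply, realPoint]
    · simp [conjP_apply, realPoint]
    · simp [conjP_apply, realPoint, ← mul_assoc]
    · simp [conjP_apply, realPoint]
  · intro h
    refine ⟨fun j => (p.1 j).re, fun j => (p.2.1 j).re, p.2.2.1, ?_⟩
    have h1 : ∀ j, star (p.1 j) = p.1 j := fun j => by
      have := congrFun (congrArg (fun q : Phase => q.1) h) j
      simpa [conjP_apply] using this
    have h2 : ∀ j, star (p.2.1 j) = p.2.1 j := fun j => by
      have := congrFun (congrArg (fun q : Phase => q.2.1) h) j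
      simpa [conjP_apply] using this
    have h3 : ∀ j, -Complex.I * star (p.2.2.1 j) = p.2.2.2 j := fun j => by
      have := congrFun (congrArg (fun q : Phase => q.2.2.2) h) j
      simpa [conjP_apply] using this
    ext j
    · exact ((Complex.conj_eq_iff_re).1 (h1 j)).symm
    · exact ((Complex.conj_eq_iff_re).1 (h2 j)).symm
    · rfl
    · exact (h3 j).symm

/-! ### Symplectic structure -/

/-- The Hamiltonian vector `J ℓ` of a linear form `ℓ`: the vector such that `omega (J ℓ) v = ℓ v`
for all `v`. -/
def hamVec : (Phase →L[ℂ] ℂ) →L[ℂ] Phase :=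
  (ContinuousLinearMap.pi fun j =>
    ContinuousLinearMap.apply ℂ ℂ ((0, Pi.single j 1, 0, 0) : Phase)).prod
  ((ContinuousLinearMap.pi fun j =>
    -ContinuousLinearMap.apply ℂ ℂ ((Pi.single j 1, 0, 0, 0) : Phase)).prod
  ((ContinuousLinearMap.pi fun j =>
    ContinuousLinearMap.apply ℂ ℂ ((0, 0, 0, Pi.single j 1) : Phase)).prod
  (ContinuousLinearMap.pi fun j =>
    -ContinuousLinearMap.apply ℂ ℂ ((0, 0, Pi.single j 1, 0) : Phase))))

theorem hamVec_apply (l : Phase →L[ℂ] ℂ) : hamVec l = (fun j => l (0, Pi.single j 1, 0, 0),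
    fun j => -l (Pi.single j 1, 0, 0, 0), fun j => l (0, 0, 0, Pi.single j 1),
    fun j => -l (0, 0, Pi.single j 1, 0)) := rfl

theorem norm_hamVec_le (l : Phase →L[ℂ] ℂ) : ‖hamVec l‖ ≤ ‖l‖ := by
  have key : ∀ v : Phase, ‖v‖ ≤ 1 → ‖l v‖ ≤ ‖l‖ := fun v hv => l.unit_le_opNorm v hv
  rw [Phase.norm_le_iff]
  have h0 : (0 : ℝ) ≤ ‖l‖ := norm_nonneg _
  refine ⟨?_, ?_, ?_, ?_⟩ <;> rw [pi_norm_le_iff_of_nonneg h0] <;> intro j <;>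
    simp only [Phase.act, Phase.ang, Phase.ecc, Phase.eccT, hamVec_apply, norm_neg] <;>
    apply key <;> simp [Phase, Prod.norm_def, Pi.norm_single]

theorem Phase.eq_sum (v : Phase) : v = ∑ j, (v.1 j • ((Pi.single j 1, 0, 0, 0) : Phase) +
    v.2.1 j • ((0, Pi.single j 1, 0, 0) : Phase) + v.2.2.1 j • ((0, 0, Pi.single j 1, 0) : Phase) +
    v.2.2.2 j • ((0, 0, 0, Pi.single j 1) : Phase)) := by
  ext j <;> fin_cases j <;> simp [Fin.sum_univ_two]

theorem clm_apply_eq (l : Phase →L[ℂ] ℂ) (v : Phase) :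
    l v = ∑ j, (v.1 j * l (Pi.single j 1, 0, 0, 0) + v.2.1 j * l (0, Pi.single j 1, 0, 0) +
      v.2.2.1 j * l (0, 0, Pi.single j 1, 0) + v.2.2.2 j * l (0, 0, 0, Pi.single j 1)) := by
  conv_lhs => rw [Phase.eq_sum v]
  simp only [map_sum, map_add, map_smul, smul_eq_mul]

theorem omega_hamVec_left (l : Phase →L[ℂ] ℂ) (v : Phase) : omega (hamVec l) v = l v := by
  rw [clm_apply_eq l v]
  simp only [omega, hamVec_apply, Fin.sum_univ_two, Phase.act, Phase.ang, Phase.ecc, Phase.eccT]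
  ring

theorem omega_antisymm (u v : Phase) : omega u v = -omega v u := by
  simp only [omega, Fin.sum_univ_two]
  ring

theorem omega_add_left (u v w : Phase) : omega (u + v) w = omega u w + omega v w := by
  simp only [omega, Fin.sum_univ_two, Phase.act, Phase.ang, Phase.ecc, Phase.eccT, Prod.fst_add,
    Prod.snd_add, Pi.add_apply]
  ring

theorem omega_smul_left (c : ℂ) (v w : Phase) : omega (c • v) w = c * omega v w := by
  simp only [omega, Fin.sum_univ_two, Phase.act, Phase.ang, Phase.ecc, Phase.eccT, Prod.smul_fst,
    Prod.smul_snd, Pi.smul_apply, smul_eq_mul]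
  ring

theorem omega_add_right (u v w : Phase) : omega w (u + v) = omega w u + omega w v := by
  rw [omega_antisymm, omega_add_left, omega_antisymm u, omega_antisymm v]; ring

theorem omega_smul_right (c : ℂ) (v w : Phase) : omega w (c • v) = c * omega w v := by
  rw [omega_antisymm, omega_smul_left, omega_antisymm v]; ring

theorem eq_of_omega_eq {u u' : Phase} (h : ∀ v, omega u v = omega u' v) : u = u' := by
  have h1 : ∀ j, u.1 j = u'.1 j := fun j => by
    have := h (0, Pi.single j 1, 0, 0)
    fin_cases j <;> simpa [omega, Fin.sum_univ_two] using this
  have h2 : ∀ j, u.2.1 j = u'.2.1 j := fun j => by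
    have := h (Pi.single j 1, 0, 0, 0)
    fin_cases j <;> simpa [omega, Fin.sum_univ_two] using this
  have h3 : ∀ j, u.2.2.1 j = u'.2.2.1 j := fun j => by
    have := h (0, 0, 0, Pi.single j 1)
    fin_cases j <;> simpa [omega, Fin.sum_univ_two] using this
  have h4 : ∀ j, u.2.2.2 j = u'.2.2.2 j := fun j => by
    have := h (0, 0, Pi.single j 1, 0)
    fin_cases j <;> simpa [omega, Fin.sum_univ_two] using this
  ext j
  exacts [h1 j, h2 j, h3 j, h4 j]

theorem omega_rotLin (θ : ℝ) (u v : Phase) : omega (rotLin θ u) (rotLin θ v) = omega u v := by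
  have h : Complex.exp (θ * Complex.I) * Complex.exp (-(θ * Complex.I)) = 1 := by
    rw [← Complex.exp_add]; simp
  simp only [omega, rotLin, Fin.sum_univ_two, Phase.act, Phase.ang, Phase.ecc, Phase.eccT,
    ContinuousLinearMap.coe_prodMap', Prod.map_fst, Prod.map_snd, ContinuousLinearMap.coe_id',
    FunLike.coe_smul, Pi.smul_apply, smul_eq_mul, id]
  linear_combination (u.2.2.1 0 * v.2.2.2 0 - u.2.2.2 0 * v.2.2.1 0 + u.2.2.1 1 * v.2.2.2 1 -
    u.2.2.2 1 * v.2.2.1 1) * h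

theorem omega_conjP (u v : Phase) : omega (conjP u) (conjP v) = star (omega u v) := by
  simp only [omega, conjP_apply, Fin.sum_univ_two, Phase.act, Phase.ang, Phase.ecc, Phase.eccT,
    Pi.smul_apply, Pi.star_apply, smul_eq_mul, star_add, star_sub, star_mul']
  linear_combination (star (u.2.2.2 0) * star (v.2.2.1 0) - star (u.2.2.1 0) * star (v.2.2.2 0) +
    star (u.2.2.2 1) * star (v.2.2.1 1) - star (u.2.2.1 1) * star (v.2.2.2 1)) * Complex.I_sq

/-! ### Complex neighbourhoods of the real collisionless circular co-orbital configurations -/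

/-- Circular orbits of exactly resonant planets whose longitudes differ by at least `D`. -/
def core (D : ℝ) : Set Phase :=
  {p | p.act = 0 ∧ (∃ t : Fin 2 → ℝ, t 0 ∈ Icc D (2 * π - D) ∧ ∀ j, p.ang j = t j) ∧
    p.ecc = 0 ∧ p.eccT = 0}

/-- The open `s`-neighbourhood of `core D` for the supremum norm. -/
def nbhd (D s : ℝ) : Set Phase := thickening s (core D)

variable {D s s' : ℝ} {p q : Phase}

theorem isOpen_nbhd : IsOpen (nbhd D s) := isOpen_thickening

theorem nbhd_mono (h : s ≤ s') : nbhd D s ⊆ nbhd D s' := thickening_mono h _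

theorem convex_core : Convex ℝ (core D) := by
  rintro p ⟨h1, ⟨t, ht, h2⟩, h3, h4⟩ q ⟨k1, ⟨t', ht', k2⟩, k3, k4⟩ a b ha hb hab
  simp only [Phase.act_def, Phase.ang_def, Phase.ecc_def, Phase.eccT_def] at *
  refine ⟨by simp [h1, k1], ⟨fun j => a * t j + b * t' j, convex_Icc _ _ ht ht' ha hb hab, ?_⟩,
    by simp [h3, k3], by simp [h4, k4]⟩
  intro j
  simp [h2, k2]

theorem convex_nbhd : Convex ℝ (nbhd D s) := convex_core.thickening s

theorem mem_nbhd_of_norm_sub_le {r : ℝ} (hp : p ∈ nbhd D s) (h : ‖q - p‖ ≤ r) :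
    q ∈ nbhd D (s + r) := by
  obtain ⟨k, hk, hpk⟩ := mem_thickening_iff.1 hp
  refine mem_thickening_iff.2 ⟨k, hk, ?_⟩
  calc dist q k ≤ dist q p + dist p k := dist_triangle _ _ _
    _ < s + r := by rw [dist_eq_norm q p]; linarith

theorem closedBall_subset_nbhd {r : ℝ} (hp : p ∈ nbhd D s) :
    closedBall p r ⊆ nbhd D (s + r) := fun q hq =>
  mem_nbhd_of_norm_sub_le hp (by rwa [mem_closedBall, dist_eq_norm] at hq)

theorem ball_subset_nbhd {r : ℝ} (hp : p ∈ nbhd D (s - r)) : ball p r ⊆ nbhd D s := fun q hq => by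
  have := closedBall_subset_nbhd hp (ball_subset_closedBall hq)
  simpa using this

theorem mem_nbhd_of_isometry {σ : Phase → Phase} (h1 : ∀ p q, ‖σ p - σ q‖ = ‖p - q‖)
    (h2 : MapsTo σ (core D) (core D)) (hp : p ∈ nbhd D s) : σ p ∈ nbhd D s := by
  obtain ⟨k, hk, hpk⟩ := mem_thickening_iff.1 hp
  exact mem_thickening_iff.2 ⟨σ k, h2 hk, by rwa [dist_eq_norm, h1, ← dist_eq_norm]⟩

theorem add_fastDir_mem_nbhd (hp : p ∈ nbhd D s) (t : ℝ) : p + (t : ℂ) • fastDir ∈ nbhd D s := by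
  refine mem_nbhd_of_isometry (σ := fun p => p + (t : ℂ) • fastDir) (by simp) ?_ hp
  rintro p ⟨h1, ⟨τ, hτ, h2⟩, h3, h4⟩
  simp only [Phase.act_def, Phase.ang_def, Phase.ecc_def, Phase.eccT_def] at *
  refine ⟨by simpa [fastDir] using h1, ⟨τ + ![0, t], by simpa using hτ, fun j => ?_⟩,
    by simpa [fastDir] using h3, by simpa [fastDir] using h4⟩
  fin_cases j <;> simp [fastDir, h2]

theorem rot_mem_nbhd (hp : p ∈ nbhd D s) (θ : ℝ) : rot θ p ∈ nbhd D s := by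
  refine add_fastDir_mem_nbhd ?_ θ
  refine mem_nbhd_of_isometry (σ := rotLin θ) (fun p q => by rw [← map_sub, norm_rotLin]) ?_ hp
  rintro p ⟨h1, h2, h3, h4⟩
  simp only [Phase.act_def, Phase.ang_def, Phase.ecc_def, Phase.eccT_def] at *
  exact ⟨h1, h2, by simp [rotLin, h3], by simp [rotLin, h4]⟩

theorem conjP_mem_nbhd (hp : p ∈ nbhd D s) : conjP p ∈ nbhd D s := by
  refine mem_nbhd_of_isometry (σ := conjP) (fun p q => ?_) ?_ hp
  · rw [← norm_conjP (p - q), sub_eq_add_neg p q, ← neg_one_smul ℂ q, conjP_add, conjP_smul]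
    simp [sub_eq_add_neg]
  rintro p ⟨h1, ⟨τ, hτ, h2⟩, h3, h4⟩
  simp only [Phase.act_def, Phase.ang_def, Phase.ecc_def, Phase.eccT_def] at *
  refine ⟨by simp [conjP_apply, h1], ⟨τ, hτ, fun j => by simp [conjP_apply, h2]⟩,
    by simp [conjP_apply, h4], by simp [conjP_apply, h3]⟩

theorem norm_fderiv_le_of_nbhd {F : Type*} [NormedAddCommGroup F] [NormedSpace ℂ F]
    {f : Phase → F} {M δ : ℝ} (hδ : 0 < δ) (hd : DifferentiableOn ℂ f (nbhd D s))
    (hM : ∀ p ∈ nbhd D s, ‖f p‖ ≤ M) (hp : p ∈ nbhd D (s - δ)) : ‖fderiv ℂ f p‖ ≤ M / δ :=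
  norm_fderiv_le_of_ball hδ (hd.mono (ball_subset_nbhd hp))
    fun _ hq => hM _ (ball_subset_nbhd hp hq)

theorem norm_image_sub_le_of_nbhd {F : Type*} [NormedAddCommGroup F] [NormedSpace ℂ F]
    {f : Phase → F} {M : ℝ} (hd : DifferentiableOn ℂ f (nbhd D s))
    (hM : ∀ p ∈ nbhd D s, ‖fderiv ℂ f p‖ ≤ M) (hp : p ∈ nbhd D s) (hq : q ∈ nbhd D s) :
    ‖f q - f p‖ ≤ M * ‖q - p‖ :=
  convex_nbhd.norm_image_sub_le_of_norm_fderiv_le (𝕜 := ℂ)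
    (fun _ hx => hd.differentiableAt (isOpen_nbhd.mem_nhds hx)) hM hp hq

/-! ### Symmetric functions -/

/-- Functions on `W` which are invariant under the rotations of the system and real at the real
points. -/
structure IsSym (f : Phase → ℂ) (W : Set Phase) : Prop where
  rot : ∀ p ∈ W, ∀ θ : ℝ, f (rot θ p) = f p
  conj : ∀ p ∈ W, f (conjP p) = star (f p)

theorem IsSym.mono {f : Phase → ℂ} {W W' : Set Phase} (h : IsSym f W) (hs : W' ⊆ W) :
    IsSym f W' := ⟨fun p hp => h.rot p (hs hp), fun p hp => h.conj p (hs hp)⟩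

theorem IsSym.add {f g : Phase → ℂ} {W : Set Phase} (hf : IsSym f W) (hg : IsSym g W) :
    IsSym (fun p => f p + g p) W :=
  ⟨fun p hp θ => by rw [hf.rot p hp, hg.rot p hp], fun p hp => by
    rw [hf.conj p hp, hg.conj p hp, star_add]⟩

theorem IsSym.sub {f g : Phase → ℂ} {W : Set Phase} (hf : IsSym f W) (hg : IsSym g W) :
    IsSym (fun p => f p - g p) W :=
  ⟨fun p hp θ => by rw [hf.rot p hp, hg.rot p hp], fun p hp => by
    rw [hf.conj p hp, hg.conj p hp, star_sub]⟩

theorem fderiv_conjP {f : Phase → ℂ} (hf : DifferentiableOn ℂ f (nbhd D s))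
    (hsym : ∀ p ∈ nbhd D s, f (conjP p) = star (f p)) (hp : p ∈ nbhd D s) (v : Phase) :
    fderiv ℂ f (conjP p) (conjP v) = star (fderiv ℂ f p v) := by
  have h1 : DifferentiableAt ℂ f (swapLin (star p)) :=
    hf.differentiableAt (isOpen_nbhd.mem_nhds (conjP_mem_nbhd hp))
  have h2 : HasFDerivAt (fun q => f (swapLin q)) ((fderiv ℂ f (conjP p)).comp swapLin) (star p) :=
    h1.hasFDerivAt.comp (star p) swapLin.hasFDerivAt
  have h3 := h2.star_star
  rw [star_star] at h3
  have h4 : (star ∘ (fun q => f (swapLin q)) ∘ star) =ᶠ[𝓝 p] f := by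
    filter_upwards [isOpen_nbhd.mem_nhds hp] with q hq
    have := hsym q hq
    simp only [Function.comp_apply]
    change star (f (conjP q)) = _
    rw [this, star_star]
  have h5 := (h3.congr_of_eventuallyEq h4.symm).fderiv
  rw [h5]
  simp [conjP]

theorem fderiv_rot {f : Phase → ℂ} (hf : DifferentiableOn ℂ f (nbhd D s))
    {θ : ℝ} (hsym : ∀ p ∈ nbhd D s, f (rot θ p) = f p) (hp : p ∈ nbhd D s) (v : Phase) :
    fderiv ℂ f (rot θ p) (rotLin θ v) = fderiv ℂ f p v := by
  have h1 : DifferentiableAt ℂ f (rot θ p) :=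
    hf.differentiableAt (isOpen_nbhd.mem_nhds (rot_mem_nbhd hp θ))
  have h2 : HasFDerivAt (fun q => f (rot θ q)) ((fderiv ℂ f (rot θ p)).comp (rotLin θ)) p :=
    h1.hasFDerivAt.comp p ((rotLin θ).hasFDerivAt.add_const _)
  have h4 : (fun q => f (rot θ q)) =ᶠ[𝓝 p] f := by
    filter_upwards [isOpen_nbhd.mem_nhds hp] with q hq using hsym q hq
  rw [(h2.congr_of_eventuallyEq h4.symm).fderiv]
  rfl

theorem fderiv_add_fastDir {f : Phase → ℂ} {t : ℂ}
    (hsym : ∀ p ∈ nbhd D s, f (p + t • fastDir) = f p) (hp : p ∈ nbhd D s) :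
    fderiv ℂ f (p + t • fastDir) = fderiv ℂ f p := by
  rw [← fderiv_comp_add_right]
  apply Filter.EventuallyEq.fderiv_eq
  filter_upwards [isOpen_nbhd.mem_nhds hp] with q hq using hsym q hq

/-- The Hamiltonian vector field of `f`. -/
def hamField (f : Phase → ℂ) (p : Phase) : Phase := hamVec (fderiv ℂ f p)

theorem omega_hamField (f : Phase → ℂ) (p v : Phase) :
    omega (hamField f p) v = fderiv ℂ f p v := omega_hamVec_left _ _

theorem hamField_rot {f : Phase → ℂ} (hf : DifferentiableOn ℂ f (nbhd D s))
    (hsym : IsSym f (nbhd D s)) (hp : p ∈ nbhd D s) (θ : ℝ) :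
    hamField f (rot θ p) = rotLin θ (hamField f p) := by
  have hsurj : ∀ v, ∃ u, rotLin θ u = v := fun v => ⟨rotLin (-θ) v, by
    have h1 : Complex.exp (θ * Complex.I) * Complex.exp (-(θ * Complex.I)) = 1 := by
      rw [← Complex.exp_add]; simp
    have h2 : Complex.exp (-(θ * Complex.I)) * Complex.exp (θ * Complex.I) = 1 := by
      rw [mul_comm, h1]
    ext j <;> simp [rotLin, ← mul_assoc, h1, h2]⟩
  apply eq_of_omega_eq
  intro v
  obtain ⟨u, rfl⟩ := hsurj v
  rw [omega_hamField, omega_rotLin, omega_hamField,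
    fderiv_rot hf (fun p hp => hsym.rot p hp θ) hp]

theorem hamField_conjP {f : Phase → ℂ} (hf : DifferentiableOn ℂ f (nbhd D s))
    (hsym : IsSym f (nbhd D s)) (hp : p ∈ nbhd D s) :
    hamField f (conjP p) = conjP (hamField f p) := by
  apply eq_of_omega_eq
  intro v
  rw [← conjP_conjP v, omega_hamField, omega_conjP, omega_hamField,
    fderiv_conjP hf hsym.conj hp]

theorem differentiableOn_hamField {f : Phase → ℂ} (hf : DifferentiableOn ℂ f (nbhd D s)) :
    DifferentiableOn ℂ (hamField f) (nbhd D s) :=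
  hamVec.differentiable.comp_differentiableOn (differentiableOn_fderiv isOpen_nbhd hf)

/-- The derivative of a Hamiltonian vector field is an infinitesimally symplectic map, since second
derivatives are symmetric. -/
theorem omega_fderiv_hamField {f : Phase → ℂ} (hf : DifferentiableOn ℂ f (nbhd D s))
    (hp : p ∈ nbhd D s) (u v : Phase) :
    omega (fderiv ℂ (hamField f) p u) v + omega u (fderiv ℂ (hamField f) p v) = 0 := by
  have h1 : DifferentiableAt ℂ (fderiv ℂ f) p :=
    (differentiableOn_fderiv isOpen_nbhd hf).differentiableAt (isOpen_nbhd.mem_nhds hp)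
  have h2 : ∀ w, fderiv ℂ (hamField f) p w = hamVec (fderiv ℂ (fderiv ℂ f) p w) := by
    intro w
    have : HasFDerivAt (hamField f) (hamVec.comp (fderiv ℂ (fderiv ℂ f) p)) p :=
      hamVec.hasFDerivAt.comp p h1.hasFDerivAt
    rw [this.fderiv]
    rfl
  have h3 : ContDiffAt ℂ 2 f p := (analyticOnNhd_of_differentiableOn isOpen_nbhd hf p hp).contDiffAt
  have h4 := h3.isSymmSndFDerivAt (by simp [minSmoothness_of_isRCLikeNormedField])
  rw [h2, h2, omega_hamVec_left, omega_antisymm u, omega_hamVec_left, h4.eq u v]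
  ring

end

/-! ### Averaging over the fast angle -/

noncomputable section

variable {D s s' : ℝ} {p q : Phase}

/-- Weighted integral of `f` over one turn of the fast angle, starting from `p`. -/
def fastInt (w : ℝ → ℂ) (f : Phase → ℂ) (p : Phase) : ℂ :=
  ∫ t in (0 : ℝ)..(2 * π), w t • f (p + (t : ℂ) • fastDir)

/-- Average of `f` over one turn of the fast angle, starting from `p`. -/
def shiftAvg (f : Phase → ℂ) : Phase → ℂ := fastInt (fun _ => ((2 * π)⁻¹ : ℝ)) f

theorem continuousOn_comp_fastDir {F : Type*} [TopologicalSpace F] {f : Phase → F}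
    (hf : ContinuousOn f (nbhd D s)) (hp : p ∈ nbhd D s) :
    Continuous fun t : ℝ => f (p + (t : ℂ) • fastDir) :=
  hf.comp_continuous (by fun_prop) fun t => add_fastDir_mem_nbhd hp t

theorem hasFDerivAt_fastInt {w : ℝ → ℂ} (hw : Continuous w) {f : Phase → ℂ}
    (hf : DifferentiableOn ℂ f (nbhd D s)) (hp : p ∈ nbhd D s) :
    HasFDerivAt (fastInt w f)
      (∫ t in (0 : ℝ)..(2 * π), w t • fderiv ℂ f (p + (t : ℂ) • fastDir)) p :=
  hasFDerivAt_integral_translates isOpen_nbhd hf hw (by fun_prop)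
    fun t _ => add_fastDir_mem_nbhd hp t

theorem differentiableOn_fastInt {w : ℝ → ℂ} (hw : Continuous w) {f : Phase → ℂ}
    (hf : DifferentiableOn ℂ f (nbhd D s)) : DifferentiableOn ℂ (fastInt w f) (nbhd D s) :=
  fun _ hp => (hasFDerivAt_fastInt hw hf hp).differentiableAt.differentiableWithinAt

theorem differentiableOn_shiftAvg {f : Phase → ℂ}
    (hf : DifferentiableOn ℂ f (nbhd D s)) : DifferentiableOn ℂ (shiftAvg f) (nbhd D s) :=
  differentiableOn_fastInt continuous_const hf

theorem fderiv_fastInt_apply {w : ℝ → ℂ} (hw : Continuous w) {f : Phase → ℂ}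
    (hf : DifferentiableOn ℂ f (nbhd D s)) (hp : p ∈ nbhd D s) (v : Phase) :
    fderiv ℂ (fastInt w f) p v =
      ∫ t in (0 : ℝ)..(2 * π), w t * fderiv ℂ f (p + (t : ℂ) • fastDir) v := by
  rw [(hasFDerivAt_fastInt hw hf hp).fderiv, ContinuousLinearMap.intervalIntegral_apply]
  · simp
  · exact (hw.smul (continuousOn_comp_fastDir
      (continuousOn_fderiv_of_differentiableOn isOpen_nbhd hf) hp)).intervalIntegrable _ _

theorem norm_fastInt_le {w : ℝ → ℂ} {f : Phase → ℂ} {W M : ℝ}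
    (hw : ∀ t ∈ Icc 0 (2 * π), ‖w t‖ ≤ W) (hM : ∀ p ∈ nbhd D s, ‖f p‖ ≤ M)
    (hp : p ∈ nbhd D s) : ‖fastInt w f p‖ ≤ W * M * (2 * π) := by
  have := intervalIntegral.norm_integral_le_of_norm_le_const (a := 0) (b := 2 * π)
    (f := fun t => w t • f (p + (t : ℂ) • fastDir)) (C := W * M) fun t ht => by
      rw [uIoc_of_le Real.two_pi_pos.le] at ht
      have h1 := hw t (Ioc_subset_Icc_self ht)
      rw [norm_smul]
      exact mul_le_mul h1 (hM _ (add_fastDir_mem_nbhd hp t)) (norm_nonneg _)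
        ((norm_nonneg _).trans h1)
  simpa [fastInt, abs_of_pos Real.two_pi_pos] using this

theorem norm_shiftAvg_le {f : Phase → ℂ} {M : ℝ} (hM : ∀ p ∈ nbhd D s, ‖f p‖ ≤ M)
    (hp : p ∈ nbhd D s) : ‖shiftAvg f p‖ ≤ M := by
  have := norm_fastInt_le (w := fun _ => ((2 * π)⁻¹ : ℝ)) (W := (2 * π)⁻¹) (by
    intro t _
    rw [Complex.norm_real, Real.norm_of_nonneg (by positivity)]) hM hp
  calc _ ≤ _ := this
    _ = M := by field_simp

theorem IsSym.fastInt {w : ℝ → ℝ} {f : Phase → ℂ} (hf : IsSym f (nbhd D s)) :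
    IsSym (fastInt (fun t => (w t : ℂ)) f) (nbhd D s) := by
  constructor
  · intro p hp θ
    simp only [Coorbital.fastInt]
    congr 1
    ext t
    rw [← rot_add_smul_fastDir, hf.rot _ (add_fastDir_mem_nbhd hp t)]
  · intro p hp
    simp only [Coorbital.fastInt]
    rw [← starRingEnd_apply, ← intervalIntegral.intervalIntegral_conj]
    congr 1
    ext t
    rw [← conjP_add_smul_fastDir, hf.conj _ (add_fastDir_mem_nbhd hp t)]
    simp

theorem IsSym.shiftAvg {f : Phase → ℂ} (hf : IsSym f (nbhd D s)) :
    IsSym (shiftAvg f) (nbhd D s) := hf.fastInt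

theorem IsSym.periodic {f : Phase → ℂ} {W : Set Phase} (hf : IsSym f W) (hp : p ∈ W) :
    f (p + ((2 * π : ℝ) : ℂ) • fastDir) = f p := by
  rw [← rot_two_pi, hf.rot p hp]

theorem hasDerivAt_comp_fastDir {f : Phase → ℂ} (hf : DifferentiableOn ℂ f (nbhd D s))
    (hp : p ∈ nbhd D s) (t : ℝ) : HasDerivAt (fun t : ℝ => f (p + (t : ℂ) • fastDir))
      (fderiv ℂ f (p + (t : ℂ) • fastDir) fastDir) t := by
  have h1 : HasDerivAt (fun t : ℂ => p + t • fastDir) fastDir (t : ℂ) := by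
    simpa using ((hasDerivAt_id (t : ℂ)).smul_const fastDir).const_add p
  have h2 := (hf.differentiableAt (isOpen_nbhd.mem_nhds (add_fastDir_mem_nbhd hp t))
    ).hasFDerivAt.comp_hasDerivAt (t : ℂ) h1
  exact h2.comp_ofReal

theorem continuous_fderiv_comp_fastDir {f : Phase → ℂ} (hf : DifferentiableOn ℂ f (nbhd D s))
    (hp : p ∈ nbhd D s) (v : Phase) :
    Continuous fun t : ℝ => fderiv ℂ f (p + (t : ℂ) • fastDir) v :=
  (continuousOn_comp_fastDir (continuousOn_fderiv_of_differentiableOn isOpen_nbhd hf) hp).clm_apply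
    continuous_const

theorem shiftAvg_add {f : Phase → ℂ} (hper : ∀ p ∈ nbhd D s,
    f (p + ((2 * π : ℝ) : ℂ) • fastDir) = f p) (hp : p ∈ nbhd D s) (τ : ℝ) :
    shiftAvg f (p + (τ : ℂ) • fastDir) = shiftAvg f p := by
  have h1 : Function.Periodic (fun t : ℝ => ((2 * π)⁻¹ : ℂ) * f (p + (t : ℂ) • fastDir))
      (2 * π) := by
    intro t
    have := hper _ (add_fastDir_mem_nbhd hp t)
    simp only
    rw [← this, add_assoc, ← add_smul]
    simp
  have h2 := h1.intervalIntegral_add_eq τ 0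
  rw [zero_add] at h2
  have h3 : ∀ x : ℝ, p + (τ : ℂ) • fastDir + (x : ℂ) • fastDir
      = p + ((x + τ : ℝ) : ℂ) • fastDir := fun x => by
    push_cast; rw [add_smul]; abel
  simp only [shiftAvg, fastInt, smul_eq_mul]
  push_cast
  rw [← h2]
  simp only [h3]
  rw [intervalIntegral.integral_comp_add_right
    (f := fun x => (2 * (π : ℂ))⁻¹ * f (p + (x : ℂ) • fastDir))]
  simp [add_comm]

theorem shiftAvg_of_invariant {f : Phase → ℂ}
    (h : ∀ t : ℝ, f (p + (t : ℂ) • fastDir) = f p) : shiftAvg f p = f p := by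
  simp only [shiftAvg, fastInt, h, intervalIntegral.integral_const]
  simp only [sub_zero, smul_eq_mul, Complex.real_smul]
  push_cast
  have : (π : ℂ) ≠ 0 := by exact_mod_cast Real.pi_ne_zero
  field_simp

theorem shiftAvg_sub {f g : Phase → ℂ} (hf : ContinuousOn f (nbhd D s))
    (hg : ContinuousOn g (nbhd D s)) (hp : p ∈ nbhd D s) :
    shiftAvg (fun p => f p - g p) p = shiftAvg f p - shiftAvg g p := by
  simp only [shiftAvg, fastInt, smul_sub]
  exact intervalIntegral.integral_sub
    (((continuousOn_comp_fastDir hf hp).const_smul (((2 * π)⁻¹ : ℝ) : ℂ)).intervalIntegrable _ _)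
    (((continuousOn_comp_fastDir hg hp).const_smul (((2 * π)⁻¹ : ℝ) : ℂ)).intervalIntegrable _ _)

theorem fderiv_shiftAvg_fastDir {f : Phase → ℂ} (hf : DifferentiableOn ℂ f (nbhd D s))
    (hper : ∀ p ∈ nbhd D s, f (p + ((2 * π : ℝ) : ℂ) • fastDir) = f p) (hp : p ∈ nbhd D s) :
    fderiv ℂ (shiftAvg f) p fastDir = 0 := by
  rw [shiftAvg, fderiv_fastInt_apply continuous_const hf hp, intervalIntegral.integral_const_mul,
    intervalIntegral.integral_eq_sub_of_hasDerivAt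
      (fun t _ => hasDerivAt_comp_fastDir hf hp t)
      ((continuous_fderiv_comp_fastDir hf hp _).intervalIntegrable _ _), hper p hp]
  simp

/-- The average over a turn does not depend on the fast angle, even a complex one. -/
theorem shiftAvg_eq_of_sub {f : Phase → ℂ} (hf : DifferentiableOn ℂ f (nbhd D s))
    (hper : ∀ p ∈ nbhd D s, f (p + ((2 * π : ℝ) : ℂ) • fastDir) = f p) (hp : p ∈ nbhd D s)
    {z : ℂ} (hq : p + z • fastDir ∈ nbhd D s) :
    shiftAvg f (p + z • fastDir) = shiftAvg f p := by
  set g : ℝ → ℂ := fun t => shiftAvg f (p + (t : ℂ) • (z • fastDir)) with hg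
  have hmem : ∀ t ∈ Icc (0 : ℝ) 1, p + (t : ℂ) • (z • fastDir) ∈ nbhd D s := by
    intro t ht
    have := convex_nbhd.add_smul_sub_mem hp hq ht
    rw [add_sub_cancel_left] at this
    exact this
  have hd : ∀ t ∈ Icc (0 : ℝ) 1, HasDerivAt g 0 t := by
    intro t ht
    have h1 : HasDerivAt (fun t : ℂ => p + t • (z • fastDir)) (z • fastDir) (t : ℂ) := by
      simpa using ((hasDerivAt_id (t : ℂ)).smul_const (z • fastDir)).const_add p
    have h2 := ((differentiableOn_shiftAvg hf).differentiableAt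
      (isOpen_nbhd.mem_nhds (hmem t ht))).hasFDerivAt.comp_hasDerivAt (t : ℂ) h1
    rw [map_smul, fderiv_shiftAvg_fastDir hf hper (hmem t ht), smul_zero] at h2
    exact h2.comp_ofReal
  have := constant_of_has_deriv_right_zero (f := g) (a := 0) (b := 1)
    (fun t ht => (hd t ht).continuousAt.continuousWithinAt)
    (fun t ht => (hd t (Ico_subset_Icc_self ht)).hasDerivWithinAt) 1 (by simp)
  simpa [hg] using this

/-- The homological equation `υ ∂χ/∂ζ₂ = -R` for a function `R` of zero average.  The solution is
`∫ t R(ζ₂ + t) dt`, up to a factor, made of zero average; it is bounded on the domain of `R` itself,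
without loss. -/
theorem exists_homological {υ r : ℝ} (hυ : 0 < υ) {R : Phase → ℂ}
    (hR : DifferentiableOn ℂ R (nbhd D s)) (hsym : IsSym R (nbhd D s))
    (havg : ∀ p ∈ nbhd D s, shiftAvg R p = 0) (hr : ∀ p ∈ nbhd D s, ‖R p‖ ≤ r) :
    ∃ χ : Phase → ℂ, DifferentiableOn ℂ χ (nbhd D s) ∧ IsSym χ (nbhd D s) ∧
      (∀ p ∈ nbhd D s, υ * fderiv ℂ χ p fastDir = -R p) ∧
      (∀ p ∈ nbhd D s, shiftAvg χ p = 0) ∧ ∀ p ∈ nbhd D s, ‖χ p‖ ≤ 4 * π / υ * r := by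
  have hπ : (π : ℂ) ≠ 0 := by exact_mod_cast Real.pi_ne_zero
  have hυ' : (υ : ℂ) ≠ 0 := by exact_mod_cast hυ.ne'
  set w : ℝ → ℝ := fun t => -(t / (2 * π * υ)) with hw
  have hwc : Continuous fun t => (w t : ℂ) := by fun_prop
  set χ₀ : Phase → ℂ := fastInt (fun t => (w t : ℂ)) R with hχ₀
  have h0d : DifferentiableOn ℂ χ₀ (nbhd D s) := differentiableOn_fastInt hwc hR
  have h0s : IsSym χ₀ (nbhd D s) := hsym.fastInt
  have h0per : ∀ p ∈ nbhd D s, χ₀ (p + ((2 * π : ℝ) : ℂ) • fastDir) = χ₀ p :=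
    fun p hp => h0s.periodic hp
  have h0b : ∀ p ∈ nbhd D s, ‖χ₀ p‖ ≤ 2 * π / υ * r := by
    intro p hp
    have := norm_fastInt_le (w := fun t => (w t : ℂ)) (W := 1 / υ) (fun t ht => by
      rw [Complex.norm_real, hw, norm_neg, Real.norm_of_nonneg (div_nonneg ht.1 (by positivity)),
        div_le_div_iff₀ (by positivity) hυ]
      nlinarith [ht.2, Real.pi_pos]) hr hp
    calc _ ≤ _ := this
      _ = _ := by ring
  -- integration by parts: the boundary term is `-R p / υ` by periodicity, the integral vanishes
  have h0e : ∀ p ∈ nbhd D s, υ * fderiv ℂ χ₀ p fastDir = -R p := by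
    intro p hp
    have hI : (∫ t in (0 : ℝ)..(2 * π), R (p + (t : ℂ) • fastDir)) = 0 := by
      have := havg p hp
      simp only [shiftAvg, fastInt, smul_eq_mul, intervalIntegral.integral_const_mul] at this
      exact (mul_eq_zero.1 this).resolve_left (by
        push_cast; simp [hπ])
    have hparts := intervalIntegral.integral_mul_deriv_eq_deriv_mul (a := 0) (b := 2 * π)
      (u := fun t => (w t : ℂ)) (u' := fun _ => -(1 / (2 * π * υ) : ℂ))
      (v := fun t : ℝ => R (p + (t : ℂ) • fastDir))
      (v' := fun t : ℝ => fderiv ℂ R (p + (t : ℂ) • fastDir) fastDir)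
      (fun t _ => by
        have : HasDerivAt (fun t : ℂ => -(t / (2 * π * υ))) (-(1 / (2 * π * υ))) (t : ℂ) :=
          ((hasDerivAt_id (t : ℂ)).div_const _).neg
        simpa [hw] using this.comp_ofReal)
      (fun t _ => hasDerivAt_comp_fastDir hR hp t)
      (continuous_const.intervalIntegrable _ _)
      ((continuous_fderiv_comp_fastDir hR hp _).intervalIntegrable _ _)
    rw [hχ₀, fderiv_fastInt_apply hwc hR hp, hparts, intervalIntegral.integral_const_mul, hI,
      hsym.periodic hp, hw]
    simp only
    push_cast
    field_simp
    simp
  refine ⟨fun p => χ₀ p - shiftAvg χ₀ p, h0d.sub (differentiableOn_shiftAvg h0d),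
    h0s.sub h0s.shiftAvg, fun p hp => ?_, fun p hp => ?_, fun p hp => ?_⟩
  · have hnh := isOpen_nbhd.mem_nhds hp
    rw [fderiv_fun_sub (h0d.differentiableAt hnh)
      ((differentiableOn_shiftAvg h0d).differentiableAt hnh), ← h0e p hp]
    simp [fderiv_shiftAvg_fastDir h0d h0per hp]
  · rw [shiftAvg_sub h0d.continuousOn (differentiableOn_shiftAvg h0d).continuousOn hp,
      shiftAvg_of_invariant (f := shiftAvg χ₀) fun t => shiftAvg_add h0per hp t, sub_self]
  · calc _ ≤ ‖χ₀ p‖ + ‖shiftAvg χ₀ p‖ := norm_sub_le _ _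
      _ ≤ 2 * π / υ * r + 2 * π / υ * r := add_le_add (h0b p hp) (norm_shiftAvg_le h0b hp)
      _ = _ := by ring

/-- The Poisson bracket of a function independent of the fast angle with a function of zero average
has zero average. -/
theorem shiftAvg_fderiv_hamField {g χ : Phase → ℂ}
    (hχ : DifferentiableOn ℂ χ (nbhd D s))
    (hinv : ∀ p ∈ nbhd D s, ∀ t : ℝ, g (p + (t : ℂ) • fastDir) = g p)
    (havg : ∀ p ∈ nbhd D s, shiftAvg χ p = 0) (hp : p ∈ nbhd D s) :
    shiftAvg (fun p => fderiv ℂ g p (hamField χ p)) p = 0 := by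
  set L : (Phase →L[ℂ] ℂ) →L[ℂ] ℂ := (fderiv ℂ g p).comp hamVec with hL
  have h1 : ∀ t : ℝ, fderiv ℂ g (p + (t : ℂ) • fastDir) = fderiv ℂ g p := fun t =>
    fderiv_add_fastDir (fun q hq => hinv q hq t) hp
  have h2 : HasFDerivAt (shiftAvg χ) (0 : Phase →L[ℂ] ℂ) p := by
    refine (hasFDerivAt_const (0 : ℂ) p).congr_of_eventuallyEq ?_
    filter_upwards [isOpen_nbhd.mem_nhds hp] with q hq using havg q hq
  have h3 := (hasFDerivAt_fastInt continuous_const hχ hp).unique h2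
  have h4 : (fun t : ℝ => (((2 * π)⁻¹ : ℝ) : ℂ) • fderiv ℂ g (p + (t : ℂ) • fastDir)
      (hamField χ (p + (t : ℂ) • fastDir))) =
      fun t : ℝ => L ((((2 * π)⁻¹ : ℝ) : ℂ) • fderiv ℂ χ (p + (t : ℂ) • fastDir)) := by
    ext t
    rw [h1, map_smul]
    rfl
  simp only [shiftAvg, fastInt]
  rw [h4, L.intervalIntegral_comp_comm, h3, map_zero]
  exact ((continuousOn_comp_fastDir
      (continuousOn_fderiv_of_differentiableOn isOpen_nbhd hχ) hp).const_smul (((2 * π)⁻¹ : ℝ) : ℂ)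
    ).intervalIntegrable _ _

/-- The average over a turn starting from `p` is the average over `[0, 2π]`: the fast angle of `p`,
which may be complex, is moved to `0`. -/
theorem avg_eq_shiftAvg {f : Phase → ℂ} (hf : DifferentiableOn ℂ f (nbhd D s))
    (hper : ∀ p ∈ nbhd D s, f (p + ((2 * π : ℝ) : ℂ) • fastDir) = f p) (hp : p ∈ nbhd D s) :
    avg f p = shiftAvg f p := by
  have h0 : ∀ t : ℝ, p + (-(p.2.1 1)) • fastDir + (t : ℂ) • fastDir =
      (p.act, ![p.ang 0, (t : ℂ)], p.ecc, p.eccT) := by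
    intro t
    ext j <;> fin_cases j <;> simp [fastDir, Matrix.vecHead, Matrix.vecTail]
  have hq : p + (-(p.2.1 1)) • fastDir ∈ nbhd D s := by
    obtain ⟨k, ⟨k1, ⟨τ, hτ, k2⟩, k3, k4⟩, hk⟩ := mem_thickening_iff.1 hp
    refine mem_thickening_iff.2 ⟨k + (-(τ 1 : ℂ)) • fastDir,
      ⟨by simpa [fastDir] using k1, ⟨![τ 0, 0], by simpa using hτ, fun j => ?_⟩,
        by simpa [fastDir] using k3, by simpa [fastDir] using k4⟩, ?_⟩
    · have := k2 j
      fin_cases j <;> simp_all [fastDir]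
    · rw [dist_eq_norm] at hk ⊢
      have h5 := Phase.norm_le_iff.1 (le_refl ‖p - k‖)
      have hs : 0 < s := (norm_nonneg _).trans_lt hk
      refine lt_of_le_of_lt (Phase.norm_le_iff.2 ⟨?_, ?_, ?_, ?_⟩) hk
      · simpa [fastDir] using h5.1
      · rw [pi_norm_le_iff_of_nonneg (norm_nonneg _)]
        intro j
        have h6 := (pi_norm_le_iff_of_nonneg (norm_nonneg _)).1 h5.2.1 0
        have h7 := k2 1
        simp only [Phase.ang_def] at h7
        fin_cases j
        · simpa [fastDir, Matrix.vecHead] using h6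
        · simp [fastDir, h7, Matrix.vecHead, Matrix.vecTail]
      · simpa [fastDir] using h5.2.2.1
      · simpa [fastDir] using h5.2.2.2
  rw [← shiftAvg_eq_of_sub hf hper hp hq]
  simp only [shiftAvg, fastInt, avg, h0, smul_eq_mul, intervalIntegral.integral_const_mul]
  push_cast
  rw [one_div]

end

/-! ### Near-identity canonical transformations -/

noncomputable section

variable {D s s' s'' : ℝ} {p q : Phase}

/-- Symmetric canonical transformations of `nbhd D s` into `nbhd D s'` at distance at most `d` from
the identity. -/
structure IsNearIdentity (D s s' d : ℝ) (U : Phase → Phase) : Prop where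
  diff : DifferentiableOn ℂ U (nbhd D s)
  maps : MapsTo U (nbhd D s) (nbhd D s')
  near : ∀ p ∈ nbhd D s, ‖U p - p‖ ≤ d
  symplectic : ∀ p ∈ nbhd D s, ∀ u v, omega (fderiv ℂ U p u) (fderiv ℂ U p v) = omega u v
  rot : ∀ p ∈ nbhd D s, ∀ θ : ℝ, U (rot θ p) = rot θ (U p)
  conj : ∀ p ∈ nbhd D s, U (conjP p) = conjP (U p)
  angMom : ∀ p ∈ nbhd D s, angMom (U p) = angMom p

theorem IsNearIdentity.id (h : s ≤ s') : IsNearIdentity D s s' 0 (fun p => p) where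
  diff := differentiableOn_id
  maps := nbhd_mono h
  near p _ := by simp
  symplectic p _ u v := by simp
  rot _ _ _ := rfl
  conj _ _ := rfl
  angMom _ _ := rfl

theorem IsNearIdentity.comp {U V : Phase → Phase} {d d' : ℝ} (hU : IsNearIdentity D s' s'' d U)
    (hV : IsNearIdentity D s s' d' V) : IsNearIdentity D s s'' (d + d') (fun p => U (V p)) where
  diff := hU.diff.comp hV.diff hV.maps
  maps := hU.maps.comp hV.maps
  near p hp := by
    calc ‖U (V p) - p‖ = ‖(U (V p) - V p) + (V p - p)‖ := by congr 1; abel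
      _ ≤ d + d' := (norm_add_le _ _).trans
        (add_le_add (hU.near _ (hV.maps hp)) (hV.near _ hp))
  symplectic p hp u v := by
    have h1 := hU.diff.differentiableAt (isOpen_nbhd.mem_nhds (hV.maps hp))
    have h2 := hV.diff.differentiableAt (isOpen_nbhd.mem_nhds hp)
    have h3 : HasFDerivAt (fun p => U (V p)) ((fderiv ℂ U (V p)).comp (fderiv ℂ V p)) p :=
      h1.hasFDerivAt.comp p h2.hasFDerivAt
    rw [h3.fderiv, ContinuousLinearMap.comp_apply, ContinuousLinearMap.comp_apply,
      hU.symplectic _ (hV.maps hp), hV.symplectic _ hp]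
  rot p hp θ := by rw [hV.rot p hp, hU.rot _ (hV.maps hp)]
  conj p hp := by rw [hV.conj p hp, hU.conj _ (hV.maps hp)]
  angMom p hp := by rw [hU.angMom _ (hV.maps hp), hV.angMom p hp]

theorem IsNearIdentity.mono {U : Phase → Phase} {d d' r r' : ℝ} (hU : IsNearIdentity D s s' d U)
    (hr : r ≤ s) (hr' : s' ≤ r') (hd : d ≤ d') : IsNearIdentity D r r' d' U where
  diff := hU.diff.mono (nbhd_mono hr)
  maps _ hp := nbhd_mono hr' (hU.maps (nbhd_mono hr hp))
  near p hp := (hU.near p (nbhd_mono hr hp)).trans hd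
  symplectic p hp := hU.symplectic p (nbhd_mono hr hp)
  rot p hp := hU.rot p (nbhd_mono hr hp)
  conj p hp := hU.conj p (nbhd_mono hr hp)
  angMom p hp := hU.angMom p (nbhd_mono hr hp)

theorem IsSym.comp_nearIdentity {f : Phase → ℂ} {U : Phase → Phase} {d : ℝ}
    (hf : IsSym f (nbhd D s')) (hU : IsNearIdentity D s s' d U) :
    IsSym (fun p => f (U p)) (nbhd D s) :=
  ⟨fun p hp θ => by rw [hU.rot p hp, hf.rot _ (hU.maps hp)],
    fun p hp => by rw [hU.conj p hp, hf.conj _ (hU.maps hp)]⟩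

theorem approximatesLinearOn_id_add {Y : Phase → Phase} (hd : DifferentiableOn ℂ Y (nbhd D s))
    (hY : ∀ p ∈ nbhd D s, ‖fderiv ℂ Y p‖ ≤ 1 / 2) :
    ApproximatesLinearOn (fun p => p + Y p)
      ((ContinuousLinearEquiv.refl ℂ Phase : Phase ≃L[ℂ] Phase) : Phase →L[ℂ] Phase)
      (nbhd D s) (1 / 2) := by
  intro p hp q hq
  have := norm_image_sub_le_of_nbhd hd hY hq hp
  have h2 : p + Y p - (q + Y q) - (p - q) = Y p - Y q := by abel
  simp only [ContinuousLinearEquiv.coe_refl, ContinuousLinearMap.coe_id', id]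
  rw [h2]
  simpa using this

theorem half_lt_norm_refl_inv :
    Subsingleton Phase ∨ (1 / 2 : NNReal) <
      ‖((ContinuousLinearEquiv.refl ℂ Phase).symm : Phase →L[ℂ] Phase)‖₊⁻¹ := by
  right
  have : ‖((ContinuousLinearEquiv.refl ℂ Phase).symm : Phase →L[ℂ] Phase)‖₊ = 1 := by
    ext
    simp
  rw [this, inv_one]
  exact NNReal.half_lt_self one_ne_zero

/-- A map at small `C¹` distance from the identity is injective, since the domain is convex. -/
theorem injOn_id_add {Y : Phase → Phase} (hd : DifferentiableOn ℂ Y (nbhd D s))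
    (hY : ∀ p ∈ nbhd D s, ‖fderiv ℂ Y p‖ ≤ 1 / 2) : InjOn (fun p => p + Y p) (nbhd D s) :=
  (approximatesLinearOn_id_add hd hY).injOn half_lt_norm_refl_inv

theorem exists_id_add_eq {Y : Phase → Phase} (hd : DifferentiableOn ℂ Y (nbhd D s))
    (hY : ∀ p ∈ nbhd D s, ‖fderiv ℂ Y p‖ ≤ 1 / 2) {r : ℝ} (hr : 0 ≤ r)
    (hp : p ∈ nbhd D (s - r)) (hYp : ‖Y p‖ ≤ r / 2) :
    ∃ m ∈ closedBall p r, m + Y m = p := by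
  have hsub : closedBall p r ⊆ nbhd D s := by
    simpa using closedBall_subset_nbhd (r := r) hp
  have h1 := (approximatesLinearOn_id_add hd hY).surjOn_closedBall_of_nonlinearRightInverse
    (ContinuousLinearEquiv.toNonlinearRightInverse _) hr hsub
  have h2 : (((ContinuousLinearEquiv.refl ℂ Phase).toNonlinearRightInverse.nnnorm : ℝ)⁻¹
      - ((1 / 2 : NNReal) : ℝ)) * r = r / 2 := by
    have : ((ContinuousLinearEquiv.refl ℂ Phase).toNonlinearRightInverse.nnnorm : ℝ) = 1 := by
      change ‖((ContinuousLinearEquiv.refl ℂ Phase).symm : Phase →L[ℂ] Phase)‖ = 1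
      simp
    rw [this]
    norm_num
    ring
  rw [h2] at h1
  exact h1 (mem_closedBall.2 (by simpa [dist_eq_norm] using hYp))

theorem exists_inverse_id_add {Y : Phase → Phase} (hd : DifferentiableOn ℂ Y (nbhd D s))
    (hY : ∀ p ∈ nbhd D s, ‖fderiv ℂ Y p‖ ≤ 1 / 2) :
    ∃ B : Phase → Phase, ∀ m ∈ nbhd D s, B (m + Y m) = m ∧ DifferentiableAt ℂ B (m + Y m) := by
  set e := (approximatesLinearOn_id_add hd hY).toOpenPartialHomeomorph _ _
    half_lt_norm_refl_inv isOpen_nbhd with he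
  refine ⟨e.symm, fun m hm => ?_⟩
  have h1 : e.symm (m + Y m) = m := e.left_inv hm
  refine ⟨h1, ?_⟩
  have hYm := hd.differentiableAt (isOpen_nbhd.mem_nhds hm)
  have hinj : Function.Injective
      ((ContinuousLinearMap.id ℂ Phase + fderiv ℂ Y m : Phase →L[ℂ] Phase) :
        Phase →ₗ[ℂ] Phase) := by
    rw [← LinearMap.ker_eq_bot, LinearMap.ker_eq_bot']
    intro v hv
    have h2 : v = -(fderiv ℂ Y m v) := by
      have : v + fderiv ℂ Y m v = 0 := hv
      exact eq_neg_of_add_eq_zero_left this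
    have h3 : ‖v‖ ≤ 1 / 2 * ‖v‖ := by
      calc ‖v‖ = ‖fderiv ℂ Y m v‖ := (congrArg norm h2).trans (norm_neg _)
        _ ≤ _ := (fderiv ℂ Y m).le_of_opNorm_le (hY m hm) v
    exact norm_le_zero_iff.1 (by linarith)
  set f' : Phase ≃L[ℂ] Phase := (LinearEquiv.ofInjectiveEndo _ hinj).toContinuousLinearEquiv
    with hf'
  have hf : (f' : Phase →L[ℂ] Phase) = ContinuousLinearMap.id ℂ Phase + fderiv ℂ Y m :=
    ContinuousLinearMap.ext fun v => rfl
  have h2 : HasFDerivAt e (f' : Phase →L[ℂ] Phase) (e.symm (m + Y m)) := by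
    rw [h1, hf]
    exact (hasFDerivAt_id m).add hYm.hasFDerivAt
  exact (e.hasFDerivAt_symm (e.map_source hm) h2).differentiableAt

/-- Infinitesimal generator of the rotations. -/
def rotGen (p : Phase) : Phase :=
  (0, ![0, 1], Complex.I • p.2.2.1, -(Complex.I • p.2.2.2))

theorem hasDerivAt_rot (p : Phase) : HasDerivAt (fun θ : ℝ => rot θ p) (rotGen p) 0 := by
  have h1 : HasDerivAt (fun θ : ℂ => Complex.exp (θ * Complex.I)) Complex.I 0 := by
    simpa using ((hasDerivAt_id (0 : ℂ)).mul_const Complex.I).cexp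
  have h2 : HasDerivAt (fun θ : ℂ => Complex.exp (-(θ * Complex.I))) (-Complex.I) 0 := by
    simpa using (((hasDerivAt_id (0 : ℂ)).mul_const Complex.I).neg).cexp
  have h3 : HasDerivAt (fun θ : ℂ => p.2.1 + ![0, θ]) ![0, 1] 0 := by
    refine HasDerivAt.const_add _ ?_
    rw [hasDerivAt_pi]
    intro j
    fin_cases j
    · simpa using hasDerivAt_const (0 : ℂ) (0 : ℂ)
    · exact hasDerivAt_id' (0 : ℂ)
  have h4 : HasDerivAt (fun θ : ℂ => ((p.1, p.2.1 + ![0, θ],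
      Complex.exp (θ * Complex.I) • p.2.2.1, Complex.exp (-(θ * Complex.I)) • p.2.2.2) : Phase))
      (rotGen p) ((0 : ℝ) : ℂ) := by
    have := (hasDerivAt_const (0 : ℂ) p.1).prodMk (h3.prodMk
      ((h1.smul_const p.2.2.1).prodMk (h2.smul_const p.2.2.2)))
    simpa [rotGen] using this
  have h5 := h4.scomp (0 : ℝ) Complex.ofRealCLM.hasDerivAt
  rw [Complex.ofRealCLM_apply, Complex.ofReal_one, one_smul] at h5
  exact h5.congr_of_eventuallyEq (Eventually.of_forall fun θ => rot_apply θ p)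

theorem fderiv_rotGen {f : Phase → ℂ} (hf : DifferentiableAt ℂ f p)
    (hrot : ∀ θ : ℝ, f (rot θ p) = f p) : fderiv ℂ f p (rotGen p) = 0 := by
  have h0 : rot 0 p = p := by ext j <;> fin_cases j <;>
    simp [rot_apply, Matrix.vecHead, Matrix.vecTail]
  have h1 : HasFDerivAt f ((fderiv ℂ f p).restrictScalars ℝ) (rot 0 p) := by
    rw [h0]; exact hf.hasFDerivAt.restrictScalars ℝ
  have h2 := h1.comp_hasDerivAt 0 (hasDerivAt_rot p)
  have h3 : (f ∘ fun θ : ℝ => rot θ p) = fun _ => f p := by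
    ext θ; exact hrot θ
  rw [h3] at h2
  exact h2.unique (hasDerivAt_const _ _)

theorem rotGen_eq (p : Phase) : rotGen p = ((0, Pi.single 1 1, 0, 0) : Phase) +
    ∑ j, ((Complex.I * p.2.2.1 j) • ((0, 0, Pi.single j 1, 0) : Phase) +
      (-(Complex.I * p.2.2.2 j)) • ((0, 0, 0, Pi.single j 1) : Phase)) := by
  ext j <;> fin_cases j <;> simp [rotGen, Fin.sum_univ_two]

theorem apply_rotGen (l : Phase →L[ℂ] ℂ) (p : Phase) : l (rotGen p) =
    l (0, Pi.single 1 1, 0, 0) + ∑ j, (Complex.I * p.2.2.1 j * l (0, 0, Pi.single j 1, 0) -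
      Complex.I * p.2.2.2 j * l (0, 0, 0, Pi.single j 1)) := by
  rw [rotGen_eq]
  simp only [map_add, map_smul, smul_eq_mul, Fin.sum_univ_two]
  ring

/-- The implicit midpoint map `m - X(m)/2 ↦ m + X(m)/2` of the Hamiltonian vector field `X` of a
small symmetric function `χ`.  It is symplectic because its derivative is the Cayley transform of
`DX / 2`, it commutes with the affine symmetries of the system by uniqueness of the midpoint, and it
preserves the angular momentum exactly, because the latter is quadratic. -/
theorem exists_midpoint_map {χ : Phase → ℂ} {b δ : ℝ} (hδ : 0 < δ)
    (hχ : DifferentiableOn ℂ χ (nbhd D s)) (hsym : IsSym χ (nbhd D s))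
    (hb : ∀ p ∈ nbhd D s, ‖χ p‖ ≤ b) (hbδ : b ≤ δ ^ 2 / 4) :
    ∃ Φ m : Phase → Phase, IsNearIdentity D (s - 3 * δ) (s - 2 * δ) (b / δ) Φ ∧
      ∀ p ∈ nbhd D (s - 3 * δ), m p ∈ nbhd D (s - 2 * δ) ∧ ‖hamField χ (m p)‖ ≤ b / δ ∧
        m p = p + (1 / 2 : ℂ) • hamField χ (m p) ∧ Φ p = p + hamField χ (m p) := by
  set X := hamField χ with hX
  have hXd : DifferentiableOn ℂ X (nbhd D s) := differentiableOn_hamField hχ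
  have hX1 : ∀ p ∈ nbhd D (s - δ), ‖X p‖ ≤ b / δ := fun p hp =>
    (norm_hamVec_le _).trans (norm_fderiv_le_of_nbhd hδ hχ hb hp)
  have hX2 : ∀ p ∈ nbhd D (s - 2 * δ), ‖fderiv ℂ X p‖ ≤ b / δ ^ 2 := fun p hp => by
    have := norm_fderiv_le_of_nbhd hδ (hXd.mono (nbhd_mono (sub_le_self s hδ.le))) hX1
      (p := p) (nbhd_mono (by linarith) hp)
    rwa [div_div, ← sq] at this
  have hb1 : b / δ ≤ δ / 4 := by
    rw [div_le_iff₀ hδ]; nlinarith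
  have hb2 : b / δ ^ 2 ≤ 1 / 4 := by
    rw [div_le_iff₀ (by positivity)]; linarith
  set W := nbhd D (s - 2 * δ) with hW
  have hWs : W ⊆ nbhd D s := nbhd_mono (by linarith)
  have hW1 : W ⊆ nbhd D (s - δ) := nbhd_mono (by linarith)
  have hY : ∀ (c : ℂ), ‖c‖ = 1 / 2 →
      DifferentiableOn ℂ (fun p => c • X p) W ∧
      ∀ p ∈ W, ‖fderiv ℂ (fun p => c • X p) p‖ ≤ 1 / 2 := by
    intro c hc
    refine ⟨(hXd.mono hWs).const_smul c, fun p hp => ?_⟩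
    rw [fderiv_fun_const_smul (hXd.differentiableAt (isOpen_nbhd.mem_nhds (hWs hp))), norm_smul, hc]
    have := hX2 p hp
    linarith
  have hc : ‖(-(1 / 2) : ℂ)‖ = 1 / 2 := by norm_num
  obtain ⟨hYd, hYb⟩ := hY _ hc
  obtain ⟨B, hB⟩ := exists_inverse_id_add hYd hYb
  have hinj := injOn_id_add hYd hYb
  have hex : ∀ p ∈ nbhd D (s - 3 * δ), ∃ m ∈ W, m + (-(1 / 2) : ℂ) • X m = p := by
    intro p hp
    have hp' : p ∈ nbhd D (s - 2 * δ - δ / 2) := nbhd_mono (by linarith) hp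
    obtain ⟨m, hm, hmp⟩ := exists_id_add_eq hYd hYb (r := δ / 2) (by positivity) hp' (by
      rw [norm_smul, hc]
      have := hX1 p (nbhd_mono (by linarith) hp)
      linarith)
    refine ⟨m, ?_, hmp⟩
    have := closedBall_subset_nbhd hp' hm
    rwa [sub_add_cancel] at this
  have hBm : ∀ p ∈ nbhd D (s - 3 * δ), B p ∈ W ∧ B p + (-(1 / 2) : ℂ) • X (B p) = p ∧
      DifferentiableAt ℂ B p := by
    intro p hp
    obtain ⟨m, hm, hmp⟩ := hex p hp
    have h1 := hB m hm
    rw [hmp] at h1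
    rw [h1.1]
    exact ⟨hm, hmp, h1.2⟩
  have hmid : ∀ p ∈ nbhd D (s - 3 * δ), B p = p + (1 / 2 : ℂ) • X (B p) := fun p hp => by
    have := (hBm p hp).2.1
    rw [neg_smul, ← sub_eq_add_neg, sub_eq_iff_eq_add] at this
    exact this
  have hXB : ∀ p ∈ nbhd D (s - 3 * δ), DifferentiableAt ℂ X (B p) := fun p hp =>
    hXd.differentiableAt (isOpen_nbhd.mem_nhds (hWs (hBm p hp).1))
  have hnear : ∀ p ∈ nbhd D (s - 3 * δ), ‖X (B p)‖ ≤ b / δ := fun p hp =>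
    hX1 _ (hW1 (hBm p hp).1)
  have hΦd : ∀ p ∈ nbhd D (s - 3 * δ), HasFDerivAt (fun p => p + X (B p))
      (ContinuousLinearMap.id ℂ Phase + (fderiv ℂ X (B p)).comp (fderiv ℂ B p)) p := fun p hp =>
    (hasFDerivAt_id p).add ((hXB p hp).hasFDerivAt.comp p (hBm p hp).2.2.hasFDerivAt)
  refine ⟨fun p => p + X (B p), B, ⟨?_, ?_, ?_, ?_, ?_, ?_, ?_⟩, ?_⟩
  · exact fun p hp => (hΦd p hp).differentiableAt.differentiableWithinAt
  · intro p hp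
    have := mem_nbhd_of_norm_sub_le (q := p + X (B p)) hp (r := b / δ) (by simpa using hnear p hp)
    exact nbhd_mono (by linarith) this
  · intro p hp
    simpa using hnear p hp
  · intro p hp u v
    set A := fderiv ℂ X (B p) with hA
    -- differentiating `B p - X (B p) / 2 = p`
    have h1 : ∀ w, fderiv ℂ B p w + (-(1 / 2) : ℂ) • A (fderiv ℂ B p w) = w := by
      intro w
      have h2 : HasFDerivAt (fun p => B p + (-(1 / 2) : ℂ) • X (B p))
          (fderiv ℂ B p + (-(1 / 2) : ℂ) • A.comp (fderiv ℂ B p)) p :=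
        (hBm p hp).2.2.hasFDerivAt.fun_add
          (HasFDerivAt.fun_const_smul (f := fun p => X (B p))
            ((hXB p hp).hasFDerivAt.comp p (hBm p hp).2.2.hasFDerivAt) _)
      have h3 : (fun p => B p + (-(1 / 2) : ℂ) • X (B p)) =ᶠ[𝓝 p] fun p => p := by
        filter_upwards [isOpen_nbhd.mem_nhds hp] with q hq using (hBm q hq).2.1
      have h4 := (h2.congr_of_eventuallyEq h3.symm).unique (hasFDerivAt_id p)
      exact DFunLike.congr_fun h4 w
    rw [(hΦd p hp).fderiv]
    simp only [add_apply, ContinuousLinearMap.coe_id', id,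
      ContinuousLinearMap.comp_apply]
    have h5 := omega_fderiv_hamField hχ (hWs (hBm p hp).1) (fderiv ℂ B p u) (fderiv ℂ B p v)
    rw [← hX, ← hA] at h5
    have h6 : ∀ w, w + A (fderiv ℂ B p w) = fderiv ℂ B p w + (1 / 2 : ℂ) • A (fderiv ℂ B p w) := by
      intro w
      nth_rewrite 1 [← h1 w]
      rw [add_assoc, ← one_smul ℂ (A (fderiv ℂ B p w)), smul_smul, ← add_smul, smul_smul]
      norm_num
    rw [h6, h6]
    conv_rhs => rw [← h1 u, ← h1 v]
    simp only [omega_add_left, omega_add_right, omega_smul_left, omega_smul_right]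
    linear_combination h5
  · intro p hp θ
    have h1 : B (rot θ p) = rot θ (B p) := by
      apply hinj (hBm _ (rot_mem_nbhd hp θ)).1 (rot_mem_nbhd (hBm p hp).1 θ)
      simp only
      rw [(hBm _ (rot_mem_nbhd hp θ)).2.1, hX, hamField_rot hχ hsym (hWs (hBm p hp).1) θ, ← hX]
      conv_lhs => rw [← (hBm p hp).2.1]
      simp only [rot, map_add, map_smul]
      abel
    rw [h1, hX, hamField_rot hχ hsym (hWs (hBm p hp).1) θ, ← hX]
    simp only [rot, map_add]
    abel
  · intro p hp
    have h1 : B (conjP p) = conjP (B p) := by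
      apply hinj (hBm _ (conjP_mem_nbhd hp)).1 (conjP_mem_nbhd (hBm p hp).1)
      simp only
      rw [(hBm _ (conjP_mem_nbhd hp)).2.1, hX, hamField_conjP hχ hsym (hWs (hBm p hp).1), ← hX]
      conv_lhs => rw [← (hBm p hp).2.1]
      rw [conjP_add, conjP_smul]
      simp
    rw [h1, hX, hamField_conjP hχ hsym (hWs (hBm p hp).1), ← hX, conjP_add]
  · intro p hp
    have h1 := fderiv_rotGen (hχ.differentiableAt (isOpen_nbhd.mem_nhds (hWs (hBm p hp).1)))
      (hsym.rot _ (hWs (hBm p hp).1))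
    rw [apply_rotGen] at h1
    have h2 : p = B p + (-(1 / 2) : ℂ) • X (B p) := (hBm p hp).2.1.symm
    have h3 : p + X (B p) = B p + (1 / 2 : ℂ) • X (B p) := by
      calc p + X (B p) = (p + (1 / 2 : ℂ) • X (B p)) + (1 / 2 : ℂ) • X (B p) := by module
        _ = _ := by rw [← hmid p hp]
    rw [h3]
    conv_rhs => rw [h2]
    rw [hX]
    simp only [angMom, hamField, hamVec_apply, Phase.act_def, Phase.ecc_def, Phase.eccT_def,
      Prod.fst_add, Prod.snd_add, Prod.smul_fst, Prod.smul_snd, Pi.add_apply, Pi.smul_apply,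
      smul_eq_mul]
    simp only [Fin.sum_univ_two] at h1
    linear_combination h1
  · intro p hp
    exact ⟨(hBm p hp).1, hnear p hp, hmid p hp, rfl⟩

end

/-! ### The averaging procedure -/

noncomputable section

variable {D s s' : ℝ} {p q : Phase}

/-- `g + R` is, on `nbhd D s`, the sum of a part `g` independent of the fast angle, of gradient at
most `κ`, and of a part `R` of zero average and of size at most `r`. -/
structure IsNormalForm (D s κ r : ℝ) (g R : Phase → ℂ) : Prop where
  diff_g : DifferentiableOn ℂ g (nbhd D s)
  diff_R : DifferentiableOn ℂ R (nbhd D s)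
  sym_g : IsSym g (nbhd D s)
  sym_R : IsSym R (nbhd D s)
  inv_g : ∀ p ∈ nbhd D s, ∀ t : ℝ, g (p + (t : ℂ) • fastDir) = g p
  avg_R : ∀ p ∈ nbhd D s, shiftAvg R p = 0
  fderiv_g_le : ∀ p ∈ nbhd D s, ‖fderiv ℂ g p‖ ≤ κ
  R_le : ∀ p ∈ nbhd D s, ‖R p‖ ≤ r

theorem IsNormalForm.mono {κ r κ' r' : ℝ} {g R : Phase → ℂ} (h : IsNormalForm D s κ r g R)
    (hs : s' ≤ s) (hκ : κ ≤ κ') (hr : r ≤ r') : IsNormalForm D s' κ' r' g R where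
  diff_g := h.diff_g.mono (nbhd_mono hs)
  diff_R := h.diff_R.mono (nbhd_mono hs)
  sym_g := h.sym_g.mono (nbhd_mono hs)
  sym_R := h.sym_R.mono (nbhd_mono hs)
  inv_g p hp := h.inv_g p (nbhd_mono hs hp)
  avg_R p hp := h.avg_R p (nbhd_mono hs hp)
  fderiv_g_le p hp := (h.fderiv_g_le p (nbhd_mono hs hp)).trans hκ
  R_le p hp := (h.R_le p (nbhd_mono hs hp)).trans hr

theorem fastDir_eq : fastDir = ((0, Pi.single 1 1, 0, 0) : Phase) := by
  ext j <;> fin_cases j <;> simp [fastDir]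

theorem isSym_fastAct (υ : ℝ) (W : Set Phase) : IsSym (fun p => υ * p.1 1) W :=
  ⟨fun p _ θ => by simp [rot_apply], fun p _ => by simp [conjP_apply]⟩

/-- One step of the averaging procedure.  The midpoint map of the solution `χ` of the homological
equation cancels `R` at the midpoint `m`: what remains is `R (Φ p) - R (m p) + g (Φ p) - g p`.  Its
average is of second order in `r`, since the bracket of `g` and `χ` has zero average. -/
theorem IsNormalForm.step {υ δ κ r b : ℝ} {g R : Phase → ℂ} (h : IsNormalForm D s κ r g R)
    (hυ : 0 < υ) (hδ : 0 < δ) (hκ : 0 ≤ κ) (hr : 0 ≤ r) (hb : b = 4 * π / υ * r)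
    (hbδ : b ≤ δ ^ 2 / 4) :
    ∃ (Φ : Phase → Phase) (g' R' : Phase → ℂ), IsNearIdentity D (s - 4 * δ) s (b / δ) Φ ∧
      IsNormalForm D (s - 4 * δ) (κ + (r * b / δ ^ 2 + 2 * κ * b ^ 2 / δ ^ 3) / δ)
        (2 * (κ * b / δ + r * b / δ ^ 2)) g' R' ∧
      (∀ p ∈ nbhd D (s - 4 * δ), ‖g' p - g p‖ ≤ r * b / δ ^ 2 + 2 * κ * b ^ 2 / δ ^ 3) ∧
      ∀ p ∈ nbhd D (s - 4 * δ),
        υ * (Φ p).1 1 + g (Φ p) + R (Φ p) = υ * p.1 1 + g' p + R' p := by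
  have hb0 : 0 ≤ b := by rw [hb]; positivity
  obtain ⟨χ, hχd, hχs, hχe, hχa, hχb⟩ := exists_homological hυ h.diff_R h.sym_R h.avg_R h.R_le
  rw [← hb] at hχb
  obtain ⟨Φ, m, hΦ, hm⟩ := exists_midpoint_map hδ hχd hχs hχb hbδ
  have hb1 : b / δ ≤ δ / 4 := by rw [div_le_iff₀ hδ]; nlinarith
  have hVs : nbhd D (s - 3 * δ) ⊆ nbhd D s := nbhd_mono (by linarith)
  have hVs2 : nbhd D (s - 2 * δ) ⊆ nbhd D s := nbhd_mono (by linarith)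
  have hVs1 : nbhd D (s - 2 * δ) ⊆ nbhd D (s - δ) := nbhd_mono (by linarith)
  have hV4 : nbhd D (s - 4 * δ) ⊆ nbhd D (s - 3 * δ) := nbhd_mono (by linarith)
  have hXd := differentiableOn_hamField hχd
  set X := hamField χ with hX
  have hX1 : ∀ p ∈ nbhd D (s - δ), ‖X p‖ ≤ b / δ := fun p hp =>
    (norm_hamVec_le _).trans (norm_fderiv_le_of_nbhd hδ hχd hχb hp)
  have hX2 : ∀ p ∈ nbhd D (s - 2 * δ), ‖fderiv ℂ X p‖ ≤ b / δ ^ 2 := fun p hp => by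
    have := norm_fderiv_le_of_nbhd hδ (hXd.mono (nbhd_mono (sub_le_self s hδ.le))) hX1
      (p := p) (nbhd_mono (by linarith) hp)
    rwa [div_div, ← sq] at this
  set F : Phase → ℂ := fun p => υ * (Φ p).1 1 + g (Φ p) + R (Φ p) - (υ * p.1 1 + g p) with hF
  have hactd : ∀ W, DifferentiableOn ℂ (fun p : Phase => (υ : ℂ) * p.1 1) W := fun W => by
    fun_prop
  have hΦ' : IsNearIdentity D (s - 3 * δ) s (b / δ) Φ := hΦ.mono le_rfl (by linarith) le_rfl
  have hFd : DifferentiableOn ℂ F (nbhd D (s - 3 * δ)) :=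
    ((((hactd univ).comp hΦ.diff (mapsTo_univ _ _)).add (h.diff_g.comp hΦ'.diff hΦ'.maps)).add
      (h.diff_R.comp hΦ'.diff hΦ'.maps)).sub ((hactd _).add (h.diff_g.mono hVs))
  have hFs : IsSym F (nbhd D (s - 3 * δ)) :=
    ((((isSym_fastAct υ _).add h.sym_g).add h.sym_R).comp_nearIdentity hΦ').sub
      ((isSym_fastAct υ _).add (h.sym_g.mono hVs))
  have hFper : ∀ p ∈ nbhd D (s - 3 * δ), F (p + ((2 * π : ℝ) : ℂ) • fastDir) = F p :=
    fun p hp => hFs.periodic hp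
  -- `Φ p - p` is the Hamiltonian vector at the midpoint, where `χ` solves the homological equation
  have hFeq : ∀ p ∈ nbhd D (s - 3 * δ), F p = (R (Φ p) - R (m p)) + (g (Φ p) - g p) := by
    intro p hp
    obtain ⟨hm1, -, -, hm4⟩ := hm p hp
    have h1 : (Φ p).1 1 = p.1 1 + fderiv ℂ χ (m p) fastDir := by
      rw [hm4, fastDir_eq]
      rfl
    have h2 := hχe (m p) (hVs2 hm1)
    simp only [hF]
    rw [h1]
    linear_combination h2
  have hR1 : ∀ p ∈ nbhd D (s - 2 * δ), ‖fderiv ℂ R p‖ ≤ r / δ := fun p hp =>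
    norm_fderiv_le_of_nbhd hδ h.diff_R h.R_le (hVs1 hp)
  have hRdiff : ∀ p ∈ nbhd D (s - 3 * δ), ‖R (Φ p) - R (m p)‖ ≤ r * b / δ ^ 2 := by
    intro p hp
    obtain ⟨hm1, hm2, hm3, hm4⟩ := hm p hp
    have h1 := norm_image_sub_le_of_nbhd (h.diff_R.mono hVs2) hR1 hm1 (hΦ.maps hp)
    have h2 : Φ p - m p = (1 / 2 : ℂ) • X (m p) := by
      rw [hm4]
      nth_rewrite 2 [hm3]
      module
    have h3 : ‖Φ p - m p‖ ≤ b / δ := by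
      rw [h2, norm_smul]
      have h12 : ‖(1 / 2 : ℂ)‖ = 1 / 2 := by norm_num
      rw [h12]
      linarith [norm_nonneg (X (m p))]
    calc _ ≤ _ := h1
      _ ≤ r / δ * (b / δ) := by gcongr
      _ = _ := by ring
  have hgdiff : ∀ p ∈ nbhd D (s - 3 * δ), ‖g (Φ p) - g p‖ ≤ κ * b / δ := by
    intro p hp
    have h1 := norm_image_sub_le_of_nbhd h.diff_g h.fderiv_g_le (hVs hp) (hΦ'.maps hp)
    calc _ ≤ _ := h1
      _ ≤ κ * (b / δ) := by gcongr; exact hΦ.near p hp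
      _ = _ := by ring
  have hFb : ∀ p ∈ nbhd D (s - 3 * δ), ‖F p‖ ≤ κ * b / δ + r * b / δ ^ 2 := by
    intro p hp
    rw [hFeq p hp]
    linarith [norm_add_le (R (Φ p) - R (m p)) (g (Φ p) - g p), hRdiff p hp, hgdiff p hp]
  -- the bracket of `g` and `χ`, which is the first order part of `F`
  set P : Phase → ℂ := fun p => fderiv ℂ g p (X p) with hP
  have hPc : ContinuousOn P (nbhd D (s - 3 * δ)) :=
    ((continuousOn_fderiv_of_differentiableOn isOpen_nbhd h.diff_g).mono hVs).clm_apply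
      (hXd.continuousOn.mono hVs)
  have hQb : ∀ p ∈ nbhd D (s - 3 * δ), ‖F p - P p‖ ≤ r * b / δ ^ 2 + 2 * κ * b ^ 2 / δ ^ 3 := by
    intro p hp
    obtain ⟨hm1, hm2, hm3, hm4⟩ := hm p hp
    have hp2 : p ∈ nbhd D (s - 2 * δ) := nbhd_mono (by linarith) hp
    have hsub : F p - P p = (R (Φ p) - R (m p)) +
        ((g (Φ p) - g p - fderiv ℂ g p (Φ p - p)) + fderiv ℂ g p (X (m p) - X p)) := by
      have : Φ p - p = X (m p) := by rw [hm4]; abel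
      rw [hFeq p hp, this, map_sub]
      ring
    have h1 : ‖X (m p) - X p‖ ≤ b / δ ^ 2 * (b / δ) := by
      have := norm_image_sub_le_of_nbhd (hXd.mono hVs2) hX2 hp2 hm1
      refine this.trans ?_
      gcongr
      nth_rewrite 1 [hm3]
      rw [add_sub_cancel_left, norm_smul]
      have h12 : ‖(1 / 2 : ℂ)‖ = 1 / 2 := by norm_num
      rw [h12]
      linarith [norm_nonneg (X (m p))]
    have h2 : ‖fderiv ℂ g p (X (m p) - X p)‖ ≤ κ * (b / δ ^ 2 * (b / δ)) :=
      ((fderiv ℂ g p).le_of_opNorm_le (h.fderiv_g_le p (hVs hp)) _).trans (by gcongr)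
    have hD2 : ∀ q ∈ nbhd D (s - 2 * δ), ‖fderiv ℂ (fderiv ℂ g) q‖ ≤ κ / δ := fun q hq =>
      norm_fderiv_le_of_nbhd hδ (differentiableOn_fderiv isOpen_nbhd h.diff_g) h.fderiv_g_le
        (hVs1 hq)
    have hseg : segment ℝ p (Φ p) ⊆ nbhd D (s - 2 * δ) :=
      convex_nbhd.segment_subset hp2 (hΦ.maps hp)
    have h3 : ‖g (Φ p) - g p - fderiv ℂ g p (Φ p - p)‖ ≤ κ / δ * (b / δ) * (b / δ) := by
      have := (convex_segment (𝕜 := ℝ) p (Φ p)).norm_image_sub_le_of_norm_hasFDerivWithin_le'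
        (𝕜 := ℂ) (f := g) (f' := fderiv ℂ g) (φ := fderiv ℂ g p) (C := κ / δ * (b / δ))
        (fun q hq => ((h.diff_g.differentiableAt (isOpen_nbhd.mem_nhds
          (hVs2 (hseg hq)))).hasFDerivAt).hasFDerivWithinAt)
        (fun q hq => by
          refine (norm_image_sub_le_of_nbhd ((differentiableOn_fderiv isOpen_nbhd
            h.diff_g).mono hVs2) hD2 hp2 (hseg hq)).trans ?_
          gcongr
          obtain ⟨t, ht, rfl⟩ := (segment_eq_image' ℝ p (Φ p)).subset hq
          rw [add_sub_cancel_left, norm_smul, Real.norm_of_nonneg ht.1]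
          calc t * ‖Φ p - p‖ ≤ 1 * ‖Φ p - p‖ := by gcongr; exact ht.2
            _ ≤ b / δ := by rw [one_mul]; exact hΦ.near p hp)
        (left_mem_segment ℝ _ _) (right_mem_segment ℝ _ _)
      refine this.trans ?_
      gcongr
      exact hΦ.near p hp
    rw [hsub]
    calc _ ≤ r * b / δ ^ 2 + (κ / δ * (b / δ) * (b / δ) + κ * (b / δ ^ 2 * (b / δ))) := by
          refine (norm_add_le _ _).trans (add_le_add (hRdiff p hp) ?_)
          exact (norm_add_le _ _).trans (add_le_add h3 h2)
      _ = _ := by ring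
  have hFavg : ∀ p ∈ nbhd D (s - 3 * δ),
      ‖shiftAvg F p‖ ≤ r * b / δ ^ 2 + 2 * κ * b ^ 2 / δ ^ 3 := by
    intro p hp
    have h1 := norm_shiftAvg_le hQb hp
    rwa [shiftAvg_sub hFd.continuousOn hPc hp, hP, hX,
      shiftAvg_fderiv_hamField hχd h.inv_g hχa (hVs hp), sub_zero] at h1
  have hAd := differentiableOn_shiftAvg hFd
  have hAinv : ∀ p ∈ nbhd D (s - 3 * δ), ∀ t : ℝ,
      shiftAvg F (p + (t : ℂ) • fastDir) = shiftAvg F p := fun p hp t => shiftAvg_add hFper hp t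
  refine ⟨Φ, fun p => g p + shiftAvg F p, fun p => F p - shiftAvg F p,
    hΦ'.mono (by linarith) le_rfl le_rfl, ⟨?_, ?_, ?_, ?_, ?_, ?_, ?_, ?_⟩, ?_, ?_⟩
  · exact (h.diff_g.mono (hV4.trans hVs)).add (hAd.mono hV4)
  · exact (hFd.sub hAd).mono hV4
  · exact (h.sym_g.mono (hV4.trans hVs)).add (hFs.shiftAvg.mono hV4)
  · exact (hFs.sub hFs.shiftAvg).mono hV4
  · intro p hp t
    rw [h.inv_g p (hVs (hV4 hp)), hAinv p (hV4 hp)]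
  · intro p hp
    rw [shiftAvg_sub hFd.continuousOn hAd.continuousOn (hV4 hp),
      shiftAvg_of_invariant (hAinv p (hV4 hp)), sub_self]
  · intro p hp
    have hnh := isOpen_nbhd.mem_nhds (hV4 hp)
    rw [fderiv_fun_add ((h.diff_g.mono hVs).differentiableAt hnh) (hAd.differentiableAt hnh)]
    refine (norm_add_le _ _).trans (add_le_add (h.fderiv_g_le p (hVs (hV4 hp))) ?_)
    exact norm_fderiv_le_of_nbhd hδ hAd hFavg (nbhd_mono (by linarith) hp)
  · intro p hp
    rw [two_mul]
    exact (norm_sub_le _ _).trans (add_le_add (hFb p (hV4 hp)) (norm_shiftAvg_le hFb (hV4 hp)))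
  · intro p hp
    simpa using hFavg p (hV4 hp)
  · intro p _
    simp only [hF]
    ring

/-- Iteration of the averaging step, with the same loss of width `4 δ` at each step.  The remainder
is multiplied by `q ≤ 1 / 2` each time, so that the corrections form geometric series, whose partial
sums are `2 - 2 / 2 ^ n` times the first bound. -/
theorem IsNormalForm.iterate {υ δ κ r c q a : ℝ} {g R : Phase → ℂ}
    (h : IsNormalForm D s κ r g R) (hυ : 0 < υ) (hδ : 0 < δ) (hκ : 0 ≤ κ) (hr : 0 ≤ r)
    (hc : c = 4 * π / υ) (hq0 : 0 ≤ q) (hq : q ≤ 1 / 2) (h1 : c * r ≤ δ ^ 2 / 4)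
    (h2 : 2 * (2 * κ * c / δ + r * c / δ ^ 2) ≤ q)
    (ha : a = r ^ 2 * (c / δ ^ 2 + 4 * κ * c ^ 2 / δ ^ 3)) (h3 : 2 * a / δ ≤ κ) (n : ℕ) :
    ∃ (U : Phase → Phase) (g' R' : Phase → ℂ),
      IsNearIdentity D (s - 4 * n * δ) s ((2 - 2 / 2 ^ n) * (c * r / δ)) U ∧
      IsNormalForm D (s - 4 * n * δ) (κ + (2 - 2 / 2 ^ n) * (a / δ)) (q ^ n * r) g' R' ∧
      (∀ p ∈ nbhd D (s - 4 * n * δ), ‖g' p - g p‖ ≤ (2 - 2 / 2 ^ n) * a) ∧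
      ∀ p ∈ nbhd D (s - 4 * n * δ),
        υ * (U p).1 1 + g (U p) + R (U p) = υ * p.1 1 + g' p + R' p := by
  have hc0 : 0 ≤ c := by rw [hc]; positivity
  have ha0 : 0 ≤ a := by rw [ha]; positivity
  induction n with
  | zero =>
    refine ⟨fun p => p, g, R, ?_, ?_, ?_, ?_⟩
    · simpa using IsNearIdentity.id (D := D) (le_refl s)
    · simpa using h
    · simp
    · simp
  | succ n ih =>
    obtain ⟨U, g₁, R₁, hU, hN, hg, hH⟩ := ih
    set κ₁ := κ + (2 - 2 / 2 ^ n) * (a / δ) with hκ₁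
    have hpow : (2 : ℝ) / 2 ^ n ≤ 2 := div_le_self (by norm_num) (one_le_pow₀ (by norm_num))
    have hpow0 : (0 : ℝ) < 2 / 2 ^ n := by positivity
    have hκ₁0 : 0 ≤ κ₁ := by
      have : 0 ≤ (2 - 2 / 2 ^ n) * (a / δ) := mul_nonneg (by linarith) (by positivity)
      linarith
    have hκ₁2 : κ₁ ≤ 2 * κ := by
      have : (2 - 2 / 2 ^ n) * (a / δ) ≤ 2 * (a / δ) := by gcongr; linarith
      have h4 : 2 * (a / δ) = 2 * a / δ := by ring
      linarith
    have hq1 : q ^ n ≤ (1 / 2) ^ n := by gcongr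
    have hqn0 : 0 ≤ q ^ n := pow_nonneg hq0 n
    have hqn1 : q ^ n ≤ 1 := pow_le_one₀ hq0 (by linarith)
    have hr₁0 : 0 ≤ q ^ n * r := by positivity
    have hr₁ : q ^ n * r ≤ r := mul_le_of_le_one_left hr hqn1
    obtain ⟨Φ, g₂, R₂, hΦ, hN₂, hg₂, hH₂⟩ := hN.step (b := c * (q ^ n * r)) hυ hδ hκ₁0 hr₁0
      (by rw [hc]) ((by gcongr : c * (q ^ n * r) ≤ c * r).trans h1)
    have hs : s - 4 * n * δ - 4 * δ = s - 4 * (n + 1 : ℕ) * δ := by push_cast; ring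
    rw [hs] at hΦ hN₂ hg₂ hH₂
    have hsub : nbhd D (s - 4 * (n + 1 : ℕ) * δ) ⊆ nbhd D (s - 4 * n * δ) :=
      nbhd_mono (by rw [← hs]; linarith)
    have htwo : (2 : ℝ) - 2 / 2 ^ n + (1 / 2) ^ n = 2 - 2 / 2 ^ (n + 1) := by
      rw [pow_succ, div_pow, one_pow]; field_simp; ring
    have hstep : q ^ n * r * (c * (q ^ n * r)) / δ ^ 2 + 2 * κ₁ * (c * (q ^ n * r)) ^ 2 / δ ^ 3
        ≤ (1 / 2) ^ n * a := by
      calc _ = q ^ n * q ^ n * (r ^ 2 * (c / δ ^ 2 + 2 * κ₁ * c ^ 2 / δ ^ 3)) := by ring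
        _ ≤ (1 / 2) ^ n * 1 * (r ^ 2 * (c / δ ^ 2 + 2 * (2 * κ) * c ^ 2 / δ ^ 3)) := by gcongr
        _ = (1 / 2) ^ n * a := by rw [ha]; ring
    refine ⟨fun p => U (Φ p), g₂, R₂, ?_, ?_, ?_, ?_⟩
    · refine (hU.comp hΦ).mono le_rfl le_rfl ?_
      rw [← htwo, add_mul _ _ (c * r / δ)]
      gcongr
      calc c * (q ^ n * r) / δ = q ^ n * (c * r / δ) := by ring
        _ ≤ (1 / 2) ^ n * (c * r / δ) := by gcongr
    · refine hN₂.mono le_rfl ?_ ?_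
      · have h8 := div_le_div_of_nonneg_right hstep hδ.le
        rw [← htwo, add_mul, ← mul_div_assoc ((1 / 2 : ℝ) ^ n) a δ]
        linarith
      · calc _ = 2 * (κ₁ * c / δ + (q ^ n * r) * c / δ ^ 2) * (q ^ n * r) := by ring
          _ ≤ 2 * (2 * κ * c / δ + r * c / δ ^ 2) * (q ^ n * r) := by gcongr
          _ ≤ q * (q ^ n * r) := by gcongr
          _ = _ := by ring
    · intro p hp
      calc ‖g₂ p - g p‖ = ‖(g₁ p - g p) + (g₂ p - g₁ p)‖ := by congr 1; ring
        _ ≤ (2 - 2 / 2 ^ n) * a + (1 / 2) ^ n * a :=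
          (norm_add_le _ _).trans (add_le_add (hg p (hsub hp)) ((hg₂ p hp).trans hstep))
        _ = _ := by rw [← add_mul, htwo]
    · intro p hp
      have h5 := hH (Φ p)
      have h6 : Φ p ∈ nbhd D (s - 4 * n * δ) := hΦ.maps hp
      simp only
      rw [h5 h6, hH₂ p hp]

end

/-! ### Taylor series on polydiscs -/

noncomputable section

open scoped Nat in
/-- Taylor coefficients at the origin of a function of `n` complex variables. -/
def taylorCoeff : (n : ℕ) → ((Fin n → ℂ) → ℂ) → (Fin n → ℕ) → ℂ
  | 0, F, _ => F 0
  | n + 1, F, α => taylorCoeff n (fun z =>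
      ((α 0) ! : ℂ)⁻¹ * iteratedDeriv (α 0) (fun t => F (Fin.cons t z : Fin (n + 1) → ℂ)) 0)
      (Fin.tail α)

theorem cons_mem_ball {n : ℕ} {R : ℝ} (hR : 0 < R) {t : ℂ} {z : Fin n → ℂ} :
    (Fin.cons t z : Fin (n + 1) → ℂ) ∈ ball (0 : Fin (n + 1) → ℂ) R ↔
      t ∈ ball (0 : ℂ) R ∧ z ∈ ball (0 : Fin n → ℂ) R := by
  simp only [mem_ball_zero_iff, pi_norm_lt_iff hR, Fin.forall_fin_succ, Fin.cons_zero,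
    Fin.cons_succ]

theorem hasDerivAt_cons {n : ℕ} (z : Fin n → ℂ) (t : ℂ) :
    HasDerivAt (fun t : ℂ => (Fin.cons t z : Fin (n + 1) → ℂ)) (Pi.single 0 1) t := by
  rw [hasDerivAt_pi]
  intro j
  refine Fin.cases ?_ (fun i => ?_) j
  · simpa using hasDerivAt_id' t
  · simpa using hasDerivAt_const t (z i)

theorem differentiable_cons {n : ℕ} (t : ℂ) :
    Differentiable ℂ (fun z : Fin n → ℂ => (Fin.cons t z : Fin (n + 1) → ℂ)) := by
  rw [differentiable_pi]
  intro j
  refine Fin.cases ?_ (fun i => ?_) j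
  · simp
  · simpa using differentiable_apply i

/-- Iterated derivatives in the first variable are restrictions of iterated directional
derivatives. -/
theorem iteratedDeriv_cons {n : ℕ} {R : ℝ} (hR : 0 < R) (k : ℕ) :
    ∀ F : (Fin (n + 1) → ℂ) → ℂ, DifferentiableOn ℂ F (ball 0 R) →
      ∃ G : (Fin (n + 1) → ℂ) → ℂ, DifferentiableOn ℂ G (ball 0 R) ∧
        ∀ z ∈ ball (0 : Fin n → ℂ) R, ∀ t ∈ ball (0 : ℂ) R,
          iteratedDeriv k (fun t => F (Fin.cons t z : Fin (n + 1) → ℂ)) t = G (Fin.cons t z) := by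
  induction k with
  | zero => exact fun F hF => ⟨F, hF, fun z _ t _ => by simp⟩
  | succ k ih =>
    intro F hF
    obtain ⟨G, hG, hFG⟩ := ih F hF
    refine ⟨fun w => fderiv ℂ G w (Pi.single 0 1),
      differentiableOn_fderiv_apply isOpen_ball hG _, fun z hz t ht => ?_⟩
    have h1 : iteratedDeriv k (fun t => F (Fin.cons t z : Fin (n + 1) → ℂ)) =ᶠ[𝓝 t]
        fun t => G (Fin.cons t z) := by
      filter_upwards [isOpen_ball.mem_nhds ht] with t' ht' using hFG z hz t' ht'
    rw [iteratedDeriv_succ, h1.deriv_eq]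
    exact ((hG.differentiableAt (isOpen_ball.mem_nhds ((cons_mem_ball hR).2 ⟨ht, hz⟩))
      ).hasFDerivAt.comp_hasDerivAt t (hasDerivAt_cons z t)).deriv

theorem summable_prod_pow {n : ℕ} {x : Fin n → ℝ} (h0 : ∀ i, 0 ≤ x i) (h1 : ∀ i, x i < 1) :
    Summable fun α : Fin n → ℕ => ∏ i, x i ^ α i := by
  induction n with
  | zero => exact summable_of_hasFiniteSupport (toFinite _)
  | succ n ih =>
    rw [← (Fin.consEquiv fun _ : Fin (n + 1) => ℕ).summable_iff]
    have h2 := (summable_geometric_of_lt_one (h0 0) (h1 0)).mul_of_nonneg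
      (ih (x := Fin.tail x) (fun i => h0 i.succ) fun i => h1 i.succ)
      (fun k => pow_nonneg (h0 0) k)
      (fun α => Finset.prod_nonneg fun i _ => pow_nonneg (h0 i.succ) _)
    refine h2.congr fun β => ?_
    simp [Fin.consEquiv, Fin.prod_univ_succ, Fin.tail]

/-- Cauchy's estimate for the Taylor coefficients, one variable at a time. -/
theorem norm_taylorCoeff_le {n : ℕ} {R : ℝ} (hR : 0 < R) :
    ∀ (F : (Fin n → ℂ) → ℂ) (M : ℝ), DifferentiableOn ℂ F (ball 0 R) →
      (∀ z ∈ ball 0 R, ‖F z‖ ≤ M) → ∀ r, 0 < r → r < R → ∀ α,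
      ‖taylorCoeff n F α‖ ≤ M / r ^ ∑ i, α i := by
  induction n with
  | zero =>
    intro F M _ hM r _ _ α
    simpa [taylorCoeff] using hM 0 (by simpa using hR)
  | succ n ih =>
    intro F M hF hM r hr hrR α
    have hsl : ∀ z ∈ ball (0 : Fin n → ℂ) R,
        ‖((α 0).factorial : ℂ)⁻¹ *
          iteratedDeriv (α 0) (fun t => F (Fin.cons t z : Fin (n + 1) → ℂ)) 0‖ ≤ M / r ^ α 0 := by
      intro z hz
      have h1 : DiffContOnCl ℂ (fun t => F (Fin.cons t z : Fin (n + 1) → ℂ)) (ball 0 r) := by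
        refine DifferentiableOn.diffContOnCl ?_
        rw [closure_ball _ hr.ne']
        intro t ht
        exact ((hF.differentiableAt (isOpen_ball.mem_nhds ((cons_mem_ball hR).2
          ⟨closedBall_subset_ball hrR ht, hz⟩))).comp t
          (hasDerivAt_cons z t).differentiableAt).differentiableWithinAt
      have h2 := Complex.norm_iteratedDeriv_le_of_forall_mem_sphere_norm_le (α 0) hr h1
        (C := M) fun t ht => hM _ ((cons_mem_ball hR).2
          ⟨closedBall_subset_ball hrR (sphere_subset_closedBall ht), hz⟩)
      rw [norm_mul, norm_inv, Complex.norm_natCast]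
      have h3 : (0 : ℝ) < (α 0).factorial := by positivity
      calc _ ≤ ((α 0).factorial : ℝ)⁻¹ * ((α 0).factorial * M / r ^ α 0) := by gcongr
        _ = _ := by field_simp
    obtain ⟨G, hG, hFG⟩ := iteratedDeriv_cons hR (α 0) F hF
    have hd : DifferentiableOn ℂ (fun z => ((α 0).factorial : ℂ)⁻¹ *
        iteratedDeriv (α 0) (fun t => F (Fin.cons t z : Fin (n + 1) → ℂ)) 0) (ball 0 R) := by
      have h0 : (0 : ℂ) ∈ ball (0 : ℂ) R := mem_ball_self hR
      refine DifferentiableOn.congr (f := fun z => ((α 0).factorial : ℂ)⁻¹ *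
        G (Fin.cons 0 z)) ?_ fun z hz => by rw [hFG z hz 0 h0]
      exact (hG.comp (differentiable_cons 0).differentiableOn
        fun z hz => (cons_mem_ball hR).2 ⟨h0, hz⟩).const_mul _
    have := ih _ _ hd hsl r hr hrR (Fin.tail α)
    rw [taylorCoeff, Fin.sum_univ_succ, pow_add]
    calc _ ≤ _ := this
      _ = _ := by rw [div_div]; rfl

/-- The Taylor series of a bounded holomorphic function on a polydisc converges to it. -/
theorem hasSum_taylorCoeff {n : ℕ} {R : ℝ} (hR : 0 < R) :
    ∀ (F : (Fin n → ℂ) → ℂ) (M : ℝ), DifferentiableOn ℂ F (ball 0 R) →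
      (∀ z ∈ ball 0 R, ‖F z‖ ≤ M) → ∀ z ∈ ball (0 : Fin n → ℂ) R,
      HasSum (fun α => taylorCoeff n F α * ∏ i, z i ^ α i) (F z) := by
  induction n with
  | zero =>
    intro F M _ _ z _
    rw [Subsingleton.elim z 0]
    simp [taylorCoeff]
  | succ n ih =>
    intro F M hF hM z hz
    have hM0 : 0 ≤ M := (norm_nonneg _).trans (hM z hz)
    have hz' : (Fin.cons (z 0) (Fin.tail z) : Fin (n + 1) → ℂ) ∈ ball (0 : Fin (n + 1) → ℂ) R := by
      rwa [Fin.cons_self_tail]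
    obtain ⟨hz0, hzt⟩ := (cons_mem_ball hR).1 hz'
    -- the double series is absolutely convergent by the Cauchy estimates
    obtain ⟨r, hzr, hrR⟩ := exists_between (mem_ball_zero_iff.1 hz)
    have hr : 0 < r := (norm_nonneg z).trans_lt hzr
    have hsum : Summable (fun α => taylorCoeff (n + 1) F α * ∏ i, z i ^ α i) := by
      refine Summable.of_norm_bounded (g := fun α => M * ∏ i, (‖z i‖ / r) ^ α i)
        ((summable_prod_pow (fun i => by positivity) fun i => by
          rw [div_lt_one hr]; exact (norm_le_pi_norm z i).trans_lt hzr).mul_left M) fun α => ?_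
      rw [norm_mul, norm_prod]
      calc _ ≤ M / r ^ (∑ i, α i) * ∏ i, ‖z i ^ α i‖ := by
            gcongr
            exact norm_taylorCoeff_le hR F M hF hM r hr hrR α
        _ = _ := by
          simp only [norm_pow, div_pow, Finset.prod_div_distrib, Finset.prod_pow_eq_pow_sum]
          ring
    set a : ℕ → (Fin n → ℂ) → ℂ := fun k z => (k.factorial : ℂ)⁻¹ *
      iteratedDeriv k (fun t => F (Fin.cons t z : Fin (n + 1) → ℂ)) 0 with ha
    have hfib : ∀ k, HasSum (fun β : Fin n → ℕ => taylorCoeff (n + 1) F (Fin.cons k β) *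
        ∏ i, z i ^ (Fin.cons k β : Fin (n + 1) → ℕ) i) (a k (Fin.tail z) * z 0 ^ k) := by
      intro k
      have had : DifferentiableOn ℂ (a k) (ball 0 R) := by
        obtain ⟨G, hG, hFG⟩ := iteratedDeriv_cons hR k F hF
        have h0 : (0 : ℂ) ∈ ball (0 : ℂ) R := mem_ball_self hR
        refine DifferentiableOn.congr (f := fun z => (k.factorial : ℂ)⁻¹ *
          G (Fin.cons 0 z)) ?_ fun z hz => by rw [ha]; simp only; rw [hFG z hz 0 h0]
        exact (hG.comp (differentiable_cons 0).differentiableOn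
          fun z hz => (cons_mem_ball hR).2 ⟨h0, hz⟩).const_mul _
      have hab : ∀ w ∈ ball (0 : Fin n → ℂ) R, ‖a k w‖ ≤ M / r ^ k := by
        intro w hw
        have h1 := norm_taylorCoeff_le (n := 1) hR
          (fun v => F (Fin.cons (v 0) w : Fin (n + 1) → ℂ)) M ?_ ?_ r hr hrR (fun _ => k)
        · simpa [taylorCoeff, ha] using h1
        · intro v hv
          have hv0 : v 0 ∈ ball (0 : ℂ) R := by
            rw [mem_ball_zero_iff] at hv ⊢
            exact (norm_le_pi_norm v 0).trans_lt hv
          refine DifferentiableAt.differentiableWithinAt ?_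
          have h2 : DifferentiableAt ℂ (fun t => F (Fin.cons t w : Fin (n + 1) → ℂ)) (v 0) :=
            (hF.differentiableAt (isOpen_ball.mem_nhds ((cons_mem_ball hR).2
              ⟨hv0, hw⟩))).comp (v 0) (hasDerivAt_cons w (v 0)).differentiableAt
          exact DifferentiableAt.comp (f := fun v : Fin 1 → ℂ => v 0) v h2
            (differentiableAt_apply (0 : Fin 1) v)
        · intro v hv
          refine hM _ ((cons_mem_ball hR).2 ⟨?_, hw⟩)
          rw [mem_ball_zero_iff] at hv ⊢
          exact (norm_le_pi_norm v 0).trans_lt hv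
      have h2 := (ih (a k) _ had hab (Fin.tail z) hzt).mul_right (z 0 ^ k)
      refine h2.congr_fun ?_
      intro β
      simp only [taylorCoeff, Fin.prod_univ_succ, Fin.cons_zero, Fin.cons_succ, Fin.tail_cons,
        Fin.tail, ha]
      ring
    have hout : HasSum (fun k => a k (Fin.tail z) * z 0 ^ k) (F z) := by
      have h1 : DifferentiableOn ℂ (fun t => F (Fin.cons t (Fin.tail z) : Fin (n + 1) → ℂ))
          (ball 0 R) := fun t ht =>
        ((hF.differentiableAt (isOpen_ball.mem_nhds ((cons_mem_ball hR).2 ⟨ht, hzt⟩))).comp t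
          (hasDerivAt_cons _ t).differentiableAt).differentiableWithinAt
      have h2 := Complex.hasSum_taylorSeries_on_ball h1 hz0
      rw [Fin.cons_self_tail] at h2
      refine h2.congr_fun fun k => ?_
      simp only [ha, sub_zero, smul_eq_mul]
      ring
    have hS := hsum.hasSum
    rw [← (Fin.consEquiv fun _ : Fin (n + 1) => ℕ).hasSum_iff] at hS
    have h3 := hS.prod_fiberwise (g := fun k => a k (Fin.tail z) * z 0 ^ k) fun k => hfib k
    rw [h3.unique hout] at hS
    rw [← (Fin.consEquiv fun _ : Fin (n + 1) => ℕ).hasSum_iff]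
    exact hS

theorem taylorCoeff_congr {n : ℕ} : ∀ {F G : (Fin n → ℂ) → ℂ}, F =ᶠ[𝓝 0] G → ∀ α,
    taylorCoeff n F α = taylorCoeff n G α := by
  induction n with
  | zero => exact fun h _ => h.eq_of_nhds
  | succ n ih =>
    intro F G h α
    refine ih ?_ _
    obtain ⟨r, hr, hrs⟩ := Metric.eventually_nhds_iff_ball.1 h
    filter_upwards [ball_mem_nhds (0 : Fin n → ℂ) hr] with z hz
    congr 1
    refine Filter.EventuallyEq.iteratedDeriv_eq _ ?_
    filter_upwards [ball_mem_nhds (0 : ℂ) hr] with t ht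
    exact hrs _ ((cons_mem_ball hr).2 ⟨ht, hz⟩)

theorem iteratedDeriv_comp_mul_left (k : ℕ) (h : ℂ → ℂ) (c : ℂ) :
    iteratedDeriv k (fun t => h (c * t)) = fun t => c ^ k * iteratedDeriv k h (c * t) := by
  induction k with
  | zero => simp
  | succ k ih =>
    ext t
    rw [iteratedDeriv_succ, ih, iteratedDeriv_succ, deriv_const_mul_field, deriv_comp_mul_left]
    simp [pow_succ, mul_assoc]

theorem taylorCoeff_scale {n : ℕ} : ∀ (F : (Fin n → ℂ) → ℂ) (c : Fin n → ℂ) (α : Fin n → ℕ),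
    taylorCoeff n (fun z => F (fun i => c i * z i)) α = (∏ i, c i ^ α i) * taylorCoeff n F α := by
  induction n with
  | zero =>
    intro F c α
    simp only [taylorCoeff, Finset.univ_eq_empty, Finset.prod_empty, one_mul]
    congr 1
    exact Subsingleton.elim _ _
  | succ n ih =>
    intro F c α
    have hconst : ∀ (n : ℕ) (b : ℂ) (G : (Fin n → ℂ) → ℂ) (β : Fin n → ℕ),
        taylorCoeff n (fun z => b * G z) β = b * taylorCoeff n G β := by
      intro n
      induction n with
      | zero => exact fun b G β => rfl
      | succ n ih' =>
        intro b G β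
        simp only [taylorCoeff]
        rw [← ih']
        congr 1
        ext z
        rw [iteratedDeriv_const_mul_field]
        ring
    have h1 : ∀ (t : ℂ) (z : Fin n → ℂ),
        (fun i => c i * (Fin.cons t z : Fin (n + 1) → ℂ) i) =
          (Fin.cons (c 0 * t) (fun i => Fin.tail c i * z i) : Fin (n + 1) → ℂ) := by
      intro t z
      ext i
      refine Fin.cases ?_ (fun j => ?_) i <;> simp [Fin.tail]
    have h2 : (fun z : Fin n → ℂ => ((α 0).factorial : ℂ)⁻¹ * iteratedDeriv (α 0)
        (fun t => F (fun i => c i * (Fin.cons t z : Fin (n + 1) → ℂ) i)) 0) =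
        fun z => c 0 ^ α 0 * (fun w => ((α 0).factorial : ℂ)⁻¹ * iteratedDeriv (α 0)
          (fun t => F (Fin.cons t w : Fin (n + 1) → ℂ)) 0) (fun i => Fin.tail c i * z i) := by
      ext z
      simp only [h1]
      rw [iteratedDeriv_comp_mul_left (α 0)
        (fun t => F (Fin.cons t (fun i => Fin.tail c i * z i) : Fin (n + 1) → ℂ))]
      simp only [mul_zero]
      ring
    rw [taylorCoeff, h2, hconst, ih (fun w => ((α 0).factorial : ℂ)⁻¹ * iteratedDeriv (α 0)
      (fun t => F (Fin.cons t w : Fin (n + 1) → ℂ)) 0) (Fin.tail c) (Fin.tail α),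
      taylorCoeff, Fin.prod_univ_succ]
    simp only [Fin.tail]
    ring

end

/-! ### The D'Alembert rule is rotation invariance -/

noncomputable section

variable {D ρ σ : ℝ}

theorem rot_mem_domain {p : Phase} (hp : p ∈ domain D ρ σ) (θ : ℝ) : rot θ p ∈ domain D ρ σ := by
  obtain ⟨h1, ⟨t, ht, h2⟩, h3, h4⟩ := hp
  have h5 : ‖Complex.exp (-(θ * Complex.I))‖ = 1 := by
    have := Complex.norm_exp_ofReal_mul_I (-θ)
    simpa using this
  simp only [Phase.act_def, Phase.ang_def, Phase.ecc_def, Phase.eccT_def] at *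
  rw [rot_apply]
  refine ⟨h1, ⟨t + ![0, θ], by simpa using ht, fun j => ?_⟩, fun j => ?_, fun j => ?_⟩
  · fin_cases j
    · simpa [-Matrix.cons_val', Matrix.vecHead] using h2 0
    · simpa [Matrix.vecHead, Matrix.vecTail] using h2 1
  · simpa [norm_smul] using h3 j
  · simpa [norm_smul, h5] using h4 j

/-- Each term of the expansion is rotation invariant: by the relation between the indices, the phases
of its factors cancel. -/
theorem rot_of_dAlembert {f : Phase → ℂ} {K : Set Phase} (hf : DAlembert f K) {p : Phase} {θ : ℝ}
    (hp : p ∈ K) (hq : rot θ p ∈ K) : f (rot θ p) = f p := by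
  obtain ⟨c, hc, hs⟩ := hf
  have h1 := hs p hp
  have h2 := hs _ hq
  refine h2.unique ?_
  convert h1 using 2 with n
  by_cases hn : n.1 + (n.2.1 0 : ℤ) + (n.2.1 1 : ℤ) - (n.2.2 0 : ℤ) - (n.2.2 1 : ℤ) = 0
  · rw [rot_apply]
    simp only [Phase.act_def, Phase.ang_def, Phase.ecc_def, Phase.eccT_def, Pi.add_apply,
      Matrix.cons_val_zero, Matrix.cons_val_one, add_zero, Fin.prod_univ_two, Pi.smul_apply,
      smul_eq_mul, mul_pow, ← Complex.exp_nat_mul]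
    have h3 : Complex.exp (Complex.I * n.1 * (p.2.1 1 + θ)) =
        Complex.exp (Complex.I * n.1 * p.2.1 1) * Complex.exp (Complex.I * n.1 * θ) := by
      rw [← Complex.exp_add]; congr 1; ring
    have h4 : Complex.exp (n.2.1 0 * (θ * Complex.I)) * Complex.exp (n.2.1 1 * (θ * Complex.I)) *
        (Complex.exp (n.2.2 0 * -(θ * Complex.I)) * Complex.exp (n.2.2 1 * -(θ * Complex.I))) *
        Complex.exp (Complex.I * n.1 * θ) = 1 := by
      rw [← Complex.exp_add, ← Complex.exp_add, ← Complex.exp_add, ← Complex.exp_add]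
      have hn' : (n.1 + n.2.1 0 + n.2.1 1 - n.2.2 0 - n.2.2 1 : ℂ) = 0 := by exact_mod_cast hn
      rw [← Complex.exp_zero]
      congr 1
      linear_combination (θ * Complex.I) * hn'
    rw [h3]
    linear_combination (c n p.1 (p.2.1 0) * (p.2.2.1 0 ^ n.2.1 0 * p.2.2.1 1 ^ n.2.1 1) *
      (p.2.2.2 0 ^ n.2.2 0 * p.2.2.2 1 ^ n.2.2 1) * Complex.exp (Complex.I * n.1 * p.2.1 1)) * h4
  · simp [hc n hn]

/-- The phase point with the given actions, angles `s`, `t`, and eccentricity variables `z`. -/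
def slicePoint (Z : Fin 2 → ℂ) (s t : ℂ) (z : Fin (2 + 2) → ℂ) : Phase :=
  (Z, ![s, t], fun j => z (Fin.castAdd 2 j), fun j => z (Fin.natAdd 2 j))

theorem differentiable_slicePoint (Z : Fin 2 → ℂ) (s t : ℂ) :
    Differentiable ℂ (slicePoint Z s t) := by
  unfold slicePoint
  fun_prop

/-- The factors by which the complex rotation of angle `t` multiplies the eccentricity variables. -/
def eccRot (t : ℂ) : Fin (2 + 2) → ℂ :=
  Fin.append (fun _ : Fin 2 => Complex.exp (t * Complex.I))
    (fun _ : Fin 2 => Complex.exp (-(t * Complex.I)))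

theorem rot_slicePoint (θ : ℝ) (Z : Fin 2 → ℂ) (s t : ℂ) (y : Fin (2 + 2) → ℂ) :
    rot θ (slicePoint Z s t fun i => eccRot t i * y i) =
      slicePoint Z s (t + θ) fun i => eccRot (t + θ) i * y i := by
  rw [rot_apply]
  have h1 : Complex.exp ((t + θ) * Complex.I) =
      Complex.exp (θ * Complex.I) * Complex.exp (t * Complex.I) := by
    rw [← Complex.exp_add]; congr 1; ring
  have h2 : Complex.exp (-((t + θ) * Complex.I)) =
      Complex.exp (-(θ * Complex.I)) * Complex.exp (-(t * Complex.I)) := by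
    rw [← Complex.exp_add]; congr 1; ring
  ext j
  · rfl
  · fin_cases j <;> simp [slicePoint]
  · simp [slicePoint, eccRot, h1, mul_assoc]
  · simp [slicePoint, eccRot, h2, mul_assoc, -Fin.natAdd_eq_addNat]

theorem slicePoint_mem_domain {p : Phase} (hp : p ∈ domain D ρ σ) {t : ℂ} (ht : |t.im| ≤ σ)
    {z : Fin (2 + 2) → ℂ} (hz : ‖z‖ ≤ √(ρ * σ)) :
    slicePoint p.act (p.ang 0) t z ∈ domain D ρ σ := by
  obtain ⟨h1, ⟨τ, hτ, h2⟩, h3, h4⟩ := hp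
  refine ⟨h1, ⟨![τ 0, t.re], hτ, fun j => ?_⟩, fun j => (norm_le_pi_norm z _).trans hz,
    fun j => (norm_le_pi_norm z _).trans hz⟩
  fin_cases j
  · simpa [slicePoint] using h2 0
  · have h5 : t - (t.re : ℂ) = t.im * Complex.I := by
      apply Complex.ext <;> simp
    simpa [slicePoint, h5] using ht

theorem abs_im_ang_le {p : Phase} (hp : p ∈ domain D ρ σ) : |(p.ang 1).im| ≤ σ := by
  obtain ⟨-, ⟨τ, -, h2⟩, -, -⟩ := hp
  have h3 := (Complex.abs_im_le_norm _).trans (h2 1)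
  simpa using h3

/-- Invariance under the real rotations implies invariance under the complex ones which stay in the
domain, as long as the eccentricity variables are small: the function of the complex rotation angle
has zero derivative in real directions, hence zero derivative. -/
theorem eccRot_slice_eq {f : Phase → ℂ} (hρ : 0 < ρ * σ) (hσ : 0 < σ)
    (hf : AnalyticOnNhd ℂ f (domain D ρ σ))
    (hrot : ∀ p ∈ domain D ρ σ, ∀ θ : ℝ, f (rot θ p) = f p) {p : Phase} (hp : p ∈ domain D ρ σ)
    {y : Fin (2 + 2) → ℂ} (hy : ‖y‖ ≤ √(ρ * σ) / Real.exp σ) {w : ℂ} (hw : |w.im| ≤ σ) :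
    f (slicePoint p.act (p.ang 0) w fun i => eccRot w i * y i) =
      f (slicePoint p.act (p.ang 0) 0 y) := by
  set P : ℂ → Phase := fun t => slicePoint p.act (p.ang 0) t fun i => eccRot t i * y i with hP
  have hPd : Differentiable ℂ P := by
    have h1 : ∀ i, Differentiable ℂ fun t => eccRot t i := by
      intro i
      refine Fin.addCases (fun j => ?_) (fun j => ?_) i
      · simp only [eccRot, Fin.append_left]; fun_prop
      · simp only [eccRot, Fin.append_right]; fun_prop
    have h2 : Differentiable ℂ fun t : ℂ => (![p.ang 0, t] : Fin 2 → ℂ) := by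
      rw [differentiable_pi]
      intro i
      fin_cases i
      · simp
      · simp
    exact (differentiable_const _).prodMk (h2.prodMk
      ((differentiable_pi.2 fun j => (h1 _).mul_const _).prodMk
        (differentiable_pi.2 fun j => (h1 _).mul_const _)))
  have hPK : ∀ t : ℂ, |t.im| ≤ σ → P t ∈ domain D ρ σ := by
    intro t ht
    refine slicePoint_mem_domain hp ht ?_
    rw [pi_norm_le_iff_of_nonneg (Real.sqrt_nonneg _)]
    intro i
    have h1 : ‖eccRot t i‖ ≤ Real.exp σ := by
      refine Fin.addCases (fun j => ?_) (fun j => ?_) i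
      · simp only [eccRot, Fin.append_left, Complex.norm_exp]
        refine Real.exp_le_exp.2 ?_
        simp only [Complex.mul_re, Complex.I_re, Complex.I_im]
        linarith [(abs_le.1 ht).1]
      · simp only [eccRot, Fin.append_right, Complex.norm_exp]
        refine Real.exp_le_exp.2 ?_
        simp only [Complex.neg_re, Complex.mul_re, Complex.I_re, Complex.I_im]
        linarith [(abs_le.1 ht).2]
    rw [norm_mul]
    calc _ ≤ Real.exp σ * (√(ρ * σ) / Real.exp σ) := by
          gcongr
          exact (norm_le_pi_norm y i).trans hy
      _ = _ := by field_simp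
  have hder : ∀ t ∈ {t : ℂ | |t.im| ≤ σ},
      HasDerivWithinAt (fun t => f (P t)) 0 {t : ℂ | |t.im| ≤ σ} t := by
    intro t ht
    have h1 : HasDerivAt (fun t => f (P t)) (deriv (fun t => f (P t)) t) t :=
      ((hf _ (hPK t ht)).differentiableAt.comp t (hPd t)).hasDerivAt
    have h2 : HasDerivAt (fun θ : ℝ => f (P (t + θ))) (deriv (fun t => f (P t)) t) 0 := by
      have h3 : HasDerivAt (fun x : ℂ => f (P (t + x))) (deriv (fun t => f (P t)) t)
          ((0 : ℝ) : ℂ) := by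
        refine HasDerivAt.comp_const_add (f := fun t => f (P t)) t _ ?_
        simpa using h1
      exact h3.comp_ofReal
    have h4 : (fun θ : ℝ => f (P (t + θ))) = fun _ => f (P t) := by
      ext θ
      rw [← hrot _ (hPK t ht) θ, hP]
      simp only [rot_slicePoint]
    rw [h4] at h2
    rw [h2.unique (hasDerivAt_const _ _)] at h1
    exact h1.hasDerivWithinAt
  have hconv : Convex ℝ {t : ℂ | |t.im| ≤ σ} := by
    have : {t : ℂ | |t.im| ≤ σ} = Complex.imLm ⁻¹' Icc (-σ) σ := by
      ext t; simp [abs_le]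
    rw [this]
    exact (convex_Icc _ _).linear_preimage _
  have h5 := hconv.norm_image_sub_le_of_norm_hasDerivWithin_le (C := 0) hder (by simp)
    (show (0 : ℂ) ∈ _ by simpa using hσ.le) (show w ∈ _ from hw)
  rw [zero_mul, norm_le_zero_iff, sub_eq_zero] at h5
  rw [hP] at h5
  simp only at h5
  rw [h5]
  congr 2
  ext i
  refine Fin.addCases (fun j => ?_) (fun j => ?_) i <;> simp [eccRot, -Fin.natAdd_eq_addNat]

/-- A rotation invariant holomorphic function satisfies the D'Alembert rule: its Taylor coefficients
in the eccentricity variables are pure exponentials of the fast angle. -/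
theorem dAlembert_of_rot {f : Phase → ℂ} (hρ : 0 < ρ * σ) (hσ : 0 < σ)
    (hf : AnalyticOnNhd ℂ f (domain D ρ σ))
    (hrot : ∀ p ∈ domain D ρ σ, ∀ θ : ℝ, f (rot θ p) = f p) : DAlembert f (domain D ρ σ) := by
  classical
  set c : ℤ × (Fin 2 → ℕ) × (Fin 2 → ℕ) → (Fin 2 → ℂ) → ℂ → ℂ := fun n Z s =>
    if n.1 + (n.2.1 0 : ℤ) + (n.2.1 1 : ℤ) - (n.2.2 0 : ℤ) - (n.2.2 1 : ℤ) = 0 then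
      taylorCoeff (2 + 2) (fun z => f (slicePoint Z s 0 z)) (Fin.append n.2.1 n.2.2) else 0 with hc
  refine ⟨c, fun n hn Z s => by simp only [hc, if_neg hn], fun p hp => ?_⟩
  have hR : 0 < √(ρ * σ) := Real.sqrt_pos.2 hρ
  have hw := abs_im_ang_le hp
  set w := p.ang 1 with hwdef
  set F : (Fin (2 + 2) → ℂ) → ℂ := fun z => f (slicePoint p.act (p.ang 0) w z) with hF
  -- the slice of `f` through `p` is holomorphic on a larger polydisc
  obtain ⟨R, hRR, M, hFd, hFM⟩ : ∃ R, √(ρ * σ) < R ∧ ∃ M, DifferentiableOn ℂ F (ball 0 R) ∧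
      ∀ z ∈ ball 0 R, ‖F z‖ ≤ M := by
    have hopen : IsOpen {z | AnalyticAt ℂ f (slicePoint p.act (p.ang 0) w z)} :=
      (isOpen_analyticAt ℂ f).preimage (differentiable_slicePoint _ _ _).continuous
    have hsub : closedBall 0 √(ρ * σ) ⊆
        {z | AnalyticAt ℂ f (slicePoint p.act (p.ang 0) w z)} := fun z hz =>
      hf _ (slicePoint_mem_domain hp hw (mem_closedBall_zero_iff.1 hz))
    obtain ⟨δ, hδ, hδs⟩ := (isCompact_closedBall _ _).exists_cthickening_subset_open hopen hsub
    rw [cthickening_closedBall hδ.le hR.le] at hδs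
    have hd : ∀ z ∈ closedBall (0 : Fin (2 + 2) → ℂ) (δ + √(ρ * σ)), DifferentiableAt ℂ F z :=
      fun z hz => (hδs hz).differentiableAt.comp z (differentiable_slicePoint _ _ _ z)
    obtain ⟨M, hM⟩ := (isCompact_closedBall (0 : Fin (2 + 2) → ℂ)
      (δ + √(ρ * σ))).exists_bound_of_continuousOn
        fun z hz => (hd z hz).continuousAt.continuousWithinAt
    exact ⟨δ + √(ρ * σ), by linarith, M, fun z hz =>
      (hd z (ball_subset_closedBall hz)).differentiableWithinAt,
      fun z hz => hM z (ball_subset_closedBall hz)⟩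
  have hRpos := hR.trans hRR
  have hz : Fin.append p.ecc p.eccT ∈ ball (0 : Fin (2 + 2) → ℂ) R := by
    rw [mem_ball_zero_iff, pi_norm_lt_iff hRpos]
    intro i
    refine Fin.addCases (fun j => ?_) (fun j => ?_) i
    · rw [Fin.append_left]; exact (hp.2.2.1 j).trans_lt hRR
    · rw [Fin.append_right]; exact (hp.2.2.2 j).trans_lt hRR
  have hsum := hasSum_taylorCoeff hRpos F M hFd hFM _ hz
  have hFp : F (Fin.append p.ecc p.eccT) = f p := by
    simp only [hF]
    congr 1
    ext j
    · rfl
    · fin_cases j <;> simp [slicePoint, hwdef]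
    · simp [slicePoint]
    · simp [slicePoint, -Fin.natAdd_eq_addNat]
  rw [hFp] at hsum
  -- the coefficients at the fast angle `w` are those at the fast angle `0`, up to exponentials
  have hcoef : ∀ α, (∏ i, eccRot w i ^ α i) * taylorCoeff (2 + 2) F α =
      taylorCoeff (2 + 2) (fun z => f (slicePoint p.act (p.ang 0) 0 z)) α := by
    intro α
    rw [← taylorCoeff_scale]
    refine taylorCoeff_congr ?_ α
    filter_upwards [closedBall_mem_nhds (0 : Fin (2 + 2) → ℂ)
      (div_pos hR (Real.exp_pos σ))] with y hy
    exact eccRot_slice_eq hρ hσ hf hrot hp (mem_closedBall_zero_iff.1 hy) hw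
  -- the only index of the expansion with the exponents `α`
  set ι : (Fin (2 + 2) → ℕ) → ℤ × (Fin 2 → ℕ) × (Fin 2 → ℕ) := fun α =>
    ((α 2 : ℤ) + α 3 - α 0 - α 1, fun j => α (Fin.castAdd 2 j), fun j => α (Fin.natAdd 2 j))
    with hι
  have happ : ∀ α : Fin (2 + 2) → ℕ, Fin.append (fun j : Fin 2 => α (Fin.castAdd 2 j))
      (fun j : Fin 2 => α (Fin.natAdd 2 j)) = α := by
    intro α
    ext i
    refine Fin.addCases (fun j => ?_) (fun j => ?_) i <;> simp [-Fin.natAdd_eq_addNat]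
  have hinj : Function.Injective ι := by
    intro α β h
    simp only [hι, Prod.mk.injEq] at h
    rw [← happ α, ← happ β, h.2.1, h.2.2]
  rw [← hinj.hasSum_iff]
  · convert hsum using 2 with α
    have h1 : c (ι α) p.act (p.ang 0) = (∏ i, eccRot w i ^ α i) * taylorCoeff (2 + 2) F α := by
      rw [hcoef]
      simp only [hc, hι, happ]
      rw [if_pos]
      change (α 2 : ℤ) + α 3 - α 0 - α 1 + α 0 + α 1 - α 2 - α 3 = 0
      ring
    have h2 : (∏ i, eccRot w i ^ α i) * Complex.exp (Complex.I * (ι α).1 * w) = 1 := by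
      simp only [Fin.prod_univ_add, eccRot, Fin.append_left, Fin.append_right, Fin.prod_univ_two,
        ← Complex.exp_nat_mul]
      rw [← Complex.exp_add, ← Complex.exp_add, ← Complex.exp_add, ← Complex.exp_add,
        ← Complex.exp_zero]
      congr 1
      change (α 0 : ℂ) * (w * Complex.I) + (α 1 : ℂ) * (w * Complex.I) +
        ((α 2 : ℂ) * -(w * Complex.I) + (α 3 : ℂ) * -(w * Complex.I)) +
        Complex.I * (((α 2 : ℤ) + α 3 - α 0 - α 1 : ℤ) : ℂ) * w = 0
      push_cast
      ring
    simp only [Function.comp_apply, h1]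
    rw [Fin.prod_univ_add (f := fun i => Fin.append p.ecc p.eccT i ^ α i)]
    simp only [Fin.append_left, Fin.append_right]
    change _ * (∏ j, p.ecc j ^ α (Fin.castAdd 2 j)) * (∏ j, p.eccT j ^ α (Fin.natAdd 2 j)) * _ = _
    linear_combination (taylorCoeff (2 + 2) F α * ((∏ j, p.ecc j ^ α (Fin.castAdd 2 j)) *
      ∏ j, p.eccT j ^ α (Fin.natAdd 2 j))) * h2
  · intro n hn
    have h1 : c n p.act (p.ang 0) = 0 := by
      simp only [hc]
      rw [if_neg]
      intro h
      refine hn ⟨Fin.append n.2.1 n.2.2, ?_⟩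
      simp only [hι, Fin.append_left, Fin.append_right]
      have h0 : Fin.append n.2.1 n.2.2 0 = n.2.1 0 := Fin.append_left _ _ 0
      have h1 : Fin.append n.2.1 n.2.2 1 = n.2.1 1 := Fin.append_left _ _ 1
      have h2 : Fin.append n.2.1 n.2.2 2 = n.2.2 0 := Fin.append_right _ _ 0
      have h3 : Fin.append n.2.1 n.2.2 3 = n.2.2 1 := Fin.append_right _ _ 1
      rw [h0, h1, h2, h3]
      refine Prod.ext ?_ rfl
      simp only
      linarith
    simp [h1]

end

/-! ### Kepler's problem in Poincaré variables -/

noncomputable section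

section KeplerState

variable {mh mu Lam lam : ℝ} {x rt r : ℂ}

/-- Every point with `|x|² < Lam` represents a Keplerian motion. -/
theorem exists_isKeplerState (hmh : 0 < mh) (hmu : 0 < mu) (hL : 0 < Lam) (hx : ‖x‖ ^ 2 < Lam) :
    ∃ rt r, IsKeplerState mh mu Lam lam x rt r := by
  set s : ℝ := 1 - ‖x‖ ^ 2 / Lam with hs
  have hs0 : 0 < s := by
    have : ‖x‖ ^ 2 / Lam < 1 := (div_lt_one hL).2 hx
    linarith
  have hs1 : s ≤ 1 := by
    have : 0 ≤ ‖x‖ ^ 2 / Lam := by positivity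
    linarith
  have he2 : 0 ≤ 1 - s ^ 2 := by nlinarith
  have hse : √(1 - √(1 - s ^ 2) ^ 2) = s := by
    rw [Real.sq_sqrt he2, sub_sub_cancel, Real.sqrt_sq hs0.le]
  -- Kepler's equation is solvable by the intermediate value theorem
  obtain ⟨E, -, hE⟩ : lam - Complex.arg x ∈ (fun E => E - √(1 - s ^ 2) * Real.sin E) ''
      Icc (lam - Complex.arg x - √(1 - s ^ 2)) (lam - Complex.arg x + √(1 - s ^ 2)) := by
    have he0 := Real.sqrt_nonneg (1 - s ^ 2)
    refine intermediate_value_Icc (by linarith) (by fun_prop) ⟨?_, ?_⟩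
    · nlinarith [Real.neg_one_le_sin (lam - Complex.arg x - √(1 - s ^ 2))]
    · nlinarith [Real.sin_le_one (lam - Complex.arg x + √(1 - s ^ 2))]
  refine ⟨_, _, (Lam / mh) ^ 2 / mu, √(1 - s ^ 2), Complex.arg x, E, by positivity,
    Real.sqrt_nonneg _, ?_, ?_, ?_, ?_, rfl, rfl⟩
  · rw [Real.sqrt_lt' one_pos]; nlinarith
  · rw [mul_div_cancel₀ _ hmu.ne', Real.sqrt_sq (by positivity)]
    field_simp
  · simp only at hE
    linarith
  · rw [hse, ← Real.sqrt_mul hL.le, hs, sub_sub_cancel, mul_div_cancel₀ _ hL.ne',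
      Real.sqrt_sq (norm_nonneg _), mul_comm Complex.I, Complex.norm_mul_exp_arg_mul_I]

/-- The Keplerian energy only depends on the action `Lam`. -/
theorem IsKeplerState.energy (h : IsKeplerState mh mu Lam lam x rt r) (hmh : 0 < mh)
    (hmu : 0 < mu) :
    ‖rt‖ ^ 2 / (2 * mh) - mu * mh / ‖r‖ = -(mh ^ 3 * mu ^ 2) / (2 * Lam ^ 2) := by
  obtain ⟨a, e, w, E, ha, he0, he1, hLam, -, -, hr, hrt⟩ := h
  have hpos : 0 < 1 - e * Real.cos E := by nlinarith [Real.cos_le_one E, Real.neg_one_le_cos E]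
  have hs2 : √(1 - e ^ 2) ^ 2 = 1 - e ^ 2 := Real.sq_sqrt (by nlinarith)
  have hw : ‖Complex.exp (Complex.I * w)‖ = 1 := by
    rw [mul_comm]; exact Complex.norm_exp_ofReal_mul_I w
  have hn : ∀ c d : ℝ, ‖(c : ℂ) + Complex.I * (d : ℂ)‖ ^ 2 = c ^ 2 + d ^ 2 := by
    intro c d
    rw [← Complex.normSq_eq_norm_sq, mul_comm Complex.I, Complex.normSq_add_mul_I]
  have hr' : ‖r‖ = a * (1 - e * Real.cos E) := by
    rw [hr, norm_mul, norm_mul, hw, mul_one, Complex.norm_of_nonneg ha.le]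
    congr 1
    rw [← sq_eq_sq₀ (norm_nonneg _) hpos.le, hn, mul_pow, hs2]
    linear_combination (1 - e ^ 2) * Real.sin_sq_add_cos_sq E
  have hrt' : ‖rt‖ ^ 2 = mh ^ 2 * (mu / a) * (1 + e * Real.cos E) / (1 - e * Real.cos E) := by
    rw [hrt, norm_mul, norm_mul, hw, mul_one, mul_pow, hn, Complex.norm_real, Real.norm_eq_abs,
      sq_abs, mul_pow, div_pow, mul_pow, Real.sq_sqrt (by positivity), mul_pow, hs2]
    have h2 : (-Real.sin E) ^ 2 + (1 - e ^ 2) * Real.cos E ^ 2 =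
        (1 - e * Real.cos E) * (1 + e * Real.cos E) := by
      linear_combination Real.sin_sq_add_cos_sq E
    rw [h2]
    field_simp
  have hL2 : Lam ^ 2 = mh ^ 2 * (mu * a) := by
    rw [hLam, mul_pow, Real.sq_sqrt (by positivity)]
  rw [hr', hrt', hL2]
  field_simp
  ring

end KeplerState

/-- `e` times the exponential of the longitude of the pericentre, in terms of the normalized
eccentricity variables `ξ`, `η = ξ̄`. -/
def eccVec (ξ η : ℂ) : ℂ := ξ * (2 - ξ * η) ^ (1 / 2 : ℂ)

/-- Kepler's equation for the difference `u` between the eccentric and the mean longitude. -/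
def keplerEq (v : (ℂ × ℂ) × ℂ) : ℂ :=
  v.2 - (eccVec v.1.2 v.1.1 * Complex.exp (Complex.I * v.2) -
    eccVec v.1.1 v.1.2 * Complex.exp (-(Complex.I * v.2))) / (2 * Complex.I)

theorem AnalyticAt.eccVec {E : Type*} [NormedAddCommGroup E] [NormedSpace ℂ E] {f g : E → ℂ} {v : E}
    (hf : AnalyticAt ℂ f v) (hg : AnalyticAt ℂ g v) (hf0 : f v = 0) :
    AnalyticAt ℂ (fun v => Coorbital.eccVec (f v) (g v)) v := by
  unfold Coorbital.eccVec
  refine hf.mul (AnalyticAt.cpow (analyticAt_const.sub (hf.mul hg)) analyticAt_const ?_)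
  simp [hf0]

theorem analyticAt_keplerEq : AnalyticAt ℂ keplerEq 0 := by
  have h1 : AnalyticAt ℂ (fun v : (ℂ × ℂ) × ℂ => v.1.1) 0 :=
    ((ContinuousLinearMap.fst ℂ ℂ ℂ).comp (ContinuousLinearMap.fst ℂ (ℂ × ℂ) ℂ)).analyticAt 0
  have h2 : AnalyticAt ℂ (fun v : (ℂ × ℂ) × ℂ => v.1.2) 0 :=
    ((ContinuousLinearMap.snd ℂ ℂ ℂ).comp (ContinuousLinearMap.fst ℂ (ℂ × ℂ) ℂ)).analyticAt 0
  have h5 : AnalyticAt ℂ (fun v : (ℂ × ℂ) × ℂ => v.2) 0 :=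
    (ContinuousLinearMap.snd ℂ (ℂ × ℂ) ℂ).analyticAt 0
  have h3 := AnalyticAt.eccVec h1 h2 rfl
  have h4 := AnalyticAt.eccVec h2 h1 rfl
  unfold keplerEq
  fun_prop

/-- Near circular orbits the solution of Kepler's equation is unique and analytic, by the implicit
function theorem. -/
theorem exists_eccOffset : ∃ U : ℂ × ℂ → ℂ, AnalyticAt ℂ U 0 ∧ U 0 = 0 ∧
    ∀ᶠ v : (ℂ × ℂ) × ℂ in 𝓝 0, keplerEq v = 0 → U v.1 = v.2 := by
  have h0 : keplerEq 0 = 0 := by simp [keplerEq, eccVec]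
  have hinv : (fderiv ℂ keplerEq 0 ∘L .inr ℂ (ℂ × ℂ) ℂ).IsInvertible := by
    have h1 : HasFDerivAt (fun u : ℂ => keplerEq (0, u))
        (fderiv ℂ keplerEq 0 ∘L .inr ℂ (ℂ × ℂ) ℂ) 0 :=
      analyticAt_keplerEq.differentiableAt.hasFDerivAt.comp (0 : ℂ)
        (ContinuousLinearMap.inr ℂ (ℂ × ℂ) ℂ).hasFDerivAt
    have h2 : (fun u : ℂ => keplerEq (0, u)) = id := by
      ext u; simp [keplerEq, eccVec]
    rw [h2] at h1
    rw [h1.unique (hasFDerivAt_id 0)]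
    exact ⟨ContinuousLinearEquiv.refl ℂ ℂ, rfl⟩
  have hc : ContDiffAt ℂ ⊤ keplerEq 0 := analyticAt_keplerEq.contDiffAt
  refine ⟨hc.implicitFunction (by simp) hinv, ?_, ?_, ?_⟩
  · have h1 := hc.contDiffAt_implicitFunction (by simp) hinv
    exact h1.analyticAt
  · exact hc.implicitFunction_apply_self (by simp) hinv
  · filter_upwards [hc.eventually_apply_eq_iff_implicitFunction (by simp) hinv] with v hv h
    exact hv.1 (by rw [h, h0])

/-- The analytic solution of Kepler's equation near circular orbits: the difference between the
eccentric and the mean longitude. -/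
def eccOffset : ℂ × ℂ → ℂ := exists_eccOffset.choose

theorem analyticAt_eccOffset : AnalyticAt ℂ eccOffset 0 := exists_eccOffset.choose_spec.1

theorem eccOffset_zero : eccOffset 0 = 0 := exists_eccOffset.choose_spec.2.1

theorem eventually_eccOffset : ∀ᶠ v : (ℂ × ℂ) × ℂ in 𝓝 0, keplerEq v = 0 → eccOffset v.1 = v.2 :=
  exists_eccOffset.choose_spec.2.2

/-- Position on a Kepler orbit in the frame of the mean longitude, for unit semi-major axis. -/
def keplerPos (ξ η : ℂ) : ℂ :=
  (2 - ξ * η) / 2 * Complex.exp (Complex.I * eccOffset (ξ, η)) +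
    ξ ^ 2 / 2 * Complex.exp (-(Complex.I * eccOffset (ξ, η))) - eccVec ξ η

/-- Complex conjugate of `keplerPos`, as a holomorphic function. -/
def keplerPosT (ξ η : ℂ) : ℂ :=
  (2 - ξ * η) / 2 * Complex.exp (-(Complex.I * eccOffset (ξ, η))) +
    η ^ 2 / 2 * Complex.exp (Complex.I * eccOffset (ξ, η)) - eccVec η ξ

/-- The ratio of the distance to the semi-major axis. -/
def keplerDist (ξ η : ℂ) : ℂ :=
  1 - (eccVec η ξ * Complex.exp (Complex.I * eccOffset (ξ, η)) +
    eccVec ξ η * Complex.exp (-(Complex.I * eccOffset (ξ, η)))) / 2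

/-- Normalized momentum on a Kepler orbit in the frame of the mean longitude. -/
def keplerMom (ξ η : ℂ) : ℂ :=
  Complex.I * ((2 - ξ * η) / 2 * Complex.exp (Complex.I * eccOffset (ξ, η)) -
    ξ ^ 2 / 2 * Complex.exp (-(Complex.I * eccOffset (ξ, η)))) / keplerDist ξ η

/-- Complex conjugate of `keplerMom`, as a holomorphic function. -/
def keplerMomT (ξ η : ℂ) : ℂ :=
  -Complex.I * ((2 - ξ * η) / 2 * Complex.exp (-(Complex.I * eccOffset (ξ, η))) -
    η ^ 2 / 2 * Complex.exp (Complex.I * eccOffset (ξ, η))) / keplerDist ξ η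

section Analytic

variable {E : Type*} [NormedAddCommGroup E] [NormedSpace ℂ E] {f g : E → ℂ} {v : E}

theorem AnalyticAt.eccOffset (hf : AnalyticAt ℂ f v) (hg : AnalyticAt ℂ g v) (hf0 : f v = 0)
    (hg0 : g v = 0) : AnalyticAt ℂ (fun v => Coorbital.eccOffset (f v, g v)) v := by
  have h : AnalyticAt ℂ Coorbital.eccOffset (f v, g v) := by
    rw [hf0, hg0]; exact analyticAt_eccOffset
  exact h.comp (f := fun v => (f v, g v)) (hf.prod hg)

theorem AnalyticAt.keplerPos (hf : AnalyticAt ℂ f v) (hg : AnalyticAt ℂ g v) (hf0 : f v = 0)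
    (hg0 : g v = 0) : AnalyticAt ℂ (fun v => Coorbital.keplerPos (f v) (g v)) v := by
  have h1 := AnalyticAt.eccOffset hf hg hf0 hg0
  have h2 := AnalyticAt.eccVec hf hg hf0
  unfold Coorbital.keplerPos
  fun_prop

theorem AnalyticAt.keplerPosT (hf : AnalyticAt ℂ f v) (hg : AnalyticAt ℂ g v) (hf0 : f v = 0)
    (hg0 : g v = 0) : AnalyticAt ℂ (fun v => Coorbital.keplerPosT (f v) (g v)) v := by
  have h1 := AnalyticAt.eccOffset hf hg hf0 hg0
  have h2 := AnalyticAt.eccVec hg hf hg0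
  unfold Coorbital.keplerPosT
  fun_prop

theorem keplerDist_zero : keplerDist 0 0 = 1 := by simp [keplerDist, eccVec]

theorem AnalyticAt.keplerDist (hf : AnalyticAt ℂ f v) (hg : AnalyticAt ℂ g v) (hf0 : f v = 0)
    (hg0 : g v = 0) : AnalyticAt ℂ (fun v => Coorbital.keplerDist (f v) (g v)) v := by
  have h1 := AnalyticAt.eccOffset hf hg hf0 hg0
  have h2 := AnalyticAt.eccVec hf hg hf0
  have h3 := AnalyticAt.eccVec hg hf hg0
  unfold Coorbital.keplerDist
  fun_prop

theorem AnalyticAt.keplerMom (hf : AnalyticAt ℂ f v) (hg : AnalyticAt ℂ g v) (hf0 : f v = 0)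
    (hg0 : g v = 0) : AnalyticAt ℂ (fun v => Coorbital.keplerMom (f v) (g v)) v := by
  have h1 := AnalyticAt.eccOffset hf hg hf0 hg0
  have h2 := AnalyticAt.keplerDist hf hg hf0 hg0
  unfold Coorbital.keplerMom
  refine AnalyticAt.div (by fun_prop) h2 ?_
  rw [hf0, hg0, keplerDist_zero]
  exact one_ne_zero

theorem AnalyticAt.keplerMomT (hf : AnalyticAt ℂ f v) (hg : AnalyticAt ℂ g v) (hf0 : f v = 0)
    (hg0 : g v = 0) : AnalyticAt ℂ (fun v => Coorbital.keplerMomT (f v) (g v)) v := by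
  have h1 := AnalyticAt.eccOffset hf hg hf0 hg0
  have h2 := AnalyticAt.keplerDist hf hg hf0 hg0
  unfold Coorbital.keplerMomT
  refine AnalyticAt.div (by fun_prop) h2 ?_
  rw [hf0, hg0, keplerDist_zero]
  exact one_ne_zero

end Analytic

theorem keplerPos_zero : keplerPos 0 0 = 1 := by
  have : eccOffset (0, 0) = 0 := eccOffset_zero
  simp [keplerPos, eccVec, this]

theorem keplerPosT_zero : keplerPosT 0 0 = 1 := by
  have : eccOffset (0, 0) = 0 := eccOffset_zero
  simp [keplerPosT, eccVec, this]

set_option maxHeartbeats 1000000 in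
/-- Near circular orbits, the heliocentric coordinates are given by the analytic expressions
`keplerPos`, `keplerMom`, and their conjugates by `keplerPosT`, `keplerMomT`. -/
theorem exists_isKeplerState_formulas : ∃ δ > 0, ∀ (mh mu Lam lam : ℝ) (x rt r : ℂ), 0 < mh →
    0 < mu → 0 < Lam → IsKeplerState mh mu Lam lam x rt r → ‖x‖ < δ * √Lam → ∀ ξ η : ℂ,
    ξ = x * Complex.exp (-(Complex.I * lam)) / (√Lam : ℝ) →
    η = star x * Complex.exp (Complex.I * lam) / (√Lam : ℝ) →
    r = Complex.exp (Complex.I * lam) * (Lam ^ 2 / (mh ^ 2 * mu) * keplerPos ξ η) ∧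
    star r = Complex.exp (-(Complex.I * lam)) * (Lam ^ 2 / (mh ^ 2 * mu) * keplerPosT ξ η) ∧
    rt = Complex.exp (Complex.I * lam) * (mh ^ 2 * mu / Lam * keplerMom ξ η) ∧
    star rt = Complex.exp (-(Complex.I * lam)) * (mh ^ 2 * mu / Lam * keplerMomT ξ η) := by
  obtain ⟨ε, hε, hε'⟩ := Metric.eventually_nhds_iff_ball.1 eventually_eccOffset
  -- below, `ξ` and `η` have modulus `σ`, and the solution `u` of Kepler's equation is at most `2 σ`
  refine ⟨ε / 2, by positivity, ?_⟩
  rintro mh mu Lam lam x rt r hmh hmu hL ⟨a, e, w, E, ha, he0, he1, hLam, hlam, hx, hr, hrt⟩ hxs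
    ξ η hξ hη
  set s := √(1 - e ^ 2) with hs
  have hs2 : s ^ 2 = 1 - e ^ 2 := Real.sq_sqrt (by nlinarith)
  have hs0 : 0 < s := Real.sqrt_pos.2 (by nlinarith)
  have hs1 : s ≤ 1 := by nlinarith
  set σ := √(1 - s) with hσ
  have hσ2 : σ ^ 2 = 1 - s := Real.sq_sqrt (by linarith)
  have hsL : 0 < √Lam := Real.sqrt_pos.2 hL
  have hsL' : ((√Lam : ℝ) : ℂ) ≠ 0 := by exact_mod_cast hsL.ne'
  set τ := √(1 + s) with hτ
  have hτ2 : τ ^ 2 = 1 + s := Real.sq_sqrt (by linarith)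
  have hστ : σ * τ = e := by
    rw [hσ, hτ, ← Real.sqrt_mul (by linarith), ← Real.sqrt_sq he0]
    congr 1
    nlinarith
  have conj_exp : ∀ t : ℝ, star (Complex.exp (Complex.I * t)) = Complex.exp (-(Complex.I * t)) := by
    intro t
    rw [Complex.star_def, ← Complex.exp_conj]
    simp
  have exp_mul_neg : ∀ t : ℂ, Complex.exp (Complex.I * t) * Complex.exp (-(Complex.I * t)) = 1 := by
    intro t; rw [← Complex.exp_add]; simp
  -- all formulas become polynomial identities in the exponentials of `E`, `w` and `lam`
  set A := Complex.exp (Complex.I * E) with hA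
  set A' := Complex.exp (-(Complex.I * E)) with hA'
  set B := Complex.exp (Complex.I * w) with hB
  set B' := Complex.exp (-(Complex.I * w)) with hB'
  set C := Complex.exp (Complex.I * lam) with hC
  set C' := Complex.exp (-(Complex.I * lam)) with hC'
  have hAA : A * A' = 1 := exp_mul_neg _
  have hBB : B * B' = 1 := exp_mul_neg _
  have hCC : C * C' = 1 := exp_mul_neg _
  have hξ' : ξ = σ * B * C' := by
    rw [hξ, hx]; push_cast; field_simp
  have hη' : η = σ * B' * C := by
    have h1 : star B = B' := conj_exp w
    rw [hη, hx, star_mul', h1, Complex.star_def, Complex.conj_ofReal]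
    push_cast; field_simp
  have hξη : ξ * η = ((1 - s : ℝ) : ℂ) := by
    rw [hξ', hη', ← hσ2]; push_cast
    linear_combination (σ : ℂ) ^ 2 * C * C' * hBB + (σ : ℂ) ^ 2 * hCC
  have hroot : (2 - ((1 - s : ℝ) : ℂ)) ^ (1 / 2 : ℂ) = (τ : ℂ) := by
    have h1 : (2 - ((1 - s : ℝ) : ℂ)) = ((1 + s : ℝ) : ℂ) := by push_cast; ring
    rw [h1, hτ, Real.sqrt_eq_rpow, Complex.ofReal_cpow (by linarith)]
    norm_num
  have hW : eccVec ξ η = e * B * C' := by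
    rw [eccVec, hξη, hroot, hξ', ← hστ]; push_cast; ring
  have hW' : eccVec η ξ = e * B' * C := by
    rw [eccVec, mul_comm η ξ, hξη, hroot, hη', ← hστ]; push_cast; ring
  obtain ⟨u, hu⟩ : ∃ u : ℝ, u = e * Real.sin E := ⟨_, rfl⟩
  have hu' : u = E + w - lam := by rw [hu, hlam]; ring
  have hexp : Complex.exp (Complex.I * u) = A * B * C' := by
    rw [hA, hB, hC', ← Complex.exp_add, ← Complex.exp_add, hu']
    congr 1; push_cast; ring
  have hexp' : Complex.exp (-(Complex.I * u)) = A' * B' * C := by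
    rw [hA', hB', hC, ← Complex.exp_add, ← Complex.exp_add, hu']
    congr 1; push_cast; ring
  have hcos : Complex.cos E = (A + A') / 2 := by
    rw [Complex.cos, hA, hA']
    congr 3 <;> ring_nf
  have hsin : Complex.sin E = (A' - A) * Complex.I / 2 := by
    rw [Complex.sin, hA, hA']
    congr 4 <;> ring_nf
  have hI : (2 * Complex.I)⁻¹ = -Complex.I / 2 := by
    rw [mul_inv, Complex.inv_I]; ring
  have hkep : keplerEq ((ξ, η), (u : ℂ)) = 0 := by
    simp only [keplerEq]
    rw [hW, hW', hexp, hexp', hu, Complex.ofReal_mul, Complex.ofReal_sin, hsin,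
      div_eq_mul_inv _ (2 * Complex.I), hI]
    linear_combination (e * Complex.I / 2 * (A - A') : ℂ) * (C * C' * hBB + hCC)
  have hoff : eccOffset (ξ, η) = u := by
    refine hε' ((ξ, η), (u : ℂ)) ?_ hkep
    have hxn : ‖x‖ = √Lam * σ := by
      rw [hx, norm_mul, hB, mul_comm Complex.I, Complex.norm_exp_ofReal_mul_I, mul_one,
        Complex.norm_of_nonneg (by positivity)]
    have hσε : σ < ε / 2 := by
      rw [hxn, mul_comm] at hxs
      exact lt_of_mul_lt_mul_right hxs hsL.le
    have hσ0 : 0 ≤ σ := Real.sqrt_nonneg _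
    have nB : ∀ t : ℝ, ‖Complex.exp (Complex.I * t)‖ = 1 := fun t => by
      rw [mul_comm]; exact Complex.norm_exp_ofReal_mul_I t
    have nB' : ∀ t : ℝ, ‖Complex.exp (-(Complex.I * t))‖ = 1 := fun t => by
      rw [← conj_exp, norm_star, nB]
    have h1 : ‖ξ‖ = σ := by
      rw [hξ', norm_mul, norm_mul, hB, hC', nB, nB', Complex.norm_of_nonneg hσ0]; ring
    have h2 : ‖η‖ = σ := by
      rw [hη', norm_mul, norm_mul, hB', hC, nB, nB', Complex.norm_of_nonneg hσ0]; ring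
    have h3 : ‖(u : ℂ)‖ < ε := by
      rw [Complex.norm_real, Real.norm_eq_abs, hu, abs_mul, abs_of_nonneg he0]
      have hτ' : τ ≤ 2 := by
        rw [hτ]; exact (Real.sqrt_le_left (by norm_num)).2 (by linarith)
      have := Real.abs_sin_le_one E
      have h4 : e ≤ σ * 2 := by rw [← hστ]; gcongr
      nlinarith
    rw [mem_ball_zero_iff]
    simp only [Prod.norm_def, h1, h2, sup_lt_iff]
    exact ⟨⟨by linarith, by linarith⟩, h3⟩
  have hdist : keplerDist ξ η = ((1 - e * Real.cos E : ℝ) : ℂ) := by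
    rw [keplerDist, hoff, hW, hW', hexp, hexp']
    push_cast
    rw [hcos]
    linear_combination (-(e * (A + A') / 2) : ℂ) * (C * C' * hBB + hCC)
  have hpos : 0 < 1 - e * Real.cos E := by nlinarith [Real.cos_le_one E, Real.neg_one_le_cos E]
  have ha' : Lam ^ 2 / (mh ^ 2 * mu) = a := by
    rw [hLam, mul_pow, Real.sq_sqrt (by positivity)]; field_simp
  have haC : (Lam : ℂ) ^ 2 / (mh ^ 2 * mu) = a := by exact_mod_cast ha'
  have hm' : mh ^ 2 * mu / Lam = mh * (√(mu / a ^ 3) * a) := by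
    have h1 : √(mu / a ^ 3) * a = √mu / √a := by
      rw [Real.sqrt_div hmu.le, show a ^ 3 = a * a ^ 2 by ring, Real.sqrt_mul ha.le,
        Real.sqrt_sq ha.le]
      field_simp
    have h2 : √mu * √mu = mu := Real.mul_self_sqrt hmu.le
    have h3 : 0 < √mu := Real.sqrt_pos.2 hmu
    have h4 : 0 < √a := Real.sqrt_pos.2 ha
    rw [h1, hLam, Real.sqrt_mul hmu.le]
    field_simp
    nlinarith
  have hmC : (mh : ℂ) ^ 2 * mu / Lam = ((mh * (√(mu / a ^ 3) * a) : ℝ) : ℂ) := by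
    rw [← hm']; push_cast; ring
  have hσC : (σ : ℂ) ^ 2 = 1 - s := by exact_mod_cast hσ2
  have hstar : ∀ c d : ℝ, star ((c : ℂ) + Complex.I * (d : ℂ)) = c - Complex.I * d := by
    intro c d
    simp [sub_eq_add_neg]
  have hB1 : star B = B' := conj_exp w
  obtain ⟨m, hm⟩ : ∃ m : ℝ, m = mh * (√(mu / a ^ 3) * a) := ⟨_, rfl⟩
  obtain ⟨d, hd⟩ : ∃ d : ℝ, d = 1 - e * Real.cos E := ⟨_, rfl⟩
  have hrt' : rt = ((m / d : ℝ) : ℂ) * ((-Real.sin E : ℝ) + Complex.I * (s * Real.cos E : ℝ)) *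
      B := by
    rw [hrt, hm, hd]; push_cast; ring
  rw [← hm] at hmC
  rw [← hd] at hdist
  refine ⟨?_, ?_, ?_, ?_⟩
  · rw [haC, hr, keplerPos, hoff, hexp, hexp', hξη, hW, hξ']
    push_cast
    rw [hcos, hsin]
    linear_combination (a * s * (A' - A) / 2 * B : ℂ) * Complex.I_sq -
      (a * B * (1 + s) / 2 * A : ℂ) * hCC - a * B * A' / 2 * (B * B' * (C * C') ^ 2) * hσC -
      a * B * A' / 2 * (1 - s) * (C * C') ^ 2 * hBB -
      a * B * A' / 2 * (1 - s) * (C * C' + 1) * hCC + a * B * e * hCC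
  · rw [haC, hr, keplerPosT, hoff, hexp, hexp', hξη, hW', hη', star_mul', star_mul', hstar, hB1,
      Complex.star_def, Complex.conj_ofReal]
    push_cast
    rw [hcos, hsin]
    linear_combination (a * s * (A - A') / 2 * B' : ℂ) * Complex.I_sq -
      (a * B' * (1 + s) / 2 * A' : ℂ) * hCC - a * B' * A / 2 * (B * B' * (C * C') ^ 2) * hσC -
      a * B' * A / 2 * (1 - s) * (C * C') ^ 2 * hBB -
      a * B' * A / 2 * (1 - s) * (C * C' + 1) * hCC + a * B' * e * hCC
  · rw [hmC, hrt', keplerMom, hoff, hexp, hexp', hξη, hdist, hξ']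
    push_cast
    rw [hcos, hsin]
    linear_combination (m / d * Complex.I : ℂ) * (-(B * (1 + s) / 2 * A * hCC) +
      B * A' / 2 * (B * B' * (C * C') ^ 2) * hσC + B * A' / 2 * (1 - s) * (C * C') ^ 2 * hBB +
      B * A' / 2 * (1 - s) * (C * C' + 1) * hCC)
  · rw [hmC, hrt', keplerMomT, hoff, hexp, hexp', hξη, hdist, hη', star_mul', star_mul', hstar,
      hB1, Complex.star_def, Complex.conj_ofReal]
    push_cast
    rw [hcos, hsin]
    linear_combination (-(m / d * Complex.I) : ℂ) * (-(B' * (1 + s) / 2 * A' * hCC) +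
      B' * A / 2 * (B * B' * (C * C') ^ 2) * hσC + B' * A / 2 * (1 - s) * (C * C') ^ 2 * hBB +
      B' * A / 2 * (1 - s) * (C * C' + 1) * hCC)

end

/-! ### The perturbation in resonant variables -/

noncomputable section

/-- Normalized eccentricity variable in the frame of the mean longitude `φ`. -/
def eccNorm (L φ x : ℂ) : ℂ := x * Complex.exp (-(Complex.I * φ)) / L ^ (1 / 2 : ℂ)

/-- Conjugate of `eccNorm`, in terms of `xt = -i conj x`. -/
def eccNormT (L φ xt : ℂ) : ℂ := Complex.I * xt * Complex.exp (Complex.I * φ) / L ^ (1 / 2 : ℂ)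

/-- The complexified actions of the planets, where `L` are the exactly resonant ones. -/
def planetLam (L : Fin 2 → ℂ) (p : Phase) : Fin 2 → ℂ := ![L 0 + p.1 0, L 1 + p.1 1 - p.1 0]

/-- The complexified mean longitudes of the planets. -/
def planetLon (p : Phase) : Fin 2 → ℂ := ![p.2.1 0 + p.2.1 1, p.2.1 1]

/-- Normalized eccentricity variables of the planets. -/
def planetEcc (L : Fin 2 → ℂ) (p : Phase) (j : Fin 2) : ℂ :=
  eccNorm (planetLam L p j) (planetLon p j) (p.2.2.1 j)

/-- Conjugates of the normalized eccentricity variables of the planets. -/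
def planetEccT (L : Fin 2 → ℂ) (p : Phase) (j : Fin 2) : ℂ :=
  eccNormT (planetLam L p j) (planetLon p j) (p.2.2.2 j)

/-- Complexified heliocentric positions; `c.1 j` stands for `redMass j ^ 2 * mu j` and `c.2` for the
exactly resonant actions. -/
def planetPos (c : (Fin 2 → ℂ) × (Fin 2 → ℂ)) (p : Phase) (j : Fin 2) : ℂ :=
  Complex.exp (Complex.I * planetLon p j) *
    (planetLam c.2 p j ^ 2 / c.1 j * keplerPos (planetEcc c.2 p j) (planetEccT c.2 p j))

/-- Holomorphic extension of the conjugate of `planetPos`. -/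
def planetPosT (c : (Fin 2 → ℂ) × (Fin 2 → ℂ)) (p : Phase) (j : Fin 2) : ℂ :=
  Complex.exp (-(Complex.I * planetLon p j)) *
    (planetLam c.2 p j ^ 2 / c.1 j * keplerPosT (planetEcc c.2 p j) (planetEccT c.2 p j))

/-- Complexified momenta. -/
def planetMom (c : (Fin 2 → ℂ) × (Fin 2 → ℂ)) (p : Phase) (j : Fin 2) : ℂ :=
  Complex.exp (Complex.I * planetLon p j) *
    (c.1 j / planetLam c.2 p j * keplerMom (planetEcc c.2 p j) (planetEccT c.2 p j))

/-- Holomorphic extension of the conjugate of `planetMom`. -/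
def planetMomT (c : (Fin 2 → ℂ) × (Fin 2 → ℂ)) (p : Phase) (j : Fin 2) : ℂ :=
  Complex.exp (-(Complex.I * planetLon p j)) *
    (c.1 j / planetLam c.2 p j * keplerMomT (planetEcc c.2 p j) (planetEccT c.2 p j))

/-- Holomorphic extension of the squared distance of the planets. -/
def distSq (c : (Fin 2 → ℂ) × (Fin 2 → ℂ)) (p : Phase) : ℂ :=
  (planetPos c p 0 - planetPos c p 1) * (planetPosT c p 0 - planetPosT c p 1)

/-- Holomorphic extension of the perturbation divided by `eps`, the inner product of the momenta and
the distance being expressed by conjugates; `M` is the product of the planetary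
mass parameters. -/
def pertFun (m0 M : ℝ) (c : (Fin 2 → ℂ) × (Fin 2 → ℂ)) (p : Phase) : ℂ :=
  (planetMom c p 0 * planetMomT c p 1 + planetMomT c p 0 * planetMom c p 1) / (2 * m0) -
    M / distSq c p ^ (1 / 2 : ℂ)

/-- The representative with zero fast angle on the rotation orbit of `p`. -/
def derot (p : Phase) : Phase := (p.1, ![p.2.1 0, 0],
  Complex.exp (-(Complex.I * p.2.1 1)) • p.2.2.1, Complex.exp (Complex.I * p.2.1 1) • p.2.2.2)

theorem derot_rot (θ : ℝ) (p : Phase) : derot (rot θ p) = derot p := by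
  have h1 : Complex.exp (-(Complex.I * (p.2.1 1 + θ))) * Complex.exp (θ * Complex.I) =
      Complex.exp (-(Complex.I * p.2.1 1)) := by
    rw [← Complex.exp_add]; congr 1; ring
  have h2 : Complex.exp (Complex.I * (p.2.1 1 + θ)) * Complex.exp (-(θ * Complex.I)) =
      Complex.exp (Complex.I * p.2.1 1) := by
    rw [← Complex.exp_add]; congr 1; ring
  rw [rot_apply]
  simp only [derot, Pi.add_apply, Matrix.cons_val_zero, Matrix.cons_val_one, add_zero, smul_smul,
    h1, h2]

theorem differentiable_derot : Differentiable ℂ derot := by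
  have h : Differentiable ℂ fun p : Phase => (![p.2.1 0, 0] : Fin 2 → ℂ) := by
    rw [differentiable_pi]
    intro j
    fin_cases j
    · simp only [Fin.zero_eta, Matrix.cons_val_zero]; fun_prop
    · simp
  unfold derot
  fun_prop

theorem planetEcc_derot (L : Fin 2 → ℂ) (p : Phase) (j : Fin 2) :
    planetEcc L (derot p) j = planetEcc L p j := by
  have h1 : Complex.exp (-(Complex.I * p.2.1 1)) * p.2.2.1 0 * Complex.exp (-(Complex.I * p.2.1 0))
      = p.2.2.1 0 * Complex.exp (-(Complex.I * (p.2.1 0 + p.2.1 1))) := by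
    rw [mul_add, neg_add, Complex.exp_add]; ring
  fin_cases j <;> simp [planetEcc, eccNorm, planetLam, planetLon, derot, h1, mul_comm]

theorem planetEccT_derot (L : Fin 2 → ℂ) (p : Phase) (j : Fin 2) :
    planetEccT L (derot p) j = planetEccT L p j := by
  have h1 : Complex.I * (Complex.exp (Complex.I * p.2.1 1) * p.2.2.2 0) *
      Complex.exp (Complex.I * p.2.1 0) =
      Complex.I * p.2.2.2 0 * Complex.exp (Complex.I * (p.2.1 0 + p.2.1 1)) := by
    rw [mul_add, Complex.exp_add]; ring
  have h2 : Complex.I * (Complex.exp (Complex.I * p.2.1 1) * p.2.2.2 1) =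
      Complex.I * p.2.2.2 1 * Complex.exp (Complex.I * p.2.1 1) := by ring
  fin_cases j <;> simp [planetEccT, eccNormT, planetLam, planetLon, derot, h1, h2]

theorem exp_planetLon_derot (p : Phase) (j : Fin 2) :
    Complex.exp (Complex.I * planetLon (derot p) j) =
      Complex.exp (-(Complex.I * p.2.1 1)) * Complex.exp (Complex.I * planetLon p j) := by
  rw [← Complex.exp_add]
  congr 1
  fin_cases j <;> simp [planetLon, derot]; ring

theorem exp_neg_planetLon_derot (p : Phase) (j : Fin 2) :
    Complex.exp (-(Complex.I * planetLon (derot p) j)) =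
      Complex.exp (Complex.I * p.2.1 1) * Complex.exp (-(Complex.I * planetLon p j)) := by
  rw [← Complex.exp_add]
  congr 1
  fin_cases j <;> simp [planetLon, derot]; ring

theorem distSq_derot (c : (Fin 2 → ℂ) × (Fin 2 → ℂ)) (p : Phase) :
    distSq c (derot p) = distSq c p := by
  have h : Complex.exp (-(Complex.I * p.2.1 1)) * Complex.exp (Complex.I * p.2.1 1) = 1 := by
    rw [← Complex.exp_add]; simp
  have hL : planetLam c.2 (derot p) = planetLam c.2 p := rfl
  simp only [distSq, planetPos, planetPosT, exp_planetLon_derot, exp_neg_planetLon_derot,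
    planetEcc_derot, planetEccT_derot, hL]
  rw [mul_assoc (Complex.exp (-(Complex.I * p.2.1 1))),
    mul_assoc (Complex.exp (-(Complex.I * p.2.1 1))), ← mul_sub,
    mul_assoc (Complex.exp (Complex.I * p.2.1 1)),
    mul_assoc (Complex.exp (Complex.I * p.2.1 1)), ← mul_sub, mul_mul_mul_comm, h, one_mul]

theorem pertFun_derot (m0 M : ℝ) (c : (Fin 2 → ℂ) × (Fin 2 → ℂ)) (p : Phase) :
    pertFun m0 M c (derot p) = pertFun m0 M c p := by
  have h : Complex.exp (-(Complex.I * p.2.1 1)) * Complex.exp (Complex.I * p.2.1 1) = 1 := by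
    rw [← Complex.exp_add]; simp
  have hL : planetLam c.2 (derot p) = planetLam c.2 p := rfl
  have hm : ∀ j, planetMom c (derot p) j =
      Complex.exp (-(Complex.I * p.2.1 1)) * planetMom c p j := fun j => by
    simp only [planetMom, exp_planetLon_derot, planetEcc_derot, planetEccT_derot, hL, mul_assoc]
  have hmT : ∀ j, planetMomT c (derot p) j =
      Complex.exp (Complex.I * p.2.1 1) * planetMomT c p j := fun j => by
    simp only [planetMomT, exp_neg_planetLon_derot, planetEcc_derot, planetEccT_derot, hL,
      mul_assoc]
  rw [pertFun, pertFun, distSq_derot, hm, hm, hmT, hmT]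
  congr 2
  linear_combination (planetMom c p 0 * planetMomT c p 1 + planetMomT c p 0 * planetMom c p 1) * h

section Analytic

variable {v : ((Fin 2 → ℂ) × (Fin 2 → ℂ)) × Phase}

theorem analyticAt_coord (l : ((Fin 2 → ℂ) × (Fin 2 → ℂ)) × Phase →L[ℂ] Fin 2 → ℂ) (j : Fin 2) :
    AnalyticAt ℂ (fun v => l v j) v :=
  ((ContinuousLinearMap.proj (R := ℂ) (φ := fun _ : Fin 2 => ℂ) j).comp l).analyticAt v

theorem analyticAt_planetLam (j : Fin 2) :
    AnalyticAt ℂ (fun v : ((Fin 2 → ℂ) × (Fin 2 → ℂ)) × Phase => planetLam v.1.2 v.2 j) v := by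
  have hL : ∀ j, AnalyticAt ℂ
      (fun v : ((Fin 2 → ℂ) × (Fin 2 → ℂ)) × Phase => v.1.2 j) v :=
    analyticAt_coord ((ContinuousLinearMap.snd ℂ _ _).comp (ContinuousLinearMap.fst ℂ _ _))
  have hZ : ∀ j, AnalyticAt ℂ
      (fun v : ((Fin 2 → ℂ) × (Fin 2 → ℂ)) × Phase => v.2.1 j) v :=
    analyticAt_coord ((ContinuousLinearMap.fst ℂ _ _).comp (ContinuousLinearMap.snd ℂ _ _))
  fin_cases j
  · exact (hL 0).add (hZ 0)
  · exact ((hL 1).add (hZ 1)).sub (hZ 0)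

theorem analyticAt_planetLon (j : Fin 2) :
    AnalyticAt ℂ (fun v : ((Fin 2 → ℂ) × (Fin 2 → ℂ)) × Phase => planetLon v.2 j) v := by
  have hz : ∀ j, AnalyticAt ℂ
      (fun v : ((Fin 2 → ℂ) × (Fin 2 → ℂ)) × Phase => v.2.2.1 j) v :=
    analyticAt_coord ((ContinuousLinearMap.fst ℂ _ _).comp
      ((ContinuousLinearMap.snd ℂ _ _).comp (ContinuousLinearMap.snd ℂ _ _)))
  fin_cases j
  · exact (hz 0).add (hz 1)
  · exact hz 1

theorem analyticAt_planetEcc {j : Fin 2} (hL : planetLam v.1.2 v.2 j ∈ Complex.slitPlane) :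
    AnalyticAt ℂ (fun v : ((Fin 2 → ℂ) × (Fin 2 → ℂ)) × Phase => planetEcc v.1.2 v.2 j) v := by
  have hx : AnalyticAt ℂ (fun v : ((Fin 2 → ℂ) × (Fin 2 → ℂ)) × Phase => v.2.2.2.1 j) v :=
    analyticAt_coord ((ContinuousLinearMap.fst ℂ _ _).comp ((ContinuousLinearMap.snd ℂ _ _).comp
      ((ContinuousLinearMap.snd ℂ _ _).comp (ContinuousLinearMap.snd ℂ _ _)))) j
  have h1 := analyticAt_planetLam (v := v) j
  have h2 := analyticAt_planetLon (v := v) j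
  unfold planetEcc eccNorm
  refine AnalyticAt.div (by fun_prop) (h1.cpow analyticAt_const hL) ?_
  simp [Complex.cpow_eq_zero_iff, Complex.slitPlane_ne_zero hL]

theorem analyticAt_planetEccT {j : Fin 2} (hL : planetLam v.1.2 v.2 j ∈ Complex.slitPlane) :
    AnalyticAt ℂ (fun v : ((Fin 2 → ℂ) × (Fin 2 → ℂ)) × Phase => planetEccT v.1.2 v.2 j) v := by
  have hx : AnalyticAt ℂ (fun v : ((Fin 2 → ℂ) × (Fin 2 → ℂ)) × Phase => v.2.2.2.2 j) v :=
    analyticAt_coord ((ContinuousLinearMap.snd ℂ _ _).comp ((ContinuousLinearMap.snd ℂ _ _).comp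
      ((ContinuousLinearMap.snd ℂ _ _).comp (ContinuousLinearMap.snd ℂ _ _)))) j
  have h1 := analyticAt_planetLam (v := v) j
  have h2 := analyticAt_planetLon (v := v) j
  unfold planetEccT eccNormT
  refine AnalyticAt.div (by fun_prop) (h1.cpow analyticAt_const hL) ?_
  simp [Complex.cpow_eq_zero_iff, Complex.slitPlane_ne_zero hL]

theorem planetEcc_eq_zero {L : Fin 2 → ℂ} {p : Phase} {j : Fin 2} (h : p.2.2.1 j = 0) :
    planetEcc L p j = 0 := by simp [planetEcc, eccNorm, h]

theorem planetEccT_eq_zero {L : Fin 2 → ℂ} {p : Phase} {j : Fin 2} (h : p.2.2.2 j = 0) :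
    planetEccT L p j = 0 := by simp [planetEccT, eccNormT, h]

theorem analyticAt_planet {j : Fin 2} (hk : v.1.1 j ≠ 0)
    (hL : planetLam v.1.2 v.2 j ∈ Complex.slitPlane) (hx : v.2.2.2.1 j = 0)
    (hxt : v.2.2.2.2 j = 0) :
    AnalyticAt ℂ (fun v : ((Fin 2 → ℂ) × (Fin 2 → ℂ)) × Phase => planetPos v.1 v.2 j) v ∧
    AnalyticAt ℂ (fun v : ((Fin 2 → ℂ) × (Fin 2 → ℂ)) × Phase => planetPosT v.1 v.2 j) v ∧
    AnalyticAt ℂ (fun v : ((Fin 2 → ℂ) × (Fin 2 → ℂ)) × Phase => planetMom v.1 v.2 j) v ∧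
    AnalyticAt ℂ (fun v : ((Fin 2 → ℂ) × (Fin 2 → ℂ)) × Phase => planetMomT v.1 v.2 j) v := by
  have hk' : AnalyticAt ℂ (fun v : ((Fin 2 → ℂ) × (Fin 2 → ℂ)) × Phase => v.1.1 j) v :=
    analyticAt_coord ((ContinuousLinearMap.fst ℂ _ _).comp (ContinuousLinearMap.fst ℂ _ _)) j
  have h1 := analyticAt_planetLam (v := v) j
  have h2 := analyticAt_planetLon (v := v) j
  have h3 := analyticAt_planetEcc hL
  have h4 := analyticAt_planetEccT hL
  have z3 : planetEcc v.1.2 v.2 j = 0 := planetEcc_eq_zero hx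
  have z4 : planetEccT v.1.2 v.2 j = 0 := planetEccT_eq_zero hxt
  have a1 := AnalyticAt.keplerPos h3 h4 z3 z4
  have a2 := AnalyticAt.keplerPosT h3 h4 z3 z4
  have a3 := AnalyticAt.keplerMom h3 h4 z3 z4
  have a4 := AnalyticAt.keplerMomT h3 h4 z3 z4
  have d1 : AnalyticAt ℂ (fun v : ((Fin 2 → ℂ) × (Fin 2 → ℂ)) × Phase =>
      planetLam v.1.2 v.2 j ^ 2 / v.1.1 j) v := (h1.pow 2).div hk' hk
  have d2 : AnalyticAt ℂ (fun v : ((Fin 2 → ℂ) × (Fin 2 → ℂ)) × Phase =>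
      v.1.1 j / planetLam v.1.2 v.2 j) v := hk'.div h1 (Complex.slitPlane_ne_zero hL)
  refine ⟨?_, ?_, ?_, ?_⟩
  · unfold planetPos; fun_prop
  · unfold planetPosT; fun_prop
  · unfold planetMom; fun_prop
  · unfold planetMomT; fun_prop

theorem analyticAt_distSq (hk : ∀ j, v.1.1 j ≠ 0)
    (hL : ∀ j, planetLam v.1.2 v.2 j ∈ Complex.slitPlane) (hx : v.2.2.2.1 = 0)
    (hxt : v.2.2.2.2 = 0) :
    AnalyticAt ℂ (fun v : ((Fin 2 → ℂ) × (Fin 2 → ℂ)) × Phase => distSq v.1 v.2) v := by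
  have h := fun j => analyticAt_planet (hk j) (hL j) (congrFun hx j) (congrFun hxt j)
  exact ((h 0).1.sub (h 1).1).mul ((h 0).2.1.sub (h 1).2.1)

theorem analyticAt_pertFun (m0 M : ℝ) (hk : ∀ j, v.1.1 j ≠ 0)
    (hL : ∀ j, planetLam v.1.2 v.2 j ∈ Complex.slitPlane) (hx : v.2.2.2.1 = 0)
    (hxt : v.2.2.2.2 = 0) (hd : distSq v.1 v.2 ∈ Complex.slitPlane) :
    AnalyticAt ℂ (fun v : ((Fin 2 → ℂ) × (Fin 2 → ℂ)) × Phase => pertFun m0 M v.1 v.2) v := by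
  have h := fun j => analyticAt_planet (hk j) (hL j) (congrFun hx j) (congrFun hxt j)
  have h0 := analyticAt_distSq hk hL hx hxt
  unfold pertFun
  refine AnalyticAt.sub ?_ (analyticAt_const.div (h0.cpow analyticAt_const hd) ?_)
  · have := (((h 0).2.2.1.mul (h 1).2.2.2).add ((h 0).2.2.2.mul (h 1).2.2.1)).div_const
      (c := (2 * m0 : ℂ))
    exact this
  · simp [Complex.cpow_eq_zero_iff, Complex.slitPlane_ne_zero hd]

end Analytic

theorem sq_mem_slitPlane {z : ℂ} (h : 0 < z.re) : z ^ 2 ∈ Complex.slitPlane := by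
  rw [Complex.mem_slitPlane_iff]
  by_cases hi : z.im = 0
  · left; rw [sq, Complex.mul_re, hi]; nlinarith
  · right
    rw [sq, Complex.mul_im]
    have := mul_ne_zero h.ne' hi
    intro h2
    apply this
    linarith

/-- Two points at different longitudes on the same circle do not collide, even for complex
longitudes. -/
theorem distSq_mem_slitPlane {c : (Fin 2 → ℂ) × (Fin 2 → ℂ)} {p : Phase} {a D s t : ℝ} (ha : 0 < a)
    (hc : ∀ j, c.2 j ^ 2 / c.1 j = a) (h1 : p.1 = 0) (h3 : p.2.2.1 = 0) (h4 : p.2.2.2 = 0)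
    (hs : s < D) (ht : t ∈ Icc D (2 * π - D)) (hd : ‖p.2.1 0 - t‖ ≤ s) :
    distSq c p ∈ Complex.slitPlane := by
  set z := p.2.1 0 / 2 with hz
  have hlam : ∀ j, planetLam c.2 p j = c.2 j := by
    intro j; fin_cases j <;> simp [planetLam, h1]
  have hpos : ∀ j, planetPos c p j = Complex.exp (Complex.I * planetLon p j) * a := fun j => by
    rw [planetPos, hlam, hc, planetEcc_eq_zero (congrFun h3 j), planetEccT_eq_zero (congrFun h4 j),
      keplerPos_zero, mul_one]
  have hposT : ∀ j, planetPosT c p j = Complex.exp (-(Complex.I * planetLon p j)) * a := fun j => by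
    rw [planetPosT, hlam, hc, planetEcc_eq_zero (congrFun h3 j),
      planetEccT_eq_zero (congrFun h4 j), keplerPosT_zero, mul_one]
  -- the length of a chord of the circle of radius `a`
  have h2 : distSq c p = (2 * a * Complex.sin z) ^ 2 := by
    have e1 : Complex.exp (Complex.I * planetLon p 0) = Complex.exp (z * Complex.I) ^ 2 *
        Complex.exp (Complex.I * p.2.1 1) := by
      rw [← Complex.exp_nat_mul, ← Complex.exp_add]
      congr 1
      simp only [planetLon, Matrix.cons_val_zero, hz]
      push_cast; ring
    have e2 : Complex.exp (-(Complex.I * planetLon p 0)) = Complex.exp (-z * Complex.I) ^ 2 *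
        Complex.exp (-(Complex.I * p.2.1 1)) := by
      rw [← Complex.exp_nat_mul, ← Complex.exp_add]
      congr 1
      simp only [planetLon, Matrix.cons_val_zero, hz]
      push_cast; ring
    have e3 : planetLon p 1 = p.2.1 1 := rfl
    have e4 : Complex.exp (Complex.I * p.2.1 1) * Complex.exp (-(Complex.I * p.2.1 1)) = 1 := by
      rw [← Complex.exp_add]; simp
    have e5 : Complex.exp (z * Complex.I) * Complex.exp (-z * Complex.I) = 1 := by
      rw [← Complex.exp_add]; simp
    rw [distSq, hpos, hpos, hposT, hposT, e1, e2, e3, Complex.sin]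
    linear_combination ((a : ℂ) ^ 2 * (Complex.exp (z * Complex.I) ^ 2 - 1) *
      (Complex.exp (-z * Complex.I) ^ 2 - 1)) * e4 +
      (a : ℂ) ^ 2 * (Complex.exp (z * Complex.I) * Complex.exp (-z * Complex.I) + 1 - 2) * e5 -
      (a : ℂ) ^ 2 * (Complex.exp (-z * Complex.I) - Complex.exp (z * Complex.I)) ^ 2 *
        Complex.I_sq
  rw [h2]
  apply sq_mem_slitPlane
  have hre : |(p.2.1 0).re - t| ≤ s := by
    have := (Complex.abs_re_le_norm _).trans hd
    simpa using this
  rw [abs_le] at hre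
  have hz2 : z.re = (p.2.1 0).re / 2 := by
    rw [hz]; simp
  have hsin : 0 < Real.sin z.re := Real.sin_pos_of_pos_of_lt_pi
    (by rw [hz2]; linarith [ht.1, ht.2]) (by rw [hz2]; linarith [ht.1, ht.2])
  rw [Complex.sin_eq, ← Complex.ofReal_sin, ← Complex.ofReal_cos, ← Complex.ofReal_sinh,
    ← Complex.ofReal_cosh]
  have : (2 * (a : ℂ) * (Real.sin z.re * Real.cosh z.im + Real.cos z.re * Real.sinh z.im *
      Complex.I)).re = 2 * a * (Real.sin z.re * Real.cosh z.im) := by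
    simp [Complex.add_re, Complex.mul_re, Complex.mul_im, -Complex.ofReal_sin,
      -Complex.ofReal_cos, -Complex.ofReal_sinh, -Complex.ofReal_cosh]
  rw [this]
  have := Real.cosh_pos z.im
  positivity

end

/-! ### The perturbation at real points, and its extension to a complex tube -/

noncomputable section

/-- The constants entering the perturbation, as required by `planetPos` and `planetMom`. -/
def ThreeBody.consts (S : ThreeBody) : (Fin 2 → ℂ) × (Fin 2 → ℂ) :=
  (fun j => ((S.redMass j ^ 2 * S.mu j : ℝ) : ℂ), fun j => (S.Lam0 j : ℂ))

/-- Actions of the planets at a real point. -/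
def ThreeBody.Lam (S : ThreeBody) (Z : Fin 2 → ℝ) : Fin 2 → ℝ :=
  ![S.Lam0 0 + Z 0, S.Lam0 1 + Z 1 - Z 0]

/-- Mean longitudes of the planets at a real point. -/
def realLon (zeta : Fin 2 → ℝ) : Fin 2 → ℝ := ![zeta 0 + zeta 1, zeta 1]

theorem planetLam_realPoint (S : ThreeBody) (Z zeta : Fin 2 → ℝ) (x : Fin 2 → ℂ) (j : Fin 2) :
    planetLam S.consts.2 (realPoint Z zeta x) j = (S.Lam Z j : ℝ) := by
  fin_cases j <;> simp [planetLam, ThreeBody.consts, ThreeBody.Lam, realPoint]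

theorem planetLon_realPoint (Z zeta : Fin 2 → ℝ) (x : Fin 2 → ℂ) (j : Fin 2) :
    planetLon (realPoint Z zeta x) j = (realLon zeta j : ℝ) := by
  fin_cases j <;> simp [planetLon, realLon, realPoint]

theorem ThreeBody.isState_iff (S : ThreeBody) (Z zeta : Fin 2 → ℝ) (x rt r : Fin 2 → ℂ) :
    S.IsState Z zeta x rt r ↔ ∀ j, IsKeplerState (S.redMass j) (S.mu j) (S.Lam Z j)
      (realLon zeta j) (x j) (rt j) (r j) := by
  rw [Fin.forall_fin_two]
  rfl

/-- The holomorphic expressions take the right values at real points near circular orbits. -/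
theorem exists_pertFun_realPoint : ∃ δ > 0, ∀ (S : ThreeBody) (Z zeta : Fin 2 → ℝ)
    (x rt r : Fin 2 → ℂ), (∀ j, 0 < S.redMass j) → (∀ j, 0 < S.mu j) → (∀ j, 0 < S.Lam Z j) →
    (∀ j, ‖x j‖ < δ * √(S.Lam Z j)) → S.IsState Z zeta x rt r →
    distSq S.consts (realPoint Z zeta x) = ((‖r 0 - r 1‖ ^ 2 : ℝ) : ℂ) ∧
    S.eps * pertFun S.m0 (S.m 0 * S.m 1) S.consts (realPoint Z zeta x) = S.planetaryP rt r := by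
  obtain ⟨δ, hδ, h⟩ := exists_isKeplerState_formulas
  refine ⟨δ, hδ, ?_⟩
  intro S Z zeta x rt r hmh hmu hL hx hst
  rw [S.isState_iff] at hst
  have hroot : ∀ j, (((S.Lam Z j : ℝ) : ℂ)) ^ (1 / 2 : ℂ) = ((√(S.Lam Z j) : ℝ) : ℂ) := fun j => by
    rw [Real.sqrt_eq_rpow, Complex.ofReal_cpow (hL j).le]; norm_num
  have key := fun j => h _ _ _ _ _ _ _ (hmh j) (hmu j) (hL j) (hst j) (hx j)
    (planetEcc S.consts.2 (realPoint Z zeta x) j) (planetEccT S.consts.2 (realPoint Z zeta x) j)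
    (by rw [planetEcc, eccNorm, planetLam_realPoint, planetLon_realPoint, hroot]; rfl)
    (by
      rw [planetEccT, eccNormT, planetLam_realPoint, planetLon_realPoint, hroot]
      have h1 : (realPoint Z zeta x).2.2.2 j = -Complex.I * star (x j) := rfl
      have h2 : Complex.I * (-Complex.I * star (x j)) = star (x j) := by
        rw [← mul_assoc]; simp
      rw [h1, h2])
  have hp : ∀ j, planetPos S.consts (realPoint Z zeta x) j = r j := fun j => by
    rw [(key j).1, planetPos, planetLam_realPoint, planetLon_realPoint]
    simp [ThreeBody.consts]
  have hpT : ∀ j, planetPosT S.consts (realPoint Z zeta x) j = star (r j) := fun j => by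
    rw [(key j).2.1, planetPosT, planetLam_realPoint, planetLon_realPoint]
    simp [ThreeBody.consts]
  have hm : ∀ j, planetMom S.consts (realPoint Z zeta x) j = rt j := fun j => by
    rw [(key j).2.2.1, planetMom, planetLam_realPoint, planetLon_realPoint]
    simp [ThreeBody.consts]
  have hmT : ∀ j, planetMomT S.consts (realPoint Z zeta x) j = star (rt j) := fun j => by
    rw [(key j).2.2.2, planetMomT, planetLam_realPoint, planetLon_realPoint]
    simp [ThreeBody.consts]
  have hd : distSq S.consts (realPoint Z zeta x) = ((‖r 0 - r 1‖ ^ 2 : ℝ) : ℂ) := by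
    rw [distSq, hp, hp, hpT, hpT, ← star_sub, Complex.star_def, Complex.mul_conj,
      Complex.normSq_eq_norm_sq]
  refine ⟨hd, ?_⟩
  have hrd : (((‖r 0 - r 1‖ ^ 2 : ℝ) : ℂ)) ^ (1 / 2 : ℂ) = ((‖r 0 - r 1‖ : ℝ) : ℂ) := by
    have h1 : (1 / 2 : ℂ) = ((1 / 2 : ℝ) : ℂ) := by norm_num
    rw [h1, ← Complex.ofReal_cpow (by positivity), ← Real.sqrt_eq_rpow,
      Real.sqrt_sq (norm_nonneg _)]
  have hin : (rt 0 * star (rt 1) + star (rt 0) * rt 1) = ((2 * inner ℝ (rt 0) (rt 1) : ℝ) : ℂ) := by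
    rw [Complex.inner]
    apply Complex.ext
    · simp [Complex.mul_re, Complex.mul_im]; ring
    · simp [Complex.mul_re, Complex.mul_im]; ring
  rw [pertFun, hm, hm, hmT, hmT, hin, hd, hrd, ThreeBody.planetaryP]
  push_cast
  congr 2
  rw [mul_div_mul_left _ _ two_ne_zero]

/-- The complex neighbourhood of the circular co-orbital configurations with width `s` in the angles
and `r` in the other variables. -/
def tube (D s r : ℝ) : Set Phase :=
  {p | (∀ j, ‖p.1 j‖ < r) ∧ (∃ t : Fin 2 → ℝ, t 0 ∈ Icc D (2 * π - D) ∧ ∀ j, ‖p.2.1 j - t j‖ ≤ s) ∧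
    (∀ j, ‖p.2.2.1 j‖ < r) ∧ ∀ j, ‖p.2.2.2 j‖ < r}

theorem conjP_mem_tube {D s r : ℝ} {p : Phase} (h : p ∈ tube D s r) : conjP p ∈ tube D s r := by
  obtain ⟨h1, ⟨t, ht, h2⟩, h3, h4⟩ := h
  refine ⟨fun j => ?_, ⟨t, ht, fun j => ?_⟩, fun j => ?_, fun j => ?_⟩
  · simpa [conjP_apply] using h1 j
  · have := h2 j
    rw [← norm_star] at this
    simpa [conjP_apply] using this
  · simpa [conjP_apply] using h4 j
  · simpa [conjP_apply] using h3 j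

theorem differentiableAt_star_conjP {f : Phase → ℂ} {p : Phase}
    (hf : DifferentiableAt ℂ f (conjP p)) : DifferentiableAt ℂ (fun p => star (f (conjP p))) p := by
  have h1 : DifferentiableAt ℂ f (swapLin (star p)) := hf
  have h2 : DifferentiableAt ℂ (fun q => f (swapLin q)) (star p) :=
    h1.comp (star p) swapLin.differentiableAt
  have h3 := h2.star_star
  rwa [star_star] at h3

section Constants

variable (m0 ups : ℝ) (m : Fin 2 → ℝ)

theorem redMass_pos (hm0 : 0 < m0) (hm : ∀ j, 0 < m j) {eps : ℝ} (he : 0 ≤ eps) (j : Fin 2) :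
    0 < (⟨m0, m, ups, eps⟩ : ThreeBody).redMass j := by
  have := hm j
  have h2 : 0 < m0 + eps * m j := by positivity
  simp only [ThreeBody.redMass]
  positivity

theorem mu_pos (hm0 : 0 < m0) (hm : ∀ j, 0 < m j) {eps : ℝ} (he : 0 ≤ eps) (j : Fin 2) :
    0 < (⟨m0, m, ups, eps⟩ : ThreeBody).mu j := by
  have := hm j
  simp only [ThreeBody.mu]
  positivity

theorem semiAxis0_pos (hm0 : 0 < m0) (hm : ∀ j, 0 < m j) (hups : 0 < ups) {eps : ℝ} (he : 0 ≤ eps)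
    (j : Fin 2) : 0 < (⟨m0, m, ups, eps⟩ : ThreeBody).semiAxis0 j := by
  have := mu_pos m0 ups m hm0 hm he j
  simp only [ThreeBody.semiAxis0]
  positivity

theorem Lam0_pos (hm0 : 0 < m0) (hm : ∀ j, 0 < m j) (hups : 0 < ups) {eps : ℝ} (he : 0 ≤ eps)
    (j : Fin 2) : 0 < (⟨m0, m, ups, eps⟩ : ThreeBody).Lam0 j := by
  have := mu_pos m0 ups m hm0 hm he j
  have := redMass_pos m0 ups m hm0 hm he j
  have := semiAxis0_pos m0 ups m hm0 hm hups he j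
  simp only [ThreeBody.Lam0]
  positivity

theorem Lam0_sq (hm0 : 0 < m0) (hm : ∀ j, 0 < m j) (hups : 0 < ups) {eps : ℝ} (he : 0 ≤ eps)
    (j : Fin 2) : (⟨m0, m, ups, eps⟩ : ThreeBody).Lam0 j ^ 2 =
      (⟨m0, m, ups, eps⟩ : ThreeBody).redMass j ^ 2 * (⟨m0, m, ups, eps⟩ : ThreeBody).mu j *
        (⟨m0, m, ups, eps⟩ : ThreeBody).semiAxis0 j := by
  have h1 := mu_pos m0 ups m hm0 hm he j
  have h2 := semiAxis0_pos m0 ups m hm0 hm hups he j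
  rw [ThreeBody.Lam0, mul_pow, Real.sq_sqrt (by positivity)]
  ring

theorem continuousAt_mu (j : Fin 2) :
    ContinuousAt (fun eps => (⟨m0, m, ups, eps⟩ : ThreeBody).mu j) 0 := by
  simp only [ThreeBody.mu]; fun_prop

theorem continuousAt_redMass (hm0 : 0 < m0) (j : Fin 2) :
    ContinuousAt (fun eps => (⟨m0, m, ups, eps⟩ : ThreeBody).redMass j) 0 := by
  simp only [ThreeBody.redMass]
  refine ContinuousAt.div (by fun_prop) (by fun_prop) ?_
  simpa using hm0.ne'

theorem continuousAt_Lam0 (hm0 : 0 < m0) (j : Fin 2) :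
    ContinuousAt (fun eps => (⟨m0, m, ups, eps⟩ : ThreeBody).Lam0 j) 0 := by
  have h1 := continuousAt_mu m0 ups m j
  have h2 := continuousAt_redMass m0 ups m hm0 j
  simp only [ThreeBody.Lam0, ThreeBody.semiAxis0]
  refine h2.mul (ContinuousAt.sqrt (h1.mul ((h1.rpow_const ?_).mul continuousAt_const)))
  left
  simpa [ThreeBody.mu] using hm0.ne'

theorem continuousAt_consts (hm0 : 0 < m0) :
    ContinuousAt (fun eps => (⟨m0, m, ups, eps⟩ : ThreeBody).consts) 0 := by
  refine ContinuousAt.prodMk (continuousAt_pi.2 fun j => ?_) (continuousAt_pi.2 fun j => ?_)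
  · exact Complex.continuous_ofReal.continuousAt.comp
      (((continuousAt_redMass m0 ups m hm0 j).pow 2).mul (continuousAt_mu m0 ups m j))
  · exact Complex.continuous_ofReal.continuousAt.comp (continuousAt_Lam0 m0 ups m hm0 j)

end Constants

theorem conjP_rot (θ : ℝ) (p : Phase) : conjP (rot θ p) = rot θ (conjP p) := by
  have h1 : (starRingEnd ℂ) (Complex.exp (θ * Complex.I)) = Complex.exp (-(θ * Complex.I)) := by
    rw [← Complex.exp_conj]; simp
  have h2 : (starRingEnd ℂ) (Complex.exp (-(θ * Complex.I))) = Complex.exp (θ * Complex.I) := by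
    rw [← Complex.exp_conj]; simp
  rw [rot_apply, rot_apply, conjP_apply, conjP_apply]
  ext j
  · rfl
  · fin_cases j <;> simp [Matrix.vecHead, Matrix.vecTail]
  · simp [h2]; ring
  · simp [h1]; ring

theorem HK_realPoint (S : ThreeBody) {Z zeta : Fin 2 → ℝ} {x rt r : Fin 2 → ℂ}
    (hmh : ∀ j, 0 < S.redMass j) (hmu : ∀ j, 0 < S.mu j) (h : S.IsState Z zeta x rt r) :
    S.HK (realPoint Z zeta x) = (S.planetaryK rt r : ℂ) := by
  rw [S.isState_iff] at h
  have he := fun j => (h j).energy (hmh j) (hmu j)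
  rw [ThreeBody.planetaryK, Fin.sum_univ_two, he, he]
  simp only [ThreeBody.HK, ThreeBody.Lam, realPoint, Phase.act_def, Matrix.cons_val_zero,
    Matrix.cons_val_one]
  push_cast
  ring

/-- The circular co-orbital configurations with zero fast angle and complex longitude difference. -/
def coreSlice (D s : ℝ) : Set Phase :=
  (fun z : ℂ => ((0, ![z, 0], 0, 0) : Phase)) '' cthickening s (Complex.ofReal '' Icc D (2 * π - D))

theorem isCompact_coreSlice (D s : ℝ) : IsCompact (coreSlice D s) := by
  refine IsCompact.image (IsCompact.cthickening (isCompact_Icc.image Complex.continuous_ofReal)) ?_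
  have h : Continuous fun z : ℂ => (![z, 0] : Fin 2 → ℂ) := by
    rw [continuous_pi_iff]
    intro j
    fin_cases j
    · exact continuous_id
    · exact continuous_const
  fun_prop

/-- The perturbation is holomorphic and bounded near the circular co-orbital configurations, for
masses of the planets close to zero.  It is enough to consider configurations with zero fast angle,
which form a compact set. -/
theorem exists_bound_pertFun {m0 ups : ℝ} {m : Fin 2 → ℝ} (hm0 : 0 < m0) (hm : ∀ j, 0 < m j)
    (hups : 0 < ups) {D s : ℝ} (hs : 0 < s) (hsD : s < D) :
    ∃ δ > 0, ∃ M > 0,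
      ∀ v ∈ cthickening δ ({(⟨m0, m, ups, 0⟩ : ThreeBody).consts} ×ˢ coreSlice D s),
      AnalyticAt ℂ (fun v : ((Fin 2 → ℂ) × (Fin 2 → ℂ)) × Phase =>
        pertFun m0 (m 0 * m 1) v.1 v.2) v ∧ distSq v.1 v.2 ≠ 0 ∧
      ‖pertFun m0 (m 0 * m 1) v.1 v.2‖ ≤ M := by
  set c0 := (⟨m0, m, ups, 0⟩ : ThreeBody).consts with hc0
  have hK : IsCompact ({c0} ×ˢ coreSlice D s) := isCompact_singleton.prod (isCompact_coreSlice D s)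
  have hmu : ∀ j, (⟨m0, m, ups, 0⟩ : ThreeBody).mu j = m0 := fun j => by simp [ThreeBody.mu]
  have hev : ∀ v ∈ {c0} ×ˢ coreSlice D s, v ∈ interior {v : ((Fin 2 → ℂ) × (Fin 2 → ℂ)) × Phase |
      AnalyticAt ℂ (fun v : ((Fin 2 → ℂ) × (Fin 2 → ℂ)) × Phase =>
        pertFun m0 (m 0 * m 1) v.1 v.2) v ∧ distSq v.1 v.2 ≠ 0} := by
    rintro ⟨c, q⟩ ⟨hc, z, hz, rfl⟩
    rw [mem_singleton_iff] at hc
    simp only at hc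
    subst hc
    rw [(isCompact_Icc.image Complex.continuous_ofReal).cthickening_eq_biUnion_closedBall hs.le]
      at hz
    simp only [mem_image, iUnion_exists, biUnion_and', iUnion_iUnion_eq_right, mem_iUnion,
      mem_closedBall, exists_prop, dist_eq_norm] at hz
    obtain ⟨t, ht, hzt⟩ := hz
    have hk : ∀ j, c0.1 j ≠ 0 := fun j => by
      have h1 := redMass_pos m0 ups m hm0 hm le_rfl j
      have h2 := mu_pos m0 ups m hm0 hm le_rfl j
      simp only [hc0, ThreeBody.consts]
      exact_mod_cast (by positivity)
    have hlam : ∀ j, planetLam c0.2 ((0, ![z, 0], 0, 0) : Phase) j = c0.2 j := fun j => by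
      fin_cases j <;> simp [planetLam]
    have hL : ∀ j, planetLam c0.2 ((0, ![z, 0], 0, 0) : Phase) j ∈ Complex.slitPlane := fun j => by
      rw [hlam, hc0]
      exact Complex.ofReal_mem_slitPlane.2 (Lam0_pos m0 ups m hm0 hm hups le_rfl j)
    have ha := semiAxis0_pos m0 ups m hm0 hm hups le_rfl 0
    have hd : distSq c0 ((0, ![z, 0], 0, 0) : Phase) ∈ Complex.slitPlane := by
      refine distSq_mem_slitPlane ha (fun j => ?_) rfl rfl rfl hsD ht hzt
      have h1 := redMass_pos m0 ups m hm0 hm le_rfl j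
      have h2 := mu_pos m0 ups m hm0 hm le_rfl j
      have h3 := Lam0_sq m0 ups m hm0 hm hups le_rfl j
      have h4 : (⟨m0, m, ups, 0⟩ : ThreeBody).semiAxis0 j =
          (⟨m0, m, ups, 0⟩ : ThreeBody).semiAxis0 0 := by simp only [ThreeBody.semiAxis0, hmu]
      simp only [hc0, ThreeBody.consts]
      rw [← Complex.ofReal_pow, ← Complex.ofReal_div, h3, ← h4,
        mul_div_cancel_left₀ _ (by positivity)]
    rw [mem_interior_iff_mem_nhds]
    have h1 := analyticAt_pertFun (v := (c0, ((0, ![z, 0], 0, 0) : Phase))) m0 (m 0 * m 1)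
      hk hL rfl rfl hd
    have h2 := analyticAt_distSq (v := (c0, ((0, ![z, 0], 0, 0) : Phase))) hk hL rfl rfl
    filter_upwards [h1.eventually_analyticAt, h2.continuousAt.eventually_ne
      (Complex.slitPlane_ne_zero hd)] with w hw1 hw2 using ⟨hw1, hw2⟩
  obtain ⟨δ, hδ, hsub⟩ := hK.exists_cthickening_subset_open isOpen_interior hev
  have hsub' := hsub.trans interior_subset
  obtain ⟨M, hM⟩ := (hK.cthickening (r := δ)).exists_bound_of_continuousOn
    (f := fun v : ((Fin 2 → ℂ) × (Fin 2 → ℂ)) × Phase => pertFun m0 (m 0 * m 1) v.1 v.2)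
    fun v hv => (hsub' hv).1.continuousAt.continuousWithinAt
  exact ⟨δ, hδ, |M| + 1, by positivity, fun v hv => ⟨(hsub' hv).1, (hsub' hv).2,
    (hM v hv).trans ((le_abs_self M).trans (by linarith))⟩⟩

/-- The perturbation extends holomorphically to a tube of fixed size around the circular co-orbital
configurations, and is there of the order of `eps`. -/
theorem exists_perturbation {m0 ups : ℝ} {m : Fin 2 → ℝ} (hm0 : 0 < m0) (hm : ∀ j, 0 < m j)
    (hups : 0 < ups) {D s : ℝ} (hs : 0 < s) (hsD : s < D) :
    ∃ r > 0, ∃ M > 0, ∃ e0 > 0, ∀ eps, 0 < eps → eps < e0 →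
    ∃ P : Phase → ℂ, (∀ p ∈ tube D s r, DifferentiableAt ℂ P p) ∧
      (∀ p ∈ tube D s r, ‖P p‖ ≤ M * eps) ∧ IsSym P (tube D s r) ∧
      ∀ (Z zeta : Fin 2 → ℝ) (x : Fin 2 → ℂ), realPoint Z zeta x ∈ tube D s r →
        (∃ rt r, (⟨m0, m, ups, eps⟩ : ThreeBody).IsState Z zeta x rt r) ∧
        ∀ rt r, (⟨m0, m, ups, eps⟩ : ThreeBody).IsState Z zeta x rt r → r 0 ≠ r 1 ∧
          P (realPoint Z zeta x) = ((⟨m0, m, ups, eps⟩ : ThreeBody).planetaryP rt r : ℂ) ∧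
          (⟨m0, m, ups, eps⟩ : ThreeBody).HK (realPoint Z zeta x) + P (realPoint Z zeta x) =
            (((⟨m0, m, ups, eps⟩ : ThreeBody).planetaryK rt r +
              (⟨m0, m, ups, eps⟩ : ThreeBody).planetaryP rt r : ℝ) : ℂ) := by
  obtain ⟨δ₁, hδ₁, M, hM, hb⟩ := exists_bound_pertFun hm0 hm hups hs hsD
  obtain ⟨δ₂, hδ₂, hreal⟩ := exists_pertFun_realPoint
  have hL0 := Lam0_pos m0 ups m hm0 hm hups le_rfl
  obtain ⟨l, hl, hlL⟩ : ∃ l > 0, ∀ j, l ≤ (⟨m0, m, ups, 0⟩ : ThreeBody).Lam0 j :=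
    ⟨_, lt_min (hL0 0) (hL0 1), Fin.forall_fin_two.2 ⟨min_le_left _ _, min_le_right _ _⟩⟩
  have hl4 : 0 < √(l / 4) := Real.sqrt_pos.2 (by positivity)
  obtain ⟨r, hr, hr1, hr2, hr3, hr4⟩ : ∃ r > 0, r ≤ δ₁ * Real.exp (-s) ∧ r ≤ l / 8 ∧
      r ≤ δ₂ * √(l / 4) ∧ r ≤ √(l / 4) := by
    refine ⟨min (min (δ₁ * Real.exp (-s)) (l / 8)) (min (δ₂ * √(l / 4)) (√(l / 4))), by positivity,
      ?_, ?_, ?_, ?_⟩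
    · exact (min_le_left _ _).trans (min_le_left _ _)
    · exact (min_le_left _ _).trans (min_le_right _ _)
    · exact (min_le_right _ _).trans (min_le_left _ _)
    · exact (min_le_right _ _).trans (min_le_right _ _)
  have hev : ∀ᶠ eps in 𝓝 (0 : ℝ),
      dist (⟨m0, m, ups, eps⟩ : ThreeBody).consts (⟨m0, m, ups, 0⟩ : ThreeBody).consts < δ₁ ∧
      ∀ j, l / 2 < (⟨m0, m, ups, eps⟩ : ThreeBody).Lam0 j := by
    refine ((continuousAt_consts m0 ups m hm0).eventually (ball_mem_nhds _ hδ₁)).and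
      (Filter.eventually_all.2 fun j => (continuousAt_Lam0 m0 ups m hm0 j).eventually
        (lt_mem_nhds ?_))
    have := hlL j
    linarith
  obtain ⟨e0, he0, hev⟩ := Metric.eventually_nhds_iff_ball.1 hev
  refine ⟨r, hr, M, hM, e0, he0, fun eps heps heps0 => ?_⟩
  obtain ⟨hc, hLe⟩ := hev eps (by
    rw [mem_ball_zero_iff, Real.norm_eq_abs, abs_of_pos heps]; exact heps0)
  set S : ThreeBody := ⟨m0, m, ups, eps⟩ with hS
  -- rotating back by the fast angle, of imaginary part at most `s`, costs a factor `exp s`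
  have hmem : ∀ p ∈ tube D s r, (S.consts, derot p) ∈
      cthickening δ₁ ({(⟨m0, m, ups, 0⟩ : ThreeBody).consts} ×ˢ coreSlice D s) := by
    rintro p ⟨h1, ⟨t, ht, h2⟩, h3, h4⟩
    have him : |(p.2.1 1).im| ≤ s := by
      have := (Complex.abs_im_le_norm _).trans (h2 1)
      simpa using this
    rw [abs_le] at him
    have hrs : Real.exp s * r ≤ δ₁ := by
      calc _ ≤ Real.exp s * (δ₁ * Real.exp (-s)) := by gcongr
        _ = δ₁ * (Real.exp s * Real.exp (-s)) := by ring
        _ = δ₁ := by rw [← Real.exp_add]; simp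
    have hrδ : r ≤ δ₁ := by
      have := Real.one_le_exp hs.le
      nlinarith
    refine mem_cthickening_of_dist_le _ ((⟨m0, m, ups, 0⟩ : ThreeBody).consts,
      ((0, ![p.2.1 0, 0], 0, 0) : Phase)) _ _ ⟨rfl, mem_image_of_mem _
        (mem_cthickening_of_dist_le _ (t 0 : ℂ) _ _ (mem_image_of_mem _ ht)
          (by rw [dist_eq_norm]; exact h2 0))⟩ ?_
    rw [Prod.dist_eq]
    refine max_le hc.le ?_
    rw [dist_eq_norm, Phase.norm_le_iff]
    simp only [derot, Phase.act_def, Phase.ang_def, Phase.ecc_def, Phase.eccT_def, Prod.fst_sub,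
      Prod.snd_sub, sub_zero, sub_self, norm_zero]
    refine ⟨?_, hδ₁.le, ?_, ?_⟩ <;> rw [pi_norm_le_iff_of_nonneg hδ₁.le] <;> intro j
    · exact (h1 j).le.trans hrδ
    · rw [Pi.smul_apply, norm_smul, Complex.norm_exp]
      refine le_trans ?_ hrs
      gcongr
      · simp only [Complex.neg_re, Complex.mul_re, Complex.I_re, Complex.I_im]; linarith
      · exact (h3 j).le
    · rw [Pi.smul_apply, norm_smul, Complex.norm_exp]
      refine le_trans ?_ hrs
      gcongr
      · simp only [Complex.mul_re, Complex.I_re, Complex.I_im]; linarith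
      · exact (h4 j).le
  obtain ⟨Q, hQ⟩ : ∃ Q : Phase → ℂ, Q = fun p => eps * pertFun m0 (m 0 * m 1) S.consts (derot p) :=
    ⟨_, rfl⟩
  have hQd : ∀ p ∈ tube D s r, DifferentiableAt ℂ Q p := fun p hp => by
    rw [hQ]
    refine DifferentiableAt.const_mul ?_ _
    exact DifferentiableAt.comp (g := fun v : ((Fin 2 → ℂ) × (Fin 2 → ℂ)) × Phase =>
      pertFun m0 (m 0 * m 1) v.1 v.2) (f := fun p => (S.consts, derot p)) p
      (hb _ (hmem p hp)).1.differentiableAt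
      ((differentiableAt_const _).prodMk (differentiable_derot p))
  have hQb : ∀ p ∈ tube D s r, ‖Q p‖ ≤ M * eps := fun p hp => by
    rw [hQ, norm_mul, Complex.norm_of_nonneg heps.le, mul_comm]
    have := (hb _ (hmem p hp)).2.2
    gcongr
  -- symmetrization makes the extension real on all real points of the tube
  refine ⟨fun p => (Q p + star (Q (conjP p))) / 2, fun p hp => ?_, fun p hp => ?_,
    ⟨fun p hp θ => ?_, fun p hp => ?_⟩, fun Z zeta x hp => ?_⟩
  · have h : DifferentiableAt ℂ (fun p => (Q p + star (Q (conjP p))) * (2 : ℂ)⁻¹) p :=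
      DifferentiableAt.mul_const ((hQd p hp).fun_add
        (differentiableAt_star_conjP (hQd _ (conjP_mem_tube hp)))) _
    simpa only [div_eq_mul_inv] using h
  · have h1 := hQb p hp
    have h2 := hQb _ (conjP_mem_tube hp)
    rw [norm_div, Complex.norm_ofNat, div_le_iff₀ two_pos]
    refine (norm_add_le _ _).trans ?_
    rw [norm_star]
    linarith
  · have hr : ∀ p, Q (rot θ p) = Q p := fun p => by rw [hQ]; simp only [derot_rot]
    simp only [conjP_rot, hr]
  · rw [conjP_conjP]
    simp [add_comm]
  have hmh := redMass_pos m0 ups m hm0 hm heps.le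
  have hmu := mu_pos m0 ups m hm0 hm heps.le
  have hZ : ∀ j, |Z j| < r := fun j => by simpa [realPoint] using hp.1 j
  have hLam : ∀ j, l / 4 ≤ S.Lam Z j := by
    have z0 := abs_lt.1 (hZ 0)
    have z1 := abs_lt.1 (hZ 1)
    have l0 := hLe 0
    have l1 := hLe 1
    intro j
    fin_cases j
    · change l / 4 ≤ S.Lam0 0 + Z 0; linarith
    · change l / 4 ≤ S.Lam0 1 + Z 1 - Z 0; linarith
  have hLpos : ∀ j, 0 < S.Lam Z j := fun j => lt_of_lt_of_le (by positivity) (hLam j)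
  have hx : ∀ j, ‖x j‖ < r := fun j => hp.2.2.1 j
  refine ⟨?_, fun rt r' hst => ?_⟩
  · have hk := fun j => exists_isKeplerState (lam := realLon zeta j) (x := x j) (hmh j) (hmu j)
      (hLpos j) (by
        have h1 : ‖x j‖ ^ 2 < √(l / 4) ^ 2 :=
          pow_lt_pow_left₀ ((hx j).trans_le hr4) (norm_nonneg _) two_ne_zero
        rw [Real.sq_sqrt (by positivity)] at h1
        exact h1.trans_le (hLam j))
    choose rt r' h using hk
    exact ⟨rt, r', (S.isState_iff _ _ _ _ _).2 h⟩
  · obtain ⟨hd, hP⟩ := hreal S Z zeta x rt r' hmh hmu hLpos (fun j =>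
      (hx j).trans_le (hr3.trans (by gcongr; exact hLam j))) hst
    have hQp : Q (realPoint Z zeta x) = (S.planetaryP rt r' : ℂ) := by
      rw [hQ, ← hP]; simp only [pertFun_derot]; rfl
    have hPp : (Q (realPoint Z zeta x) + star (Q (conjP (realPoint Z zeta x)))) / 2 =
        (S.planetaryP rt r' : ℂ) := by
      rw [(mem_realPoints_iff _).1 ⟨Z, zeta, x, rfl⟩, hQp, Complex.star_def, Complex.conj_ofReal]
      ring
    refine ⟨?_, hPp, ?_⟩
    · have h1 := (hb _ (hmem _ hp)).2.1
      simp only [distSq_derot, hd] at h1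
      intro h2
      simp [h2] at h1
    · simp only [hPp, HK_realPoint S hmh hmu hst]
      push_cast
      rfl

end

/-! ### Averaging up to an exponentially small remainder -/

noncomputable section

variable {D s : ℝ} {p q : Phase}

theorem eventually_mul_le (A : ℝ) {B : ℝ} (hB : 0 < B) : ∀ᶠ μ in 𝓝[>] (0 : ℝ), A * μ ≤ B := by
  have h : Tendsto (fun μ : ℝ => A * μ) (𝓝[>] 0) (𝓝 0) := by
    have : Tendsto (fun μ : ℝ => A * μ) (𝓝 0) (𝓝 (A * 0)) := (continuous_const_mul A).tendsto 0
    rw [mul_zero] at this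
    exact this.mono_left nhdsWithin_le_nhds
  filter_upwards [h (Iio_mem_nhds hB)] with μ hμ using le_of_lt hμ

/-- The splitting of the perturbation into its average and its oscillating part. -/
theorem isNormalForm_init {σ X Y Ck M : ℝ} (hσ : 0 < σ) (hYX : Y ≤ X) (hM : 0 ≤ M)
    {k P : Phase → ℂ} (hkd : DifferentiableOn ℂ k (nbhd D (2 * σ))) (hks : IsSym k (nbhd D (2 * σ)))
    (hki : ∀ p ∈ nbhd D (2 * σ), ∀ t : ℝ, k (p + (t : ℂ) • fastDir) = k p)
    (hkb : ∀ p ∈ nbhd D (2 * σ), ‖k p‖ ≤ Ck * X)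
    (hPd : DifferentiableOn ℂ P (nbhd D (2 * σ))) (hPs : IsSym P (nbhd D (2 * σ)))
    (hPb : ∀ p ∈ nbhd D (2 * σ), ‖P p‖ ≤ M * Y) :
    IsNormalForm D (2 * σ - σ / 2) ((Ck + M) / (σ / 2) * X) (2 * M * Y)
      (fun p => k p + shiftAvg P p) (fun p => P p - shiftAvg P p) := by
  have hsub : nbhd D (2 * σ - σ / 2) ⊆ nbhd D (2 * σ) := nbhd_mono (by linarith)
  have hper : ∀ p ∈ nbhd D (2 * σ), P (p + ((2 * π : ℝ) : ℂ) • fastDir) = P p :=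
    fun p hp => hPs.periodic hp
  have hAd := differentiableOn_shiftAvg hPd
  have hAi : ∀ p ∈ nbhd D (2 * σ), ∀ t : ℝ, shiftAvg P (p + (t : ℂ) • fastDir) = shiftAvg P p :=
    fun p hp t => shiftAvg_add hper hp t
  have hAb : ∀ p ∈ nbhd D (2 * σ), ‖shiftAvg P p‖ ≤ M * Y := fun p hp => norm_shiftAvg_le hPb hp
  exact {
    diff_g := (hkd.add hAd).mono hsub
    diff_R := (hPd.sub hAd).mono hsub
    sym_g := (hks.add hPs.shiftAvg).mono hsub
    sym_R := (hPs.sub hPs.shiftAvg).mono hsub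
    inv_g := fun p hp t => by rw [hki p (hsub hp), hAi p (hsub hp)]
    avg_R := fun p hp => by
      rw [shiftAvg_sub hPd.continuousOn hAd.continuousOn (hsub hp),
        shiftAvg_of_invariant fun t => hAi p (hsub hp) t, sub_self]
    fderiv_g_le := fun p hp => by
      have := norm_fderiv_le_of_nbhd (f := fun p => k p + shiftAvg P p) (M := (Ck + M) * X)
        (half_pos hσ) (hkd.add hAd) (fun p hp => (norm_add_le _ _).trans (by
          have h1 := hkb p hp
          have h2 := hAb p hp
          nlinarith)) hp
      calc _ ≤ _ := this
        _ = _ := by ring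
    R_le := fun p hp => (norm_sub_le _ _).trans (by
      have h1 := hPb p (hsub hp)
      have h2 := hAb p (hsub hp)
      linarith) }

set_option maxHeartbeats 1000000 in
/-- Averaging in two stages: one step with fixed loss of domain, which makes the remainder smaller
by a factor `X`, then `N` steps with losses proportional to `1 / N`, each of which divides the
remainder by `exp 1`. -/
theorem exists_averaging {σ υ Ck M : ℝ} (hσ : 0 < σ) (hυ : 0 < υ) (hCk : 0 < Ck)
    (hM : 0 < M) : ∃ μ > 0, ∃ C > 0, ∀ (D X Y : ℝ) (N : ℕ), 0 < X → 0 < Y → Y ≤ X → 1 ≤ N →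
    X * N ≤ μ → ∀ k P : Phase → ℂ, DifferentiableOn ℂ k (nbhd D (2 * σ)) →
    IsSym k (nbhd D (2 * σ)) →
    (∀ p ∈ nbhd D (2 * σ), ∀ t : ℝ, k (p + (t : ℂ) • fastDir) = k p) →
    (∀ p ∈ nbhd D (2 * σ), ‖k p‖ ≤ Ck * X) →
    DifferentiableOn ℂ P (nbhd D (2 * σ)) → IsSym P (nbhd D (2 * σ)) →
    (∀ p ∈ nbhd D (2 * σ), ‖P p‖ ≤ M * Y) →
    ∃ (U : Phase → Phase) (g R : Phase → ℂ) (κ : ℝ),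
      C * Y ≤ σ / 20 ∧ IsNearIdentity D σ (3 / 2 * σ) (C * Y) U ∧
      IsNormalForm D σ κ (C * Y * Real.exp (-N)) g R ∧
      (∀ p ∈ nbhd D σ, ‖g p - (k p + shiftAvg P p)‖ ≤ C * Y ^ 2) ∧
      ∀ p ∈ nbhd D σ, υ * (U p).1 1 + k (U p) + P (U p) = υ * p.1 1 + g p + R p := by
  obtain ⟨c, hc⟩ : ∃ c, c = 4 * π / υ := ⟨_, rfl⟩
  obtain ⟨δ, hδ⟩ : ∃ δ, δ = σ / 16 := ⟨_, rfl⟩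
  have hc0 : 0 < c := by rw [hc]; positivity
  have hδ0 : 0 < δ := by rw [hδ]; positivity
  obtain ⟨K0, hK0⟩ : ∃ K0, K0 = (Ck + M) / (σ / 2) := ⟨_, rfl⟩
  obtain ⟨K1, hK1⟩ : ∃ K1, K1 = 2 * M := ⟨_, rfl⟩
  have hK00 : 0 < K0 := by rw [hK0]; positivity
  have hK10 : 0 < K1 := by rw [hK1]; positivity
  obtain ⟨K2, hK2⟩ : ∃ K2, K2 = 2 * (2 * K0 * c / δ + K1 * c / δ ^ 2) := ⟨_, rfl⟩
  have hK20 : 0 < K2 := by rw [hK2]; positivity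
  obtain ⟨K3, hK3⟩ : ∃ K3, K3 = K1 ^ 2 * (c / δ ^ 2 + 4 * K0 * c ^ 2 / δ ^ 3) := ⟨_, rfl⟩
  have hK30 : 0 < K3 := by rw [hK3]; positivity
  obtain ⟨K4, hK4⟩ : ∃ K4, K4 = K2 * K1 := ⟨_, rfl⟩
  have hK40 : 0 < K4 := by rw [hK4]; positivity
  obtain ⟨K5, hK5⟩ : ∃ K5, K5 = K4 ^ 2 * (c / δ ^ 2 + 8 * K0 * c ^ 2 / δ ^ 3) := ⟨_, rfl⟩
  have hK50 : 0 < K5 := by rw [hK5]; positivity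
  obtain ⟨C, hC⟩ : ∃ C, C = (c * K1 / δ + 2 * (c * K4 / δ)) + (K3 + 2 * K5) + K4 := ⟨_, rfl⟩
  have hC0 : 0 < C := by rw [hC]; positivity
  obtain ⟨μ, hμ0, m0, m1, m2, m3, m4, m5, m6, m7⟩ : ∃ μ > 0, (1 * μ ≤ 1) ∧ c * K1 * μ ≤ δ ^ 2 / 4 ∧
      K2 * μ ≤ 1 / 2 ∧ 2 * K3 / δ * μ ≤ K0 ∧ c * K4 * μ ≤ δ ^ 2 / 4 ∧
      2 * (4 * K0 * c / δ + K4 * c / δ ^ 2) * μ ≤ Real.exp (-1) ∧ 2 * K5 / δ * μ ≤ 2 * K0 ∧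
      C * μ ≤ σ / 20 := by
    have hev := eventually_mul_le 1 one_pos |>.and <| eventually_mul_le (c * K1)
      (show 0 < δ ^ 2 / 4 by positivity) |>.and <| eventually_mul_le K2 one_half_pos |>.and <|
      eventually_mul_le (2 * K3 / δ) hK00 |>.and <| eventually_mul_le (c * K4)
      (show 0 < δ ^ 2 / 4 by positivity) |>.and <|
      eventually_mul_le (2 * (4 * K0 * c / δ + K4 * c / δ ^ 2)) (Real.exp_pos (-1)) |>.and <|
      eventually_mul_le (2 * K5 / δ) (show 0 < 2 * K0 by positivity) |>.and <|
      eventually_mul_le C (show 0 < σ / 20 by positivity)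
    obtain ⟨μ, h1, h2⟩ := (hev.and self_mem_nhdsWithin).exists
    exact ⟨μ, h2, h1⟩
  refine ⟨μ, hμ0, C, hC0, ?_⟩
  intro D X Y N hX hY hYX hN hXN k P hkd hks hki hkb hPd hPs hPb
  have hN1 : (1 : ℝ) ≤ N := by exact_mod_cast hN
  have hN0 : (0 : ℝ) < N := by linarith
  have hXμ : X ≤ μ := by nlinarith
  have hYμ : Y ≤ μ := hYX.trans hXμ
  have hμ1 : μ ≤ 1 := by linarith
  have hX1 : X ≤ 1 := hXμ.trans hμ1
  have hinit := isNormalForm_init hσ hYX hM.le hkd hks hki hkb hPd hPs hPb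
  rw [← hK0, ← hK1] at hinit
  -- one step of fixed loss takes the remainder from `Y` to `X * Y`; without it, the quadratic
  -- remainders of steps of loss `4 * δ / N` would require a bound on `Y * N ^ 2`
  obtain ⟨a1, ha1'⟩ : ∃ a1, a1 = (K1 * Y) ^ 2 * (c / δ ^ 2 + 4 * (K0 * X) * c ^ 2 / δ ^ 3) :=
    ⟨_, rfl⟩
  have ha10 : 0 ≤ a1 / δ := by rw [ha1']; positivity
  have ha1 : a1 ≤ K3 * Y ^ 2 := by
    rw [ha1', hK3]
    have : 4 * (K0 * X) * c ^ 2 / δ ^ 3 ≤ 4 * (K0 * 1) * c ^ 2 / δ ^ 3 := by gcongr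
    rw [mul_one] at this
    calc _ ≤ (K1 * Y) ^ 2 * (c / δ ^ 2 + 4 * K0 * c ^ 2 / δ ^ 3) := by gcongr
      _ = _ := by ring
  have hst1 : 2 * a1 / δ ≤ K0 * X := by
    calc _ ≤ 2 * (K3 * Y ^ 2) / δ := by gcongr
      _ = (2 * K3 / δ * Y) * Y := by ring
      _ ≤ (2 * K3 / δ * μ) * X := by gcongr
      _ ≤ _ := by gcongr
  obtain ⟨U1, g1, R1, hU1, hN1', hg1, hH1⟩ := hinit.iterate (υ := υ) (δ := δ) (c := c) (q := K2 * X)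
    hυ hδ0 (by positivity) (by positivity) hc (by positivity)
    ((mul_le_mul_of_nonneg_left hXμ hK20.le).trans m2)
    (by
      calc c * (K1 * Y) = c * K1 * Y := by ring
        _ ≤ c * K1 * μ := by gcongr
        _ ≤ _ := m1)
    (by
      rw [hK2]
      calc 2 * (2 * (K0 * X) * c / δ + K1 * Y * c / δ ^ 2) ≤
            2 * (2 * (K0 * X) * c / δ + K1 * X * c / δ ^ 2) := by gcongr
        _ = _ := by ring)
    ha1' hst1 1
  have hs1 : 2 * σ - σ / 2 - 4 * (1 : ℕ) * δ = 5 / 4 * σ := by rw [hδ]; push_cast; ring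
  rw [hs1] at hU1 hN1' hg1 hH1
  have hsc : (2 : ℝ) - 2 / 2 ^ 1 = 1 := by norm_num
  rw [hsc, one_mul] at hU1 hN1' hg1
  -- `N` steps of loss `4 * δ / N` and ratio `exp (-1)`, as `X * N` is small
  have hN2 := hN1'.mono (le_refl (5 / 4 * σ)) (κ' := 2 * K0 * X) (r' := K4 * (X * Y))
    (by
      rw [mul_div_assoc] at hst1
      linarith)
    (by rw [pow_one, hK4]; exact le_of_eq (by ring))
  have hXN1 : X * N ≤ 1 := hXN.trans hμ1
  obtain ⟨a2, ha2'⟩ : ∃ a2, a2 = (K4 * (X * Y)) ^ 2 *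
      (c / (δ / N) ^ 2 + 4 * (2 * K0 * X) * c ^ 2 / (δ / N) ^ 3) := ⟨_, rfl⟩
  have ha20 : 0 ≤ a2 := by rw [ha2']; positivity
  have ha2 : a2 ≤ K5 * (Y ^ 2 * (X * N) ^ 2) := by
    rw [ha2']
    have h1 : 8 * (K0 * (X * N)) * c ^ 2 / δ ^ 3 ≤ 8 * (K0 * 1) * c ^ 2 / δ ^ 3 := by gcongr
    rw [mul_one] at h1
    calc (K4 * (X * Y)) ^ 2 * (c / (δ / N) ^ 2 + 4 * (2 * K0 * X) * c ^ 2 / (δ / N) ^ 3) =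
          K4 ^ 2 * (Y ^ 2 * (X * N) ^ 2) * (c / δ ^ 2 + 8 * (K0 * (X * N)) * c ^ 2 / δ ^ 3) := by
          field_simp
          ring
      _ ≤ K4 ^ 2 * (Y ^ 2 * (X * N) ^ 2) * (c / δ ^ 2 + 8 * K0 * c ^ 2 / δ ^ 3) := by gcongr
      _ = _ := by rw [hK5]; ring
  have hYN : Y * N ≤ X * N := by gcongr
  have hst2 : 2 * a2 / (δ / N) ≤ 2 * K0 * X := by
    calc _ ≤ 2 * (K5 * (Y ^ 2 * (X * N) ^ 2)) / (δ / N) := by gcongr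
      _ = 2 * K5 / δ * (Y * ((Y * N) * (X * N) ^ 2)) := by field_simp
      _ ≤ 2 * K5 / δ * (X * (μ * 1 ^ 2)) := by
        have := hYN.trans hXN
        gcongr
      _ = (2 * K5 / δ * μ) * X := by ring
      _ ≤ _ := by gcongr
  obtain ⟨U2, g2, R2, hU2, hN2', hg2, hH2⟩ := hN2.iterate (υ := υ) (δ := δ / N) (c := c)
    (q := Real.exp (-1)) hυ (by positivity) (by positivity) (by positivity) hc (Real.exp_pos _).le
    (by
      rw [Real.exp_neg, inv_le_comm₀ (Real.exp_pos 1) (by norm_num)]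
      have := Real.add_one_le_exp 1
      norm_num at this ⊢
      linarith)
    (by
      have h1 : X * N * (Y * N) ≤ μ * 1 := by
        have := hYN.trans hXN1
        gcongr
      calc c * (K4 * (X * Y)) = c * K4 * (X * N * (Y * N)) / N ^ 2 := by field_simp
        _ ≤ c * K4 * (μ * 1) / N ^ 2 := by gcongr
        _ ≤ (δ ^ 2 / 4) / N ^ 2 := by rw [mul_one]; gcongr
        _ = _ := by ring)
    (by
      have h1 : X * N * (Y * N) ≤ μ * 1 := by
        have := hYN.trans hXN1
        gcongr
      calc 2 * (2 * (2 * K0 * X) * c / (δ / N) + K4 * (X * Y) * c / (δ / N) ^ 2) =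
            2 * (4 * K0 * c / δ * (X * N) + K4 * c / δ ^ 2 * (X * N * (Y * N))) := by
            field_simp
            ring
        _ ≤ 2 * (4 * K0 * c / δ * μ + K4 * c / δ ^ 2 * (μ * 1)) := by gcongr
        _ = 2 * (4 * K0 * c / δ + K4 * c / δ ^ 2) * μ := by ring
        _ ≤ _ := m5)
    ha2' hst2 N
  have hs2 : 5 / 4 * σ - 4 * N * (δ / N) = σ := by rw [hδ]; field_simp; ring
  rw [hs2] at hU2 hN2' hg2 hH2
  have hfac : (2 : ℝ) - 2 / 2 ^ N ≤ 2 := by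
    have : (0 : ℝ) < 2 / 2 ^ N := by positivity
    linarith
  have hs3 : 2 * σ - σ / 2 = 3 / 2 * σ := by ring
  rw [hs3] at hU1
  refine ⟨fun p => U1 (U2 p), g2, R2, _, ?_, (hU1.comp hU2).mono le_rfl le_rfl ?_,
    hN2'.mono le_rfl le_rfl ?_, fun p hp => ?_, fun p hp => ?_⟩
  · calc C * Y ≤ C * μ := by gcongr
      _ ≤ _ := m7
  · have h1 : (2 - 2 / 2 ^ N) * (c * (K4 * (X * Y)) / (δ / N)) ≤ 2 * (c * K4 / δ * Y) := by
      calc (2 - 2 / 2 ^ N) * (c * (K4 * (X * Y)) / (δ / N)) ≤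
            2 * (c * (K4 * (X * Y)) / (δ / N)) := by gcongr
        _ = 2 * (c * K4 / δ * Y * (X * N)) := by field_simp
        _ ≤ 2 * (c * K4 / δ * Y * 1) := by gcongr
        _ = _ := by ring
    have h2 : 0 ≤ (K3 + 2 * K5 + K4) * Y := by positivity
    calc _ ≤ c * (K1 * Y) / δ + 2 * (c * K4 / δ * Y) := by gcongr
      _ ≤ c * (K1 * Y) / δ + 2 * (c * K4 / δ * Y) + (K3 + 2 * K5 + K4) * Y := by linarith
      _ = C * Y := by rw [hC]; ring
  · have h1 : Real.exp (-1) ^ N = Real.exp (-N) := by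
      rw [← Real.exp_nat_mul]; congr 1; ring
    rw [h1]
    have h2 : K4 ≤ C := by
      rw [hC]
      have : 0 ≤ (c * K1 / δ + 2 * (c * K4 / δ)) + (K3 + 2 * K5) := by positivity
      linarith
    calc Real.exp (-N) * (K4 * (X * Y)) ≤ Real.exp (-N) * (C * (1 * Y)) := by gcongr
      _ = _ := by ring
  · have h1 := hg1 p (nbhd_mono (by linarith) hp)
    have h2 := hg2 p hp
    have h3 : g2 p - (k p + shiftAvg P p) = (g2 p - g1 p) + (g1 p - (k p + shiftAvg P p)) := by ring
    have h4 : Y ^ 2 * (X * N) ^ 2 ≤ Y ^ 2 * 1 ^ 2 := by gcongr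
    rw [h3]
    calc _ ≤ ‖g2 p - g1 p‖ + ‖g1 p - (k p + shiftAvg P p)‖ := norm_add_le _ _
      _ ≤ 2 * (K5 * (Y ^ 2 * 1 ^ 2)) + K3 * Y ^ 2 := by
        refine add_le_add (h2.trans ?_) (h1.trans ha1)
        refine mul_le_mul hfac (ha2.trans (by gcongr)) ha20 (by norm_num)
      _ = (K3 + 2 * K5) * Y ^ 2 := by ring
      _ ≤ C * Y ^ 2 := by
        gcongr
        rw [hC]
        have h5 : 0 ≤ c * K1 / δ + 2 * (c * K4 / δ) := by positivity
        linarith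
  · have h1 := hH1 (U2 p) (hU2.maps hp)
    have h2 := hH2 p hp
    rw [← h2, ← h1]
    ring

end

/-! ### Rescaling -/

noncomputable section

variable {D s : ℝ} {p q : Phase}

/-- Multiplication of the actions by `a` and of the eccentricity variables by `b`.  For `b ^ 2 = a`
the symplectic form is multiplied by `a`. -/
def scale (a b : ℝ) : Phase →L[ℂ] Phase :=
  ((a : ℂ) • ContinuousLinearMap.id ℂ (Fin 2 → ℂ)).prodMap
    ((ContinuousLinearMap.id ℂ (Fin 2 → ℂ)).prodMap
      (((b : ℂ) • ContinuousLinearMap.id ℂ (Fin 2 → ℂ)).prodMap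
        ((b : ℂ) • ContinuousLinearMap.id ℂ (Fin 2 → ℂ))))

theorem scale_apply (a b : ℝ) (p : Phase) :
    scale a b p = ((a : ℂ) • p.1, p.2.1, (b : ℂ) • p.2.2.1, (b : ℂ) • p.2.2.2) := rfl

theorem scale_scale (a b a' b' : ℝ) (p : Phase) :
    scale a b (scale a' b' p) = scale (a * a') (b * b') p := by
  ext j <;> simp [scale_apply, mul_assoc]

theorem scale_one (p : Phase) : scale 1 1 p = p := by simp [scale_apply]

theorem scale_rot (a b θ : ℝ) (p : Phase) : scale a b (rot θ p) = rot θ (scale a b p) := by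
  simp only [scale_apply, rot_apply]
  rw [smul_comm (b : ℂ), smul_comm (b : ℂ)]

theorem scale_conjP (a b : ℝ) (p : Phase) : scale a b (conjP p) = conjP (scale a b p) := by
  ext j <;> simp [scale_apply, conjP_apply] <;> ring

theorem omega_scale {a b : ℝ} (h : b ^ 2 = a) (u v : Phase) :
    omega (scale a b u) (scale a b v) = a * omega u v := by
  have h' : (b : ℂ) ^ 2 = a := by exact_mod_cast h
  simp only [omega, scale_apply, Fin.sum_univ_two, Phase.act_def, Phase.ang_def, Phase.ecc_def,
    Phase.eccT_def, Pi.smul_apply, smul_eq_mul]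
  linear_combination (u.2.2.1 0 * v.2.2.2 0 - u.2.2.2 0 * v.2.2.1 0 + u.2.2.1 1 * v.2.2.2 1 -
    u.2.2.2 1 * v.2.2.1 1) * h'

theorem angMom_scale {a b : ℝ} (h : b ^ 2 = a) (p : Phase) :
    angMom (scale a b p) = a * angMom p := by
  have h' : (b : ℂ) ^ 2 = a := by exact_mod_cast h
  simp only [angMom, scale_apply, Phase.act_def, Phase.ecc_def, Phase.eccT_def, Pi.smul_apply,
    smul_eq_mul]
  linear_combination (-(Complex.I * p.2.2.1 0 * p.2.2.2 0) -
    Complex.I * p.2.2.1 1 * p.2.2.2 1) * h'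

theorem avg_comp_scale (c : ℂ) (a b : ℝ) (f : Phase → ℂ) (p : Phase) :
    avg (fun q => c * f (scale a b q)) p = c * avg f (scale a b p) := by
  simp only [avg, intervalIntegral.integral_const_mul]
  rw [mul_left_comm]
  rfl

theorem mem_nbhd_iff : p ∈ nbhd D s ↔ 0 < s ∧ (∀ j, ‖p.1 j‖ < s) ∧
    (∃ t : Fin 2 → ℝ, t 0 ∈ Icc D (2 * π - D) ∧ ∀ j, ‖p.2.1 j - t j‖ < s) ∧
    (∀ j, ‖p.2.2.1 j‖ < s) ∧ ∀ j, ‖p.2.2.2 j‖ < s := by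
  constructor
  · intro h
    obtain ⟨k, ⟨k1, ⟨t, ht, k2⟩, k3, k4⟩, hk⟩ := mem_thickening_iff.1 h
    have hs : 0 < s := dist_nonneg.trans_lt hk
    simp only [Phase.act_def, Phase.ang_def, Phase.ecc_def, Phase.eccT_def] at k1 k2 k3 k4
    rw [dist_eq_norm] at hk
    simp only [Prod.norm_def, max_lt_iff, pi_norm_lt_iff hs, Prod.fst_sub, Prod.snd_sub,
      Pi.sub_apply, k1, k2, k3, k4, sub_zero] at hk
    exact ⟨hs, hk.1, ⟨t, ht, hk.2.1⟩, hk.2.2.1, hk.2.2.2⟩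
  · rintro ⟨hs, h1, ⟨t, ht, h2⟩, h3, h4⟩
    refine mem_thickening_iff.2 ⟨((0, fun j => (t j : ℂ), 0, 0) : Phase),
      ⟨rfl, ⟨t, ht, fun j => rfl⟩, rfl, rfl⟩, ?_⟩
    rw [dist_eq_norm]
    simp only [Prod.norm_def, max_lt_iff, pi_norm_lt_iff hs, Prod.fst_sub, Prod.snd_sub,
      Pi.sub_apply, sub_zero]
    exact ⟨h1, h2, h3, h4⟩

section ScaledDomain

variable {a b σ r : ℝ}

theorem sqrt_domain (hb : 0 < b) (hab : b ^ 2 = a) (hr : 0 ≤ r * σ) :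
    √(r * (σ * a) * (r * σ)) = r * σ * b := by
  rw [show r * (σ * a) * (r * σ) = (r * σ * b) ^ 2 by rw [← hab]; ring,
    Real.sqrt_sq (by positivity)]

theorem scale_inv_mem_nbhd (hb : 0 < b) (hab : b ^ 2 = a) (hr : 0 ≤ r * σ) (hs : r * σ < s)
    (hp : p ∈ domain D (r * (σ * a)) (r * σ)) : scale a⁻¹ b⁻¹ p ∈ nbhd D s := by
  have ha : 0 < a := by rw [← hab]; positivity
  obtain ⟨h1, ⟨t, ht, h2⟩, h3, h4⟩ := hp
  rw [sqrt_domain hb hab hr] at h3 h4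
  simp only [Phase.act_def, Phase.ang_def, Phase.ecc_def, Phase.eccT_def] at h1 h2 h3 h4
  refine mem_nbhd_iff.2 ⟨by linarith, fun j => ?_, ⟨t, ht, fun j => (h2 j).trans_lt hs⟩,
    fun j => ?_, fun j => ?_⟩ <;>
    simp only [scale_apply, Pi.smul_apply, norm_smul, Complex.norm_real, Real.norm_eq_abs,
      abs_inv, abs_of_pos ha, abs_of_pos hb]
  · rw [inv_mul_lt_iff₀ ha]; nlinarith [h1 j]
  · rw [inv_mul_lt_iff₀ hb]; nlinarith [h3 j]
  · rw [inv_mul_lt_iff₀ hb]; nlinarith [h4 j]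

theorem scale_mem_domain (hb : 0 < b) (hab : b ^ 2 = a) (hs : s ≤ r * σ)
    (hp : p ∈ nbhd D s) : scale a b p ∈ domain D (r * (σ * a)) (r * σ) := by
  have ha : 0 < a := by rw [← hab]; positivity
  obtain ⟨hs0, h1, ⟨t, ht, h2⟩, h3, h4⟩ := mem_nbhd_iff.1 hp
  rw [domain, mem_ofPred_eq, sqrt_domain hb hab (by linarith)]
  refine ⟨fun j => ?_, ⟨t, ht, fun j => (h2 j).le.trans hs⟩, fun j => ?_, fun j => ?_⟩ <;>
    simp only [scale_apply, Phase.act_def, Phase.ecc_def, Phase.eccT_def, Pi.smul_apply, norm_smul,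
      Complex.norm_real, Real.norm_eq_abs, abs_of_pos ha, abs_of_pos hb]
  · nlinarith [h1 j]
  · nlinarith [h3 j]
  · nlinarith [h4 j]

end ScaledDomain

/-! ### The Keplerian part -/

/-- Remainder of the rescaled Keplerian energy of one planet, its linear part being subtracted. -/
def keplerRem (υ lam L : ℝ) (w : ℂ) : ℂ :=
  -(υ * lam * w ^ 2 * (3 * L + 2 * lam * w)) / (2 * (L + lam * w) ^ 2)

theorem keplerRem_spec {υ lam L b : ℝ} {w : ℂ} (hL : L ≠ 0) (hb : b = υ * L ^ 3)
    (hw : (L : ℂ) + lam * w ≠ 0) :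
    -((b : ℂ) / (2 * (L + lam * w) ^ 2)) =
      -((b : ℂ) / (2 * L ^ 2)) + lam * (υ * w + keplerRem υ lam L w) := by
  have hL' : (L : ℂ) ≠ 0 := by exact_mod_cast hL
  rw [keplerRem, hb]
  push_cast
  field_simp
  ring

theorem half_le_norm_add {lam L B : ℝ} {w : ℂ} (hlam : 0 < lam) (hw : ‖w‖ ≤ B)
    (hB : lam * B ≤ L / 2) : L / 2 ≤ ‖(L : ℂ) + lam * w‖ := by
  have h1 : ‖(lam : ℂ) * w‖ ≤ L / 2 := by
    rw [norm_mul, Complex.norm_of_nonneg hlam.le]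
    exact (mul_le_mul_of_nonneg_left hw hlam.le).trans hB
  have h2 := norm_sub_le ((L : ℂ) + lam * w) (lam * w)
  rw [add_sub_cancel_right, Complex.norm_real] at h2
  have := le_abs_self L
  rw [Real.norm_eq_abs] at h2
  linarith

theorem norm_keplerRem_le {υ lam L B : ℝ} {w : ℂ} (hυ : 0 < υ) (hlam : 0 < lam) (hL : 0 < L)
    (hw : ‖w‖ ≤ B) (hB : lam * B ≤ L / 2) :
    ‖keplerRem υ lam L w‖ ≤ 8 * υ * B ^ 2 / L * lam := by
  have h1 := half_le_norm_add hlam hw hB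
  have hB0 : 0 ≤ B := (norm_nonneg _).trans hw
  have h3 : ‖(3 * L + 2 * lam * w : ℂ)‖ ≤ 4 * L := by
    refine (norm_add_le _ _).trans ?_
    simp only [norm_mul, Complex.norm_real, Real.norm_eq_abs, abs_of_pos hL, abs_of_pos hlam,
      Complex.norm_ofNat]
    nlinarith
  rw [keplerRem, norm_div, norm_neg]
  have h4 : 2 * (L / 2) ^ 2 ≤ ‖(2 * ((L : ℂ) + lam * w) ^ 2)‖ := by
    rw [norm_mul, norm_pow, Complex.norm_ofNat]; gcongr
  calc _ ≤ (υ * lam * B ^ 2 * (4 * L)) / (2 * (L / 2) ^ 2) := by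
        refine div_le_div₀ (by positivity) ?_ (by positivity) h4
        simp only [norm_mul, norm_pow, Complex.norm_real, Real.norm_eq_abs, abs_of_pos hυ,
          abs_of_pos hlam]
        gcongr
    _ = _ := by field_simp; ring

theorem differentiableAt_keplerRem {υ lam L B : ℝ} {f : Phase → ℂ} (hf : DifferentiableAt ℂ f p)
    (hlam : 0 < lam) (hL : 0 < L) (hw : ‖f p‖ ≤ B) (hB : lam * B ≤ L / 2) :
    DifferentiableAt ℂ (fun p => keplerRem υ lam L (f p)) p := by
  have h1 := half_le_norm_add hlam hw hB
  have h2 : (2 * ((L : ℂ) + lam * f p) ^ 2) ≠ 0 := by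
    have : (L : ℂ) + lam * f p ≠ 0 := fun h => by
      rw [h, norm_zero] at h1; linarith
    exact mul_ne_zero two_ne_zero (pow_ne_zero 2 this)
  have h3 : DifferentiableAt ℂ
      (fun p => -((υ : ℂ) * lam * f p ^ 2 * (3 * L + 2 * lam * f p))) p := by fun_prop
  have h4 : DifferentiableAt ℂ (fun p => 2 * ((L : ℂ) + lam * f p) ^ 2) p := by fun_prop
  simp only [keplerRem, div_eq_mul_inv]
  exact h3.fun_mul (h4.fun_inv h2)

/-- In exact resonance both planets have the frequency `ups`. -/
theorem frequency_eq {m0 ups : ℝ} {m : Fin 2 → ℝ} (hm0 : 0 < m0) (hm : ∀ j, 0 < m j)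
    (hups : 0 < ups) {eps : ℝ} (he : 0 ≤ eps) (j : Fin 2) :
    (⟨m0, m, ups, eps⟩ : ThreeBody).redMass j ^ 3 * (⟨m0, m, ups, eps⟩ : ThreeBody).mu j ^ 2 =
      ups * (⟨m0, m, ups, eps⟩ : ThreeBody).Lam0 j ^ 3 := by
  have h1 := mu_pos m0 ups m hm0 hm he j
  simp only [ThreeBody.Lam0, ThreeBody.semiAxis0]
  set M := (⟨m0, m, ups, eps⟩ : ThreeBody).mu j
  have h2 : √(M * (M ^ (1 / 3 : ℝ) * ups ^ (-(2 / 3) : ℝ))) =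
      M ^ (2 / 3 : ℝ) * ups ^ (-(1 / 3) : ℝ) := by
    rw [← mul_assoc, ← Real.rpow_one_add' h1.le (by norm_num), Real.sqrt_eq_rpow,
      Real.mul_rpow (by positivity) (by positivity), ← Real.rpow_mul h1.le, ← Real.rpow_mul hups.le]
    norm_num
  have h3 : (M ^ (2 / 3 : ℝ)) ^ 3 = M ^ 2 := by
    rw [← Real.rpow_natCast, ← Real.rpow_mul h1.le, ← Real.rpow_natCast]; norm_num
  have h4 : (ups ^ (-(1 / 3) : ℝ)) ^ 3 = ups⁻¹ := by
    rw [← Real.rpow_natCast, ← Real.rpow_mul hups.le, ← Real.rpow_neg_one]; norm_num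
  rw [h2, mul_pow, mul_pow, h3, h4]
  field_simp

/-- After rescaling, the Keplerian part is the linear part `ups * Z_2` plus a small function of the
actions. -/
theorem exists_keplerian_remainder {m0 ups : ℝ} {m : Fin 2 → ℝ} (hm0 : 0 < m0)
    (hm : ∀ j, 0 < m j) (hups : 0 < ups) {s : ℝ} (hs : 0 < s) :
    ∃ Ck > 0, ∃ e1 > 0, ∀ D eps a b : ℝ, 0 < eps → eps < e1 → 0 < a → a < e1 →
    ∃ k : Phase → ℂ, DifferentiableOn ℂ k (nbhd D s) ∧ IsSym k (nbhd D s) ∧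
      (∀ p ∈ nbhd D s, ∀ t : ℝ, k (p + (t : ℂ) • fastDir) = k p) ∧
      (∀ p ∈ nbhd D s, ‖k p‖ ≤ Ck * a) ∧
      ∀ p ∈ nbhd D s, (⟨m0, m, ups, eps⟩ : ThreeBody).HK (scale a b p) =
        (⟨m0, m, ups, eps⟩ : ThreeBody).HK 0 + a * (ups * p.1 1 + k p) := by
  have hL0 := Lam0_pos m0 ups m hm0 hm hups le_rfl
  obtain ⟨l, hl, hlL⟩ : ∃ l > 0, ∀ j, l ≤ (⟨m0, m, ups, 0⟩ : ThreeBody).Lam0 j :=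
    ⟨_, lt_min (hL0 0) (hL0 1), Fin.forall_fin_two.2 ⟨min_le_left _ _, min_le_right _ _⟩⟩
  have hev : ∀ᶠ eps in 𝓝 (0 : ℝ), ∀ j, l / 2 < (⟨m0, m, ups, eps⟩ : ThreeBody).Lam0 j :=
    Filter.eventually_all.2 fun j => (continuousAt_Lam0 m0 ups m hm0 j).eventually
        (lt_mem_nhds (by have := hlL j; linarith))
  obtain ⟨e0, he0, hev⟩ := Metric.eventually_nhds_iff_ball.1 hev
  refine ⟨2 * (8 * ups * (2 * s) ^ 2 / (l / 2)), by positivity, min e0 (l / (8 * s)),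
    by positivity, ?_⟩
  intro D eps a b heps heps1 ha ha1
  have hLe := hev eps (by
    rw [mem_ball_zero_iff, Real.norm_eq_abs, abs_of_pos heps]
    exact heps1.trans_le (min_le_left _ _))
  have ha2 : a * (2 * s) ≤ l / 4 := by
    have h1 : a < l / (8 * s) := ha1.trans_le (min_le_right _ _)
    rw [lt_div_iff₀ (by positivity)] at h1
    linarith
  have hfreq := fun j => frequency_eq hm0 hm hups heps.le j
  set S : ThreeBody := ⟨m0, m, ups, eps⟩ with hS
  have hLp : ∀ j, 0 < S.Lam0 j := fun j => lt_trans (by positivity) (hLe j)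
  have hB : ∀ j, a * (2 * s) ≤ S.Lam0 j / 2 := fun j => by have := hLe j; linarith
  have hw0 : ∀ p ∈ nbhd D s, ‖p.1 0‖ ≤ 2 * s := fun p hp => by
    have := (mem_nbhd_iff.1 hp).2.1 0; linarith
  have hw1 : ∀ p ∈ nbhd D s, ‖p.1 1 - p.1 0‖ ≤ 2 * s := fun p hp => by
    have h0 := (mem_nbhd_iff.1 hp).2.1 0
    have h1 := (mem_nbhd_iff.1 hp).2.1 1
    exact (norm_sub_le _ _).trans (by linarith)
  have hCk : ∀ j, 8 * ups * (2 * s) ^ 2 / S.Lam0 j * a ≤ 8 * ups * (2 * s) ^ 2 / (l / 2) * a :=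
    fun j => by
      have := (hLe j).le
      gcongr
  refine ⟨fun p => keplerRem ups a (S.Lam0 0) (p.1 0) + keplerRem ups a (S.Lam0 1) (p.1 1 - p.1 0),
    fun p hp => ?_, ⟨fun p hp θ => ?_, fun p hp => ?_⟩, fun p hp t => ?_, fun p hp => ?_,
    fun p hp => ?_⟩
  · exact ((differentiableAt_keplerRem (f := fun p : Phase => p.1 0) (by fun_prop) ha (hLp 0)
      (hw0 p hp) (hB 0)).add (differentiableAt_keplerRem (f := fun p : Phase => p.1 1 - p.1 0)
      (by fun_prop) ha (hLp 1) (hw1 p hp) (hB 1))).differentiableWithinAt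
  · simp [rot_apply]
  · simp [conjP_apply, keplerRem]
  · simp [fastDir]
  · refine (norm_add_le _ _).trans ?_
    have h0 := (norm_keplerRem_le hups ha (hLp 0) (hw0 p hp) (hB 0)).trans (hCk 0)
    have h1 := (norm_keplerRem_le hups ha (hLp 1) (hw1 p hp) (hB 1)).trans (hCk 1)
    linarith
  · have hne : ∀ (j : Fin 2) (w : ℂ), ‖w‖ ≤ 2 * s → (S.Lam0 j : ℂ) + a * w ≠ 0 := by
      intro j w hw h
      have h1 := half_le_norm_add ha hw (hB j)
      rw [h, norm_zero] at h1
      have := hLp j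
      linarith
    have h0 := keplerRem_spec (hLp 0).ne' (hfreq 0) (hne 0 _ (hw0 p hp))
    have h1 := keplerRem_spec (hLp 1).ne' (hfreq 1) (hne 1 _ (hw1 p hp))
    have e1 : (S.Lam0 1 : ℂ) + a * p.1 1 - a * p.1 0 = S.Lam0 1 + a * (p.1 1 - p.1 0) := by ring
    simp only [ThreeBody.HK, scale_apply, Phase.act_def, Pi.smul_apply, smul_eq_mul, e1,
      Prod.fst_zero, Pi.zero_apply, add_zero, sub_zero, neg_div'] at h0 h1 ⊢
    linear_combination h0 + h1

end

/-! ### Transfer to the original variables -/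

noncomputable section

variable {D s s' d a b σ r : ℝ} {p q : Phase}

theorem scale_scale_inv (ha : 0 < a) (hb : 0 < b) (p : Phase) :
    scale a b (scale a⁻¹ b⁻¹ p) = p := by
  rw [scale_scale, mul_inv_cancel₀ ha.ne', mul_inv_cancel₀ hb.ne', scale_one]

theorem scale_inv_scale (ha : 0 < a) (hb : 0 < b) (p : Phase) :
    scale a⁻¹ b⁻¹ (scale a b p) = p := by
  rw [scale_scale, inv_mul_cancel₀ ha.ne', inv_mul_cancel₀ hb.ne', scale_one]

/-- The transformation `U` of the rescaled variables, in the original variables. -/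
def unscale (a b : ℝ) (U : Phase → Phase) (p : Phase) : Phase := scale a b (U (scale a⁻¹ b⁻¹ p))

theorem isOpen_scaled_nbhd : IsOpen {q | scale a b q ∈ nbhd D s} :=
  isOpen_nbhd.preimage (scale a b).continuous

theorem analyticOnNhd_comp_scale {F : Type*} [NormedAddCommGroup F] [NormedSpace ℂ F]
    [CompleteSpace F] {f : Phase → F} (hf : DifferentiableOn ℂ f (nbhd D s)) (hb : 0 < b)
    (hab : b ^ 2 = a) (hr : 0 ≤ r * σ) (hs : r * σ < s) :
    AnalyticOnNhd ℂ (fun q => f (scale a⁻¹ b⁻¹ q)) (domain D (r * (σ * a)) (r * σ)) := by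
  have h1 : DifferentiableOn ℂ (fun q => f (scale a⁻¹ b⁻¹ q)) {q | scale a⁻¹ b⁻¹ q ∈ nbhd D s} :=
    hf.comp (scale a⁻¹ b⁻¹).differentiable.differentiableOn fun _ hq => hq
  exact (analyticOnNhd_of_differentiableOn isOpen_scaled_nbhd h1).mono
    fun _ hq => scale_inv_mem_nbhd hb hab hr hs hq

theorem unscale_rot {U : Phase → Phase} (hU : IsNearIdentity D s s' d U)
    (hp : scale a⁻¹ b⁻¹ p ∈ nbhd D s) (θ : ℝ) :
    unscale a b U (rot θ p) = rot θ (unscale a b U p) := by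
  rw [unscale, scale_rot, hU.rot _ hp, scale_rot, unscale]

theorem norm_fderiv_sub_id_le {U : Phase → Phase} (hU : IsNearIdentity D σ s' d U) (hσ : 0 < σ)
    (hd : d ≤ σ / 20) : ∀ p ∈ nbhd D (σ - σ / 2), ‖fderiv ℂ (fun p => U p - p) p‖ ≤ 1 / 2 := by
  intro p hp
  refine (norm_fderiv_le_of_nbhd (half_pos hσ) (hU.diff.sub differentiableOn_id) hU.near
    hp).trans ?_
  rw [div_le_iff₀ (by positivity)]
  linarith

theorem isCanonical_unscale {U : Phase → Phase} (hU : IsNearIdentity D σ s' d U) (hσ : 0 < σ)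
    (hb : 0 < b) (hab : b ^ 2 = a) (hd : d ≤ σ / 20) :
    IsCanonical (unscale a b U) (domain D (1 / 3 * (σ * a)) (1 / 3 * σ)) := by
  have ha : 0 < a := by rw [← hab]; positivity
  have hmem : ∀ q ∈ domain D (1 / 3 * (σ * a)) (1 / 3 * σ), scale a⁻¹ b⁻¹ q ∈ nbhd D σ :=
    fun q hq => scale_inv_mem_nbhd hb hab (by positivity) (by linarith) hq
  have hab' : b⁻¹ ^ 2 = a⁻¹ := by rw [← hab, inv_pow]
  refine ⟨?_, ?_, fun p hp u v => ?_, fun p hp => ?_, fun p hp hre => ?_⟩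
  · exact analyticOnNhd_comp_scale ((scale a b).differentiable.comp_differentiableOn hU.diff) hb hab
      (by positivity) (by linarith)
  · intro p hp q hq hpq
    have h1 : ∀ q ∈ domain D (1 / 3 * (σ * a)) (1 / 3 * σ),
        scale a⁻¹ b⁻¹ q ∈ nbhd D (σ - σ / 2) := fun q hq =>
      scale_inv_mem_nbhd hb hab (by positivity) (by linarith) hq
    have h2 := injOn_id_add ((hU.diff.sub differentiableOn_id).mono (nbhd_mono (by linarith)))
      (norm_fderiv_sub_id_le hU hσ hd)
    have h3 := congrArg (scale a⁻¹ b⁻¹) hpq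
    rw [unscale, unscale, scale_inv_scale ha hb, scale_inv_scale ha hb] at h3
    have h4 := h2 (h1 p hp) (h1 q hq) (by simpa using h3)
    have h5 := congrArg (scale a b) h4
    rwa [scale_scale_inv ha hb, scale_scale_inv ha hb] at h5
  · have hUd := hU.diff.differentiableAt (isOpen_nbhd.mem_nhds (hmem p hp))
    have h1 : HasFDerivAt (unscale a b U)
        ((scale a b).comp ((fderiv ℂ U (scale a⁻¹ b⁻¹ p)).comp (scale a⁻¹ b⁻¹))) p :=
      (scale a b).hasFDerivAt.comp p (hUd.hasFDerivAt.comp p (scale a⁻¹ b⁻¹).hasFDerivAt)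
    rw [h1.fderiv]
    simp only [ContinuousLinearMap.comp_apply]
    rw [omega_scale hab, hU.symplectic _ (hmem p hp), omega_scale hab']
    have : (a : ℂ) ≠ 0 := by exact_mod_cast ha.ne'
    push_cast
    field_simp
  · rw [turn_eq, ← rot_two_pi, ← rot_two_pi, unscale_rot hU (hmem p hp)]
  · rw [mem_realPoints_iff] at hre ⊢
    rw [unscale, ← scale_conjP, ← hU.conj _ (hmem p hp), ← scale_conjP, hre]

theorem unscale_mem {U : Phase → Phase} (hU : IsNearIdentity D σ s' d U) (hσ : 0 < σ)
    (hb : 0 < b) (hab : b ^ 2 = a) (hd : d ≤ σ / 20)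
    (hp : p ∈ domain D (1 / 3 * (σ * a)) (1 / 3 * σ)) :
    unscale a b U p ∈ domain D (1 / 2 * (σ * a)) (1 / 2 * σ) := by
  have h1 : scale a⁻¹ b⁻¹ p ∈ nbhd D (2 / 5 * σ) :=
    scale_inv_mem_nbhd hb hab (by positivity) (by linarith) hp
  have h2 := hU.near _ (nbhd_mono (by linarith) h1)
  exact scale_mem_domain hb hab (by linarith) (mem_nbhd_of_norm_sub_le h1 (h2.trans hd))

theorem subset_image_unscale {U : Phase → Phase} (hU : IsNearIdentity D σ s' d U) (hσ : 0 < σ)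
    (hb : 0 < b) (hab : b ^ 2 = a) (hd : d ≤ σ / 20) :
    domain D (1 / 6 * (σ * a)) (1 / 6 * σ) ⊆
      unscale a b U '' domain D (1 / 3 * (σ * a)) (1 / 3 * σ) := by
  intro p hp
  have ha : 0 < a := by rw [← hab]; positivity
  have h1 : scale a⁻¹ b⁻¹ p ∈ nbhd D (1 / 5 * σ) :=
    scale_inv_mem_nbhd hb hab (by positivity) (by linarith) hp
  obtain ⟨m, hm, hmp⟩ := exists_id_add_eq (r := σ / 10)
    ((hU.diff.sub differentiableOn_id).mono (nbhd_mono (show σ - σ / 2 ≤ σ by linarith)))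
    (norm_fderiv_sub_id_le hU hσ hd) (by positivity) (nbhd_mono (by linarith) h1)
    ((hU.near _ (nbhd_mono (by linarith) h1)).trans (by linarith))
  have hm1 : m ∈ nbhd D (1 / 5 * σ + σ / 10) := closedBall_subset_nbhd h1 hm
  refine ⟨scale a b m, scale_mem_domain hb hab (by linarith) hm1, ?_⟩
  rw [Pi.sub_apply, id, add_sub_cancel] at hmp
  rw [unscale, scale_inv_scale ha hb, hmp, scale_scale_inv ha hb]

theorem angMom_unscale {U : Phase → Phase} (hU : IsNearIdentity D s s' d U) (hb : 0 < b)
    (hab : b ^ 2 = a) (hp : scale a⁻¹ b⁻¹ p ∈ nbhd D s) : angMom (unscale a b U p) = angMom p := by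
  have ha : 0 < a := by rw [← hab]; positivity
  rw [unscale, angMom_scale hab, hU.angMom _ hp, ← angMom_scale hab, scale_scale_inv ha hb]

theorem unscale_sub {U : Phase → Phase} (ha : 0 < a) (hb : 0 < b) (p : Phase) :
    p - unscale a b U p = scale a b (scale a⁻¹ b⁻¹ p - U (scale a⁻¹ b⁻¹ p)) := by
  rw [map_sub, scale_scale_inv ha hb, unscale]

theorem fderiv_angMom (p v : Phase) : fderiv ℂ angMom p v = v.1 1 -
    ∑ j, Complex.I * (p.2.2.1 j * v.2.2.2 j + p.2.2.2 j * v.2.2.1 j) := by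
  have hd : DifferentiableAt ℂ angMom p := by
    unfold angMom
    simp only [Phase.act_def, Phase.ecc_def, Phase.eccT_def]
    fun_prop
  have h1 : HasDerivAt (fun t : ℂ => angMom (p + t • v)) (fderiv ℂ angMom p v) 0 :=
    hd.hasFDerivAt.hasLineDerivAt v
  have h2 : (fun t : ℂ => angMom (p + t • v)) = fun t => angMom p + t * (v.1 1 -
      ∑ j, Complex.I * (p.2.2.1 j * v.2.2.2 j + p.2.2.2 j * v.2.2.1 j)) +
      t ^ 2 * -(∑ j, Complex.I * (v.2.2.1 j * v.2.2.2 j)) := by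
    ext t
    simp [angMom, Fin.sum_univ_two]
    ring
  rw [h2] at h1
  refine h1.unique ?_
  have h3 := (((hasDerivAt_id (0 : ℂ)).mul_const (v.1 1 -
    ∑ j, Complex.I * (p.2.2.1 j * v.2.2.2 j + p.2.2.2 j * v.2.2.1 j))).const_add (angMom p)).add
    (((hasDerivAt_id (0 : ℂ)).pow 2).mul_const (-(∑ j, Complex.I * (v.2.2.1 j * v.2.2.2 j))))
  refine (h3.congr_deriv ?_ :)
  simp

/-- The angular momentum generates the rotations. -/
theorem poisson_angMom {f : Phase → ℂ} (hf : DifferentiableAt ℂ f p)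
    (hrot : ∀ θ : ℝ, f (rot θ p) = f p) : poisson angMom f p = 0 := by
  have h1 := fderiv_rotGen hf hrot
  rw [apply_rotGen] at h1
  simp only [Fin.sum_univ_two] at h1
  simp only [poisson, fderiv_angMom, Fin.sum_univ_two]
  simp
  linear_combination h1

end

/-! ### The averaging theorem -/

noncomputable section

variable {D s a b σ r : ℝ} {p : Phase}

theorem DAlembert.congr {f g : Phase → ℂ} {K : Set Phase} (h : DAlembert f K)
    (hfg : ∀ p ∈ K, g p = f p) : DAlembert g K :=
  let ⟨c, h1, h2⟩ := h
  ⟨c, h1, fun p hp => by rw [hfg p hp]; exact h2 p hp⟩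

theorem scale_mem_tube (ha : 0 < a) (hb : 0 < b) (har : a * σ ≤ r) (hbr : b * σ ≤ r)
    (hp : p ∈ nbhd D σ) : scale a b p ∈ tube D σ r := by
  obtain ⟨-, h1, ⟨t, ht, h2⟩, h3, h4⟩ := mem_nbhd_iff.1 hp
  have key : ∀ {c : ℝ} {z : ℂ}, 0 < c → c * σ ≤ r → ‖z‖ < σ → ‖(c : ℂ) * z‖ < r := by
    intro c z hc hcr hz
    rw [norm_mul, Complex.norm_of_nonneg hc.le]
    exact (mul_lt_mul_of_pos_left hz hc).trans_le hcr
  rw [scale_apply]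
  exact ⟨fun j => by simpa using key ha har (h1 j), ⟨t, ht, fun j => (h2 j).le⟩,
    fun j => by simpa using key hb hbr (h3 j), fun j => by simpa using key hb hbr (h4 j)⟩

/-- Conditions on the small parameter which the averaging procedure needs. -/
theorem eventually_powers {beta : ℝ} (h1 : 1 / 7 < beta) (h2 : beta < 1 / 2) {μ e r B : ℝ}
    (hμ : 0 < μ) (he : 0 < e) (hr : 0 < r) : ∀ᶠ eps in 𝓝[>] (0 : ℝ),
    eps < 1 ∧ eps < e ∧ eps ^ beta < e ∧ eps ^ beta * B ≤ r ∧ eps ^ (beta / 2) * B ≤ r ∧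
      eps ^ beta * (1 / eps ^ ((1 - 2 * beta) / 5) + 1) ≤ μ := by
  have key : ∀ {c : ℝ}, 0 < c → Tendsto (fun eps : ℝ => eps ^ c) (𝓝[>] 0) (𝓝 0) := by
    intro c hc
    have := (Real.continuousAt_rpow_const 0 c (Or.inr hc.le)).tendsto
    rw [Real.zero_rpow hc.ne'] at this
    exact this.mono_left nhdsWithin_le_nhds
  have hid : Tendsto (fun eps : ℝ => eps) (𝓝[>] 0) (𝓝 0) := nhdsWithin_le_nhds
  have hβ := key (show 0 < beta by linarith)
  have hβ2 := key (show 0 < beta / 2 by linarith)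
  have hlast : Tendsto (fun eps : ℝ => eps ^ (beta - (1 - 2 * beta) / 5) + eps ^ beta) (𝓝[>] 0)
      (𝓝 0) := by
    simpa using (key (show 0 < beta - (1 - 2 * beta) / 5 by linarith)).add hβ
  have hm1 : Tendsto (fun eps : ℝ => eps ^ beta * B) (𝓝[>] 0) (𝓝 0) := by
    simpa using hβ.mul_const B
  have hm2 : Tendsto (fun eps : ℝ => eps ^ (beta / 2) * B) (𝓝[>] 0) (𝓝 0) := by
    simpa using hβ2.mul_const B
  filter_upwards [self_mem_nhdsWithin, hid.eventually_lt_const one_pos, hid.eventually_lt_const he,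
    hβ.eventually_lt_const he, hm1.eventually_lt_const hr, hm2.eventually_lt_const hr,
    hlast.eventually_lt_const hμ] with eps h0 e1 e2 e3 e4 e5 e6
  refine ⟨e1, e2, e3, e4.le, e5.le, le_trans (le_of_eq ?_) e6.le⟩
  rw [Real.rpow_sub h0]
  ring

theorem norm_scale_le (ha : 0 < a) (hb : 0 < b) (v : Phase) {c : ℝ} (hv : ‖v‖ ≤ c) :
    ‖(scale a b v).act‖ ≤ a * c ∧ ‖(scale a b v).ang‖ ≤ c ∧
      ‖((scale a b v).ecc, (scale a b v).eccT)‖ ≤ b * c := by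
  obtain ⟨h1, h2, h3, h4⟩ := Phase.norm_le_iff.1 hv
  rw [scale_apply]
  refine ⟨?_, h2, ?_⟩
  · refine (norm_smul_le _ _).trans ?_
    rw [Complex.norm_of_nonneg ha.le]
    gcongr
  · rw [Prod.norm_mk, max_le_iff]
    constructor
    all_goals
      refine (norm_smul_le _ _).trans ?_
      rw [Complex.norm_of_nonneg hb.le]
      gcongr

theorem avg_comp_scale_eq {f : Phase → ℂ} (hf : DifferentiableOn ℂ f (nbhd D s))
    (hsym : IsSym f (nbhd D s)) (hp : scale a b p ∈ nbhd D s) (c : ℂ) :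
    avg (fun q => c * f (scale a b q)) p = c * shiftAvg f (scale a b p) := by
  rw [avg_comp_scale, avg_eq_shiftAvg hf (fun q hq => hsym.periodic hq) hp]

theorem dAlembert_comp_scale {f : Phase → ℂ} (hf : DifferentiableOn ℂ f (nbhd D s))
    (hrot : ∀ p ∈ nbhd D s, ∀ θ : ℝ, f (rot θ p) = f p) (hσ : 0 < σ) (hb : 0 < b)
    (hab : b ^ 2 = a) (hr : 0 < r) (hs : r * σ < s) :
    DAlembert (fun q => f (scale a⁻¹ b⁻¹ q)) (domain D (r * (σ * a)) (r * σ)) := by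
  have ha : 0 < a := by rw [← hab]; positivity
  refine dAlembert_of_rot (by positivity) (by positivity)
    (analyticOnNhd_comp_scale hf hb hab (by positivity) hs) fun p hp θ => ?_
  rw [scale_rot, hrot _ (scale_inv_mem_nbhd hb hab (by positivity) hs hp)]

/-- A normal form of the rescaled Hamiltonian gives one of the Hamiltonian in the original
variables, with the estimates multiplied by the scaling factors. -/
theorem exists_normalForm_of_rescaled {S : ThreeBody} {HP k P g R : Phase → ℂ} {U : Phase → Phase}
    {d κ ρ η : ℝ} (hσ : 0 < σ) (hb : 0 < b) (hab : b ^ 2 = a) (hd : d ≤ σ / 20)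
    (hk : DifferentiableOn ℂ k (nbhd D (2 * σ))) (hksym : IsSym k (nbhd D (2 * σ)))
    (hkinv : ∀ p ∈ nbhd D (2 * σ), ∀ t : ℝ, k (p + (t : ℂ) • fastDir) = k p)
    (hHK : ∀ p ∈ nbhd D (2 * σ), S.HK (scale a b p) = S.HK 0 + a * (S.ups * p.1 1 + k p))
    (hP : DifferentiableOn ℂ P (nbhd D (2 * σ))) (hPsym : IsSym P (nbhd D (2 * σ)))
    (hHP : HP = fun q => (a : ℂ) * P (scale a⁻¹ b⁻¹ q))
    (hU : IsNearIdentity D σ (3 / 2 * σ) d U) (hg : IsNormalForm D σ κ ρ g R)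
    (hgk : ∀ p ∈ nbhd D σ, ‖g p - (k p + shiftAvg P p)‖ ≤ η)
    (hconj : ∀ p ∈ nbhd D σ,
      S.ups * (U p).1 1 + k (U p) + P (U p) = S.ups * p.1 1 + g p + R p) :
    let K : ℝ → Set Phase := fun q => domain D (q * (σ * a)) (q * σ)
    DAlembert (fun p => S.HK p + HP p) (K 1) ∧
    ∃ (U : Phase → Phase) (Hs : Phase → ℂ), IsCanonical U (K (1 / 3)) ∧
      K (1 / 6) ⊆ U '' K (1 / 3) ∧ U '' K (1 / 3) ⊆ K (1 / 2) ∧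
      AnalyticOnNhd ℂ Hs (K (1 / 3)) ∧
      (∀ p ∈ K (1 / 3), S.HK (U p) + HP (U p) = S.HK p + avg HP p + Hs p) ∧
      (∀ p ∈ K (1 / 3), ‖avg Hs p‖ ≤ a * η) ∧ (∀ p ∈ K (1 / 3), ‖Hs p - avg Hs p‖ ≤ a * ρ) ∧
      (∀ p ∈ K (1 / 3), ‖p.act - (U p).act‖ ≤ a * d) ∧
      (∀ p ∈ K (1 / 3), ‖p.ang - (U p).ang‖ ≤ d) ∧
      (∀ p ∈ K (1 / 3), ‖(p.ecc, p.eccT) - ((U p).ecc, (U p).eccT)‖ ≤ b * d) ∧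
      (∀ f : Phase → ℂ, AnalyticOnNhd ℂ f (K (1 / 2)) → DAlembert f (K (1 / 2)) →
        DAlembert (fun p => f (U p)) (K (1 / 3))) ∧
      DAlembert (fun p => S.HK (U p) + HP (U p)) (K (1 / 3)) ∧
      (∀ p ∈ K (1 / 3), angMom (U p) = angMom p) ∧
      ∀ p ∈ K (1 / 3), poisson angMom (fun y => S.HK y + avg HP y + avg Hs y) p = 0 := by
  intro K
  have ha : 0 < a := by rw [← hab]; positivity
  have hmono : nbhd D σ ⊆ nbhd D (2 * σ) := nbhd_mono (by linarith)
  have hmem : ∀ p ∈ K (1 / 3), scale a⁻¹ b⁻¹ p ∈ nbhd D σ := fun p hp =>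
    scale_inv_mem_nbhd hb hab (by positivity) (by linarith) hp
  have hcan := isCanonical_unscale hU hσ hb hab hd
  have hmaps : ∀ p ∈ K (1 / 3), unscale a b U p ∈ K (1 / 2) := fun p hp =>
    unscale_mem hU hσ hb hab hd hp
  -- the Hamiltonian and its average in the rescaled variables
  have hHK' : ∀ q, scale a⁻¹ b⁻¹ q ∈ nbhd D (2 * σ) →
      S.HK q = S.HK 0 + a * (S.ups * (scale a⁻¹ b⁻¹ q).1 1 + k (scale a⁻¹ b⁻¹ q)) := fun q hq => by
    rw [← hHK _ hq, scale_scale_inv ha hb]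
  have hPavg : ∀ q, scale a⁻¹ b⁻¹ q ∈ nbhd D (2 * σ) →
      avg HP q = a * shiftAvg P (scale a⁻¹ b⁻¹ q) := fun q hq => by
    rw [hHP, avg_comp_scale_eq hP hPsym hq]
  -- the remainder in the rescaled variables, and its average
  obtain ⟨A, hA⟩ : ∃ A : Phase → ℂ, A = fun p => g p - (k p + shiftAvg P p) := ⟨_, rfl⟩
  obtain ⟨w, hw⟩ : ∃ w : Phase → ℂ, w = fun p => A p + R p := ⟨_, rfl⟩
  have hAd : DifferentiableOn ℂ A (nbhd D σ) := by
    rw [hA]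
    exact hg.diff_g.sub ((hk.add (differentiableOn_shiftAvg hP)).mono hmono)
  have hAsym : IsSym A (nbhd D σ) := by
    rw [hA]
    exact hg.sym_g.sub ((hksym.add hPsym.shiftAvg).mono hmono)
  have hAinv : ∀ p ∈ nbhd D σ, shiftAvg A p = A p := fun p hp => by
    refine shiftAvg_of_invariant fun t => ?_
    rw [hA]
    simp only
    rw [hg.inv_g p hp, hkinv p (hmono hp),
      shiftAvg_add (fun q hq => hPsym.periodic hq) (hmono hp)]
  have hwd : DifferentiableOn ℂ w (nbhd D σ) := by
    rw [hw]
    exact hAd.add hg.diff_R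
  have hwsym : IsSym w (nbhd D σ) := by
    rw [hw]
    exact hAsym.add hg.sym_R
  have hwavg : ∀ p ∈ nbhd D σ, shiftAvg w p = A p := fun p hp => by
    have h1 : R = fun p => w p - A p := by
      ext p
      rw [hw]
      ring
    have h2 := hg.avg_R p hp
    rw [h1, shiftAvg_sub hwd.continuousOn hAd.continuousOn hp, hAinv p hp] at h2
    exact sub_eq_zero.1 h2
  obtain ⟨Hs, hHs⟩ : ∃ Hs : Phase → ℂ, Hs = fun q => (a : ℂ) * w (scale a⁻¹ b⁻¹ q) := ⟨_, rfl⟩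
  have hHsavg : ∀ q, scale a⁻¹ b⁻¹ q ∈ nbhd D σ → avg Hs q = a * A (scale a⁻¹ b⁻¹ q) :=
    fun q hq => by rw [hHs, avg_comp_scale_eq hwd hwsym hq, hwavg _ hq]
  have hanorm : ‖(a : ℂ)‖ = a := Complex.norm_of_nonneg ha.le
  have hdiff : ∀ p ∈ K (1 / 3), ‖scale a⁻¹ b⁻¹ p - U (scale a⁻¹ b⁻¹ p)‖ ≤ d := fun p hp => by
    rw [norm_sub_rev]
    exact hU.near _ (hmem p hp)
  have hcomp : ∀ f : Phase → ℂ, AnalyticOnNhd ℂ f (K (1 / 2)) → DAlembert f (K (1 / 2)) →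
      DAlembert (fun p => f (unscale a b U p)) (K (1 / 3)) := fun f hf hfD => by
    refine dAlembert_of_rot (by positivity) (by positivity) (hf.comp hcan.analytic hmaps)
      fun p hp θ => ?_
    rw [unscale_rot hU (hmem p hp)]
    exact rot_of_dAlembert hfD (hmaps p hp) (rot_mem_domain (hmaps p hp) θ)
  obtain ⟨F, hF⟩ : ∃ F : Phase → ℂ, F = fun p => S.HK 0 + a * (S.ups * p.1 1 + k p + P p) :=
    ⟨_, rfl⟩
  have hFd : DifferentiableOn ℂ F (nbhd D (2 * σ)) := by
    rw [hF]
    have h1 : Differentiable ℂ fun p : Phase => (S.ups : ℂ) * p.1 1 := by fun_prop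
    exact (((h1.differentiableOn.add hk).add hP).const_mul _).const_add _
  have hFrot : ∀ p ∈ nbhd D (2 * σ), ∀ θ : ℝ, F (rot θ p) = F p := fun p hp θ => by
    rw [hF]
    simp only
    rw [hksym.rot p hp, hPsym.rot p hp, rot_apply]
  have hFeq : ∀ r, 0 < r → r ≤ 1 → ∀ q ∈ K r, S.HK q + HP q = F (scale a⁻¹ b⁻¹ q) := by
    intro r hr hr1 q hq
    rw [hHK' q (scale_inv_mem_nbhd hb hab (by positivity) (by nlinarith) hq), hHP, hF]
    ring
  have hFD := fun (r : ℝ) (hr : 0 < r) (hr1 : r ≤ 1) =>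
    dAlembert_comp_scale hFd hFrot hσ hb hab hr (by nlinarith)
  refine ⟨(hFD 1 one_pos le_rfl).congr (hFeq 1 one_pos le_rfl), unscale a b U, Hs, hcan,
    subset_image_unscale hU hσ hb hab hd, image_subset_iff.2 hmaps, ?_, fun p hp => ?_,
    fun p hp => ?_, fun p hp => ?_, fun p hp => ?_, fun p hp => ?_, fun p hp => ?_, hcomp, ?_,
    fun p hp => angMom_unscale hU hb hab (hmem p hp), fun p hp => ?_⟩
  · rw [hHs]
    exact analyticOnNhd_const.mul
      (analyticOnNhd_comp_scale hwd hb hab (by positivity) (by linarith))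
  · have h1 := hconj _ (hmem p hp)
    have h2 := hHK _ (nbhd_mono (by linarith) (hU.maps (hmem p hp)))
    rw [hHK' p (hmono (hmem p hp)), hPavg p (hmono (hmem p hp)), hHs, hw, hA, hHP, unscale, h2]
    simp only [scale_inv_scale ha hb]
    linear_combination (a : ℂ) * h1
  · rw [hHsavg p (hmem p hp), norm_mul, hanorm, hA]
    exact mul_le_mul_of_nonneg_left (hgk _ (hmem p hp)) ha.le
  · rw [hHsavg p (hmem p hp), hHs, hw]
    simp only
    rw [← mul_sub, add_sub_cancel_left, norm_mul, hanorm]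
    exact mul_le_mul_of_nonneg_left (hg.R_le _ (hmem p hp)) ha.le
  · have h1 := (norm_scale_le ha hb _ (hdiff p hp)).1
    rw [← unscale_sub ha hb] at h1
    exact h1
  · have h1 := (norm_scale_le ha hb _ (hdiff p hp)).2.1
    rw [← unscale_sub ha hb] at h1
    exact h1
  · have h1 := (norm_scale_le ha hb _ (hdiff p hp)).2.2
    rw [← unscale_sub ha hb] at h1
    exact h1
  · refine (hcomp (fun q => F (scale a⁻¹ b⁻¹ q))
      (analyticOnNhd_comp_scale hFd hb hab (by positivity) (by linarith))
      (hFD (1 / 2) (by norm_num) (by norm_num))).congr fun p hp => ?_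
    exact hFeq (1 / 2) (by norm_num) (by norm_num) _ (hmaps p hp)
  · obtain ⟨G, hG⟩ : ∃ G : Phase → ℂ, G = fun p => S.HK 0 + a * (S.ups * p.1 1 + g p) := ⟨_, rfl⟩
    have hGd : DifferentiableOn ℂ G (nbhd D σ) := by
      rw [hG]
      have h1 : Differentiable ℂ fun p : Phase => (S.ups : ℂ) * p.1 1 := by fun_prop
      exact ((h1.differentiableOn.add hg.diff_g).const_mul _).const_add _
    have hev : (fun y => S.HK y + avg HP y + avg Hs y) =ᶠ[𝓝 p]
        fun q => G (scale a⁻¹ b⁻¹ q) := by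
      have h2 : ∀ᶠ q in 𝓝 p, scale a⁻¹ b⁻¹ q ∈ nbhd D σ :=
        (scale a⁻¹ b⁻¹).continuous.continuousAt.eventually (isOpen_nbhd.mem_nhds (hmem p hp))
      filter_upwards [h2] with q hq
      rw [hHK' q (hmono hq), hPavg q (hmono hq), hHsavg q hq, hG, hA]
      ring
    have h1 : poisson angMom (fun q => G (scale a⁻¹ b⁻¹ q)) p = 0 := by
      refine poisson_angMom (f := fun q => G (scale a⁻¹ b⁻¹ q))
        ((hGd.differentiableAt (isOpen_nbhd.mem_nhds (hmem p hp))).comp p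
          (scale a⁻¹ b⁻¹).differentiableAt) fun θ => ?_
      rw [scale_rot, hG]
      simp only
      rw [hg.sym_g.rot _ (hmem p hp), rot_apply]
    rw [← h1, poisson, poisson, hev.fderiv_eq]

end

end Coorbital

open Coorbital in
/-- First averaging theorem for the planar three-body problem in 1:1 resonance. -/
theorem theorem2 (m0 m1 m2 ups : ℝ) (hm0 : 0 < m0) (hm1 : 0 < m1) (hm2 : 0 < m2)
    (hups : 0 < ups) :
    ∃ c > 0, ∀ D : ℝ, 0 < D → D ≤ Real.pi → ∀ sig0 : ℝ, 0 < sig0 → sig0 < c * D →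
    ∀ beta : ℝ, 1 / 7 < beta → beta < 1 / 2 →
    ∃ C > 0, ∃ eps0 > 0, ∀ eps : ℝ, 0 < eps → eps < eps0 →
    let S : ThreeBody := ⟨m0, ![m1, m2], ups, eps⟩
    let alpha : ℝ := (1 - 2 * beta) / 5
    let K : ℝ → Set Phase := fun q => domain D (q * (sig0 * eps ^ beta)) (q * sig0)
    ∃ HP : Phase → ℂ, S.IsPerturbation (K 1) HP ∧
      DAlembert (fun p => S.HK p + HP p) (K 1) ∧
    ∃ (U : Phase → Phase) (Hs : Phase → ℂ),
      IsCanonical U (K (1 / 3)) ∧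
      K (1 / 6) ⊆ U '' K (1 / 3) ∧ U '' K (1 / 3) ⊆ K (1 / 2) ∧
      -- the transformed Hamiltonian
      AnalyticOnNhd ℂ Hs (K (1 / 3)) ∧
      (∀ p ∈ K (1 / 3), S.HK (U p) + HP (U p) = S.HK p + avg HP p + Hs p) ∧
      (∀ p ∈ K (1 / 3), ‖avg Hs p‖ ≤ C * eps ^ (2 - beta)) ∧
      (∀ p ∈ K (1 / 3), ‖Hs p - avg Hs p‖ ≤ C * (eps * Real.exp (-(1 / eps ^ alpha)))) ∧
      -- size of the transformation
      (∀ p ∈ K (1 / 3), ‖p.act - (U p).act‖ ≤ C * eps) ∧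
      (∀ p ∈ K (1 / 3), ‖p.ang - (U p).ang‖ ≤ C * eps ^ (1 - beta)) ∧
      (∀ p ∈ K (1 / 3), ‖(p.ecc, p.eccT) - ((U p).ecc, (U p).eccT)‖
        ≤ C * eps ^ (1 - beta / 2)) ∧
      -- the D'Alembert rule and the angular momentum are preserved
      (∀ f : Phase → ℂ, AnalyticOnNhd ℂ f (K (1 / 2)) → DAlembert f (K (1 / 2)) →
        DAlembert (fun p => f (U p)) (K (1 / 3))) ∧
      DAlembert (fun p => S.HK (U p) + HP (U p)) (K (1 / 3)) ∧
      (∀ p ∈ K (1 / 3), angMom (U p) = angMom p) ∧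
      (∀ p ∈ K (1 / 3), poisson angMom (fun y => S.HK y + avg HP y + avg Hs y) p = 0) := by
  obtain ⟨m, hm⟩ : ∃ m, m = ![m1, m2] := ⟨_, rfl⟩
  have hmpos : ∀ j, 0 < m j := by
    rw [hm]
    exact Fin.forall_fin_two.2 ⟨hm1, hm2⟩
  refine ⟨1 / 2, by norm_num, fun D hD _ σ hσ hσD beta hb1 hb2 => ?_⟩
  obtain ⟨r, hr, M, hM, e0, he0, hpert⟩ :=
    exists_perturbation hm0 hmpos hups (D := D) (s := 2 * σ) (by positivity) (by linarith)
  obtain ⟨Ck, hCk, e1, he1, hkep⟩ :=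
    exists_keplerian_remainder hm0 hmpos hups (s := 2 * σ) (by positivity)
  obtain ⟨μ, hμ, C, hC, haver⟩ := exists_averaging hσ hups hCk hM
  obtain ⟨e2, he2, hpow⟩ := mem_nhdsGT_iff_exists_Ioo_subset.1
    (eventually_powers hb1 hb2 hμ (lt_min he0 he1) hr (B := 2 * σ))
  refine ⟨C, hC, e2, he2, fun eps heps heps2 => ?_⟩
  obtain ⟨hp1, hp2, hp3, hp4, hp5, hp6⟩ := hpow ⟨heps, heps2⟩
  rw [← hm]
  intro S alpha K
  obtain ⟨P, hPd, hPM, hPsym, hPreal⟩ := hpert eps heps (hp2.trans_le (min_le_left _ _))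
  -- the scaling factors, and the size of the rescaled perturbation
  obtain ⟨a, ha⟩ : ∃ a, a = eps ^ beta := ⟨_, rfl⟩
  obtain ⟨b, hb⟩ : ∃ b, b = eps ^ (beta / 2) := ⟨_, rfl⟩
  obtain ⟨Y, hY⟩ : ∃ Y, Y = eps ^ (1 - beta) := ⟨_, rfl⟩
  have ha0 : 0 < a := by rw [ha]; positivity
  have hb0 : 0 < b := by rw [hb]; positivity
  have hY0 : 0 < Y := by rw [hY]; positivity
  have hab : b ^ 2 = a := by
    rw [hb, ha, ← Real.rpow_natCast, ← Real.rpow_mul heps.le]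
    norm_num
  have haY : a * Y = eps := by
    rw [ha, hY, ← Real.rpow_add heps]
    norm_num
  have hYa : Y ≤ a := by
    rw [ha, hY]
    exact Real.rpow_le_rpow_of_exponent_ge heps hp1.le (by linarith)
  have haYY : a * Y ^ 2 = eps ^ (2 - beta) := by
    rw [pow_two, ← mul_assoc, haY, hY, ← Real.rpow_one_add' heps.le (by linarith)]
    ring_nf
  have hbY : b * Y = eps ^ (1 - beta / 2) := by
    rw [hb, hY, ← Real.rpow_add heps]
    ring_nf
  rw [← ha] at hp3 hp4 hp6
  rw [← hb] at hp5
  obtain ⟨N, hN⟩ : ∃ N, N = ⌈1 / eps ^ alpha⌉₊ := ⟨_, rfl⟩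
  have hN1 : 1 ≤ N := by
    rw [hN]
    exact Nat.one_le_ceil_iff.2 (by positivity)
  have hNle : (1 / eps ^ alpha) ≤ N := by
    rw [hN]
    exact Nat.le_ceil _
  have hNμ : a * N ≤ μ := by
    refine le_trans ?_ hp6
    rw [hN]
    exact mul_le_mul_of_nonneg_left (Nat.ceil_lt_add_one (by positivity)).le ha0.le
  obtain ⟨k, hk1, hk2, hk3, hk4, hk5⟩ := hkep D eps a b heps (hp2.trans_le (min_le_right _ _)) ha0
    (hp3.trans_le (min_le_right _ _))
  obtain ⟨P', hP'⟩ : ∃ P' : Phase → ℂ, P' = fun p => (a : ℂ)⁻¹ * P (scale a b p) := ⟨_, rfl⟩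
  have htube : ∀ p ∈ nbhd D (2 * σ), scale a b p ∈ tube D (2 * σ) r := fun p hp =>
    scale_mem_tube ha0 hb0 hp4 hp5 hp
  have hP'd : DifferentiableOn ℂ P' (nbhd D (2 * σ)) := fun p hp => by
    rw [hP']
    exact (((hPd _ (htube p hp)).comp p (scale a b).differentiableAt).const_mul
      _).differentiableWithinAt
  have hP'sym : IsSym P' (nbhd D (2 * σ)) := by
    rw [hP']
    refine ⟨fun p hp θ => ?_, fun p hp => ?_⟩
    · rw [scale_rot, hPsym.rot _ (htube p hp)]
    · rw [scale_conjP, hPsym.conj _ (htube p hp)]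
      simp
  have hP'M : ∀ p ∈ nbhd D (2 * σ), ‖P' p‖ ≤ M * Y := fun p hp => by
    have h1 := hPM _ (htube p hp)
    rw [hP']
    simp only [norm_mul, norm_inv, Complex.norm_of_nonneg ha0.le]
    rw [inv_mul_le_iff₀ ha0]
    refine h1.trans (le_of_eq ?_)
    rw [← haY]
    ring
  have hPP' : P = fun q => (a : ℂ) * P' (scale a⁻¹ b⁻¹ q) := by
    have : (a : ℂ) ≠ 0 := by exact_mod_cast ha0.ne'
    ext q
    rw [hP']
    simp only
    rw [scale_scale_inv ha0 hb0, mul_inv_cancel_left₀ this]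
  obtain ⟨U, g, R, κ, h1, h2, h3, h4, h5⟩ :=
    haver D a Y N ha0 hY0 hYa hN1 hNμ k P' hk1 hk2 hk3 hk4 hP'd hP'sym hP'M
  obtain ⟨q1, U', Hs, q2, q3, q4, q5, q6, q7, q8, q9, q10, q11, q12, q13, q14, q15⟩ :=
    exists_normalForm_of_rescaled (S := S) hσ hb0 hab h1 hk1 hk2 hk3 hk5 hP'd hP'sym hPP' h2 h3 h4
      h5
  have hK : K = fun q => domain D (q * (σ * a)) (q * σ) := by rw [ha]
  rw [← hK] at q1 q2 q3 q4 q5 q6 q7 q8 q9 q10 q11 q12 q13 q14 q15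
  have hK1 : ∀ p ∈ K 1, scale a⁻¹ b⁻¹ p ∈ nbhd D (2 * σ) := fun p hp => by
    rw [hK] at hp
    exact scale_inv_mem_nbhd hb0 hab (by positivity) (by linarith) hp
  have hK1' : K 1 ⊆ tube D (2 * σ) r := fun p hp => by
    rw [← scale_scale_inv ha0 hb0 p]
    exact htube _ (hK1 p hp)
  have hPan : AnalyticOnNhd ℂ P (K 1) := by
    rw [hPP', hK]
    exact analyticOnNhd_const.mul
      (analyticOnNhd_comp_scale hP'd hb0 hab (by positivity) (by linarith))
  refine ⟨P, ⟨hPan, fun Z zeta x hx => hPreal Z zeta x (hK1' hx)⟩, q1, U', Hs, q2, q3, q4, q5, q6,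
    fun p hp => (q7 p hp).trans (le_of_eq ?_), fun p hp => (q8 p hp).trans ?_,
    fun p hp => (q9 p hp).trans (le_of_eq ?_), fun p hp => (q10 p hp).trans (le_of_eq ?_),
    fun p hp => (q11 p hp).trans (le_of_eq ?_), q12, q13, q14, q15⟩
  · rw [← haYY]
    ring
  · rw [← haY]
    calc a * (C * Y * Real.exp (-N)) = C * (a * Y * Real.exp (-N)) := by ring
      _ ≤ _ := by
        rw [haY]
        gcongr
  · rw [← haY]
    ring
  · rw [hY]
  · rw [← hbY]
    ring
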